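/- Notation. All function spaces are over $\mathbb{R}^2$ and complex valued; $e^{it\Delta}$ is the free Schrödinger group on $L^2$ and $\|f\|_{\dot H^s}=\|(-\Delta)^{s/2}f\|_{L^2}$. The energy is $$E[f]=\frac12\int_{\mathbb{R}^2}|\nabla f|^2\,dx-\frac16\int_{\mathbb{R}^2}|f|^6\,dx .$$ A pair $(q,r)$ with $2\le q,r\le\infty$ and $(q,r)\ne(2,\infty)$ is $\dot H^{1/2}$-admissible if $\frac2q+\frac2r=\frac12$. Fix a number $4^+\in(4,8)$, put $(4^+)'=\frac{4\cdot 4^+}{4^+-4}$, and let $$\|u\|_{S(\dot H^{1/2})}=\sup\big\{\|u\|_{L^q_tL^r_x(\mathbb{R}\times\mathbb{R}^2)} : (q,r)\ \dot H^{1/2}\text{-admissible},\ 4^+\le q\le\infty,\ 4^+\le r\le(4^+)'\big\}.$$ Proposition (linear profile decomposition and energy Pythagorean expansion). Let $(\phi_n)$ be a bounded sequence in $H^1(\mathbb{R}^2)$. (A) After passing to a subsequence (still denoted $\phi_n$), there are profiles $\psi^j\in H^1$ ($j\ge1$, independent of $n$), time shifts $t_n^j\in\mathbb{R}$, space shifts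 $x_n^j\in\mathbb{R}^2$, and remainders $W_n^M\in H^1$ ($M\ge0$), such that for all $M$ and $n$ $$\phi_n(x)=\sum_{j=1}^M e^{-it_n^j\Delta}\psi^j(x-x_n^j)+W_n^M(x),$$ and the following hold. 1. (Pairwise divergence) For $j\ne k$, $\displaystyle\lim_{n\to\infty}\big(|t_n^j-t_n^k|+|x_n^j-x_n^k|\big)=+\infty$. 2. (Asymptotic smallness) For every $M$ the limit $\lim_{n\to\infty}\|e^{it\Delta}W_n^M\|_{S(\dot H^{1/2})}$ exists, and $$\lim_{M\to\infty}\Big(\lim_{n\to\infty}\|e^{it\Delta}W_n^M\|_{S(\dot H^{1/2})}\Big)=0 .$$ 3. (Pythagorean expansion) For every $M$ and every $0\le s\le1$, as $n\to\infty$, $$\|\phi_n\|_{\dot H^s}^2=\sum_{j=1}^M\|\psi^j\|_{\dot H^s}^2+\|W_n^M\|_{\dot H^s}^2+o_n(1).$$ (B) For every subsequence of $(\phi_n)$ and every decomposition of it as in (A), that is, with $\psi^j, W_n^M\in H^1$, the displayed identity for all $M,n$, and properties 1–3, one has for every $M$, as $n\to\infty$, $$E[\phi_n]=\sum_{j=1}^M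 E\big[e^{-it_n^j\Delta}\psi^j\big]+E[W_n^M]+o_n(1).$$ -/

import Mathlib

open MeasureTheory FourierTransform TemperedDistribution Filter Topology
open scoped ENNReal SchwartzMap LineDeriv

noncomputable section

namespace ProfileDecomposition

/-- The Euclidean plane `ℝ²`. -/
abbrev Plane : Type := EuclideanSpace ℝ (Fin 2)

/-- The complex Hilbert space `L²(ℝ²)`. -/
abbrev L2 : Type := Lp ℂ 2 (volume : Measure Plane)

/-- `f ∈ H¹(ℝ²)`. -/
def MemH1 (f : L2) : Prop :=
  MemSobolev 1 2 (f : 𝓢'(Plane, ℂ))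

/-- `g` is the weak (distributional) partial derivative `∂ᵢ f`. -/
def IsWeakPartial (i : Fin 2) (f g : L2) : Prop :=
  ∂_{EuclideanSpace.single i (1 : ℝ)} (f : 𝓢'(Plane, ℂ)) = (g : 𝓢'(Plane, ℂ))

open Classical in
/-- The weak partial derivative `∂ᵢ f` as an element of `L²(ℝ²)`; it is unique, it exists for
every `f ∈ H¹(ℝ²)`, and `0` is used where it does not exist. -/
def weakPartial (i : Fin 2) (f : L2) : L2 :=
  if h : ∃ g : L2, IsWeakPartial i f g then h.choose else 0

theorem isWeakPartial_weakPartial {f : L2} (hf : MemH1 f) (i : Fin 2) :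
    IsWeakPartial i f (weakPartial i f) := by
  have h : ∃ g : L2, IsWeakPartial i f g := by
    have h1 := MemSobolev.lineDerivOp (m := EuclideanSpace.single i (1 : ℝ)) hf
    rw [sub_self] at h1
    exact memSobolev_zero_iff.mp h1
  rw [weakPartial, dif_pos h]
  exact h.choose_spec

/-- `‖∇f‖²` in `L²(ℝ²)`. -/
def gradNormSq (f : L2) : ℝ := ∑ i : Fin 2, ‖weakPartial i f‖ ^ 2

/-- `‖f‖` in `H¹(ℝ²)`. -/
def h1Norm (f : L2) : ℝ := Real.sqrt (‖f‖ ^ 2 + gradNormSq f)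

/-- `‖f‖` in `Ḣˢ(ℝ²)`, that is the `L²` norm of `(-Δ)^(s/2) f`. In Mathlib's normalisation of the
Fourier transform, the symbol of `(-Δ)^(1/2)` is `2π|ξ|`. -/
def hsNorm (s : ℝ) (f : L2) : ℝ :=
  Real.sqrt (∫ ξ : Plane, (2 * Real.pi * ‖ξ‖) ^ (2 * s) * ‖(𝓕 f : L2) ξ‖ ^ 2)

/-- The symbol `exp(-4π²it|ξ|²)` of `e^{itΔ}`. -/
def schrodingerSymbol (t : ℝ) (ξ : Plane) : ℂ :=
  Complex.exp (((-(4 * Real.pi ^ 2 * t * ‖ξ‖ ^ 2) : ℝ) : ℂ) * Complex.I)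

theorem memLp_schrodingerSymbol_mul (t : ℝ) (g : L2) :
    MemLp (fun ξ : Plane => schrodingerSymbol t ξ * g ξ) 2 volume := by
  have hc : Continuous (schrodingerSymbol t) := by
    unfold schrodingerSymbol
    fun_prop
  refine (Lp.memLp g).of_le (hc.aestronglyMeasurable.mul (Lp.aestronglyMeasurable g))
    (Eventually.of_forall fun ξ => ?_)
  rw [norm_mul, schrodingerSymbol, Complex.norm_exp_ofReal_mul_I, one_mul]

/-- The free Schrödinger group `e^{itΔ}` on `L²(ℝ²)`. -/
def schrodinger (t : ℝ) (f : L2) : L2 :=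
  𝓕⁻ (memLp_schrodingerSymbol_mul t (𝓕 f)).toLp

/-- The translate `f(· - y)`. -/
def translate (y : Plane) (f : L2) : L2 :=
  Lp.compMeasurePreserving (fun x : Plane => x - y) (measurePreserving_sub_right volume y) f

/-- The energy `E[f] = (1/2) ∫ |∇f|² - (1/6) ∫ |f|⁶`. -/
def energy (f : L2) : ℝ :=
  (1 / 2) * gradNormSq f - (1 / 6) * ∫ x : Plane, ‖f x‖ ^ 6

/-- The pair `(q, r)` is `Ḣˢ`-Strichartz admissible in dimension two. -/
def Admissible (s : ℝ) (q r : ℝ≥0∞) : Prop :=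
  2 / q + 2 / r = ENNReal.ofReal (1 - s) ∧ 2 ≤ q ∧ 2 ≤ r ∧ ¬(q = 2 ∧ r = ∞)

/-- The mixed norm `‖u‖` in `L^q_t L^r_x` over `ℝ × ℝ²`. -/
def mixedNorm (q r : ℝ≥0∞) (u : ℝ → L2) : ℝ≥0∞ :=
  eLpNorm (fun t : ℝ => eLpNorm (u t) r volume) q volume

/-- The Strichartz norm `‖u‖` in `S(Ḣ^{1/2})`, where `a` is the fixed number `4⁺` and
`4a / (a - 4)` is `(4⁺)'`: the supremum of the `L^q_t L^r_x` norms over the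
`Ḣ^{1/2}`-admissible pairs with `a ≤ q ≤ ∞` and `a ≤ r ≤ 4a / (a - 4)`. -/
def strichartzNorm (a : ℝ) (u : ℝ → L2) : ℝ≥0∞ :=
  ⨆ (q : ℝ≥0∞) (r : ℝ≥0∞) (_ : Admissible (1 / 2) q r ∧ ENNReal.ofReal a ≤ q ∧
    ENNReal.ofReal a ≤ r ∧ r ≤ ENNReal.ofReal (4 * a / (a - 4))), mixedNorm q r u

/-- The profiles `ψ j`, time shifts `t j n`, space shifts `x j n` and remainders `W M n` form a
linear profile decomposition of the sequence `φ n`. Profiles are indexed by `j = 0, 1, 2, …`, so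
that the first `M` of them are those with `j < M`. -/
structure IsLinearProfileDecomposition (a : ℝ) (φ : ℕ → L2) (ψ : ℕ → L2) (t : ℕ → ℕ → ℝ)
    (x : ℕ → ℕ → Plane) (W : ℕ → ℕ → L2) : Prop where
  profile_memH1 : ∀ j, MemH1 (ψ j)
  remainder_memH1 : ∀ M n, MemH1 (W M n)
  decomposition : ∀ M n,
    φ n = ∑ j ∈ Finset.range M, translate (x j n) (schrodinger (-(t j n)) (ψ j)) + W M n
  divergence : ∀ j k, j ≠ k →
    Tendsto (fun n => |t j n - t k n| + ‖x j n - x k n‖) atTop atTop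
  smallness : ∃ ℓ : ℕ → ℝ≥0∞,
    (∀ M, Tendsto (fun n => strichartzNorm a (fun τ => schrodinger τ (W M n))) atTop (𝓝 (ℓ M))) ∧
    Tendsto ℓ atTop (𝓝 0)
  pythagorean : ∀ M, ∀ s : ℝ, 0 ≤ s → s ≤ 1 →
    Tendsto (fun n => hsNorm s (φ n) ^ 2 -
      (∑ j ∈ Finset.range M, hsNorm s (ψ j) ^ 2 + hsNorm s (W M n) ^ 2)) atTop (𝓝 0)

end ProfileDecomposition

end

/-!
The proof is carried out on the frequency side and reduces the profile decomposition to a statement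
about unitary representations.

*The representation.* With `w(ξ) = √(1 + (2π|ξ|)²)`, the Bessel potential
`bessel G = 𝓕⁻¹(w⁻¹ G)` is an isometry of `L²` onto `H¹`. Under it, a space-time translation
`translate x ∘ schrodinger (-t)` becomes the multiplication `freqShift (t, x)` by the unimodular
function `exp(i(4π²t|ξ|² - 2π⟨x, ξ⟩))`, and the `Ḣˢ` norms with `0 ≤ s ≤ 1` become norms of bounded
multiplication operators that commute with all `freqShift γ`. The operators `freqShift γ` form a
strongly continuous unitary representation of `ℝ × ℝ²` on `L²` whose matrix coefficients vanish at
infinity (`isMixingRep_freqShift`): this is the Riemann–Lebesgue lemma for bounded `t`, and van der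
Corput's differencing for `|t| → ∞`.

*Profiles.* For any such representation `U` of a finite-dimensional space on a Hilbert space,
`IsMixingRep.exists_profiles` extracts profiles greedily: each is a weak limit of `U(-γ) W` that has
at least half of the largest norm possible. Mixing makes the parameters diverge and gives the
orthogonality relations. Since the squared norms of the profiles are summable, the remainders `W`
satisfy `⟨U(γ) χ, W⟩ → 0` uniformly in `γ`, for each `χ`. All limits are taken along one ultrafilter;
a subsequence is chosen only once, at the end (`exists_strictMono_tendsto`).

*Smallness.* The dyadic piece of the wave `e^{itΔ} bessel G` at frequencies `|ξ| ∼ 2ᵏ` is, at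
`(t, x)`, the matrix coefficient `⟨U(t, x) χₖ, G⟩` of a fixed `χₖ ∈ L²` (`besselPart_annulus_ae_eq`).
Hence weak smallness of the remainders is smallness of finitely many pieces in `L^∞`, and summation
over `k` gives smallness in `L^∞_t L^p_x` for `2 < p < ∞`. Every admissible pair in the range of the
Strichartz norm lies between `L^∞_t L⁴_x` and `L⁴_t L^∞_x`, so it remains to bound the latter norm.
This is the Strichartz inequality `exists_strichartz`. For one dyadic piece it is proved by squaring:
the square of the piece is an integral over `ℝ² × ℝ²`, where the change of variables to sum and
difference of frequencies leaves an oscillatory integral with phase `t|ζ|²`, which is bounded in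
`L²_t` by the `L²` norm of its density (`lintegral_oscInt_sq_le`).

*Energy.* The gradient term expands by the Pythagorean expansion with `s = 1`. For the sixth power of
the `L⁶` norm, a remainder with a small Strichartz norm is small in `L⁸`, because waves bounded in
`H¹` are equicontinuous in time, and then small in `L⁶` by interpolation with `L⁴`. Profiles decouple
(`tendsto_norm_sum_besselSix_pow_six`): a profile whose times escape to infinity vanishes in `L⁶`, and
the others are close to translates of compactly supported functions, which become disjoint. Writing
both `φ n` and `W M n` as sums of profiles up to a large index and one late remainder gives the
expansion.
-/

noncomputable section

namespace ProfileDecomposition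

/-! ### Multiplication operators on `L²` -/

open Classical in
/-- Multiplication by the essentially bounded function `m` as a bounded operator on `L²`; it is `0`
when `m` is not in `L^∞`. -/
def mulOp (m : Plane → ℂ) : L2 →L[ℂ] L2 :=
  if h : MemLp m ∞ (volume : Measure Plane) then
    LinearMap.mkContinuous
      { toFun := fun f => ((h.toLp m : Lp ℂ ∞ (volume : Measure Plane)) • f : L2)
        map_add' := fun _ _ => MeasureTheory.Lp.add_smul _ _ _
        map_smul' := fun c f => (MeasureTheory.Lp.smul_comm c _ f).symm }
      ‖(h.toLp m : Lp ℂ ∞ (volume : Measure Plane))‖ (fun f => MeasureTheory.Lp.norm_smul_le _ f)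
  else 0

theorem coeFn_mulOp {m : Plane → ℂ} (h : MemLp m ∞ (volume : Measure Plane)) (f : L2) :
    mulOp m f =ᵐ[volume] fun ξ => m ξ * f ξ := by
  have h1 : mulOp m f = ((h.toLp m : Lp ℂ ∞ (volume : Measure Plane)) • f : L2) := by
    rw [mulOp, dif_pos h]; rfl
  rw [h1]
  filter_upwards [Lp.coeFn_lpSMul (r := 2) (h.toLp m : Lp ℂ ∞ (volume : Measure Plane)) f,
    h.coeFn_toLp] with ξ h2 h3
  rw [h2, Pi.smul_apply', h3, smul_eq_mul]

theorem memLp_top_of_norm_le {m : Plane → ℂ} (hm : Measurable m) {C : ℝ} (hC : ∀ ξ, ‖m ξ‖ ≤ C) :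
    MemLp m ∞ (volume : Measure Plane) :=
  memLp_top_of_bound hm.aestronglyMeasurable C (Eventually.of_forall hC)

theorem norm_mulOp_le {m : Plane → ℂ} (hm : MemLp m ∞ (volume : Measure Plane)) {C : ℝ}
    (hC : ∀ ξ, ‖m ξ‖ ≤ C) (f : L2) : ‖mulOp m f‖ ≤ C * ‖f‖ := by
  refine Lp.norm_le_mul_norm_of_ae_le_mul ?_
  filter_upwards [coeFn_mulOp hm f] with ξ h1
  rw [h1, norm_mul]
  exact mul_le_mul_of_nonneg_right (hC ξ) (norm_nonneg _)

theorem norm_sq_eq_integral (f : L2) : ‖f‖ ^ 2 = ∫ ξ, ‖f ξ‖ ^ 2 := by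
  have h : (inner ℂ f f : ℂ) = ∫ ξ, inner ℂ (f ξ) (f ξ) := L2.inner_def f f
  have h2 : (‖f‖ ^ 2 : ℝ) = RCLike.re (inner ℂ f f : ℂ) := by
    rw [inner_self_eq_norm_sq]
  rw [h2, h, ← integral_re (L2.integrable_inner f f)]
  refine integral_congr_ae (Eventually.of_forall fun ξ => ?_)
  simp only [inner_self_eq_norm_sq]

/-! ### Fourier transform on `L²`: pointwise descriptions -/

theorem ae_eq_of_integral_schwartz_smul_eq {f g : Plane → ℂ}
    (hf : LocallyIntegrable f) (hg : LocallyIntegrable g)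
    (h : ∀ φ : 𝓢(Plane, ℂ), ∫ x, φ x • f x = ∫ x, φ x • g x) : f =ᵐ[volume] g := by
  refine ae_eq_of_integral_contDiff_smul_eq hf hg fun φ hφ hc => ?_
  have hc' : HasCompactSupport (fun x => (φ x : ℂ)) :=
    hc.comp_left (g := fun r : ℝ => (r : ℂ)) Complex.ofReal_zero
  have hφ' : ContDiff ℝ (↑(⊤ : ℕ∞)) (fun x => (φ x : ℂ)) :=
    Complex.ofRealCLM.contDiff.comp hφ
  have := h (hc'.toSchwartzMap hφ')
  simpa using this

theorem locallyIntegrable_L2 (f : L2) : LocallyIntegrable (f : Plane → ℂ) :=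
  (Lp.memLp f).locallyIntegrable (by norm_num)

/-- On `L¹ ∩ L²` the inverse Fourier transform of `L²` is given by the usual integral. -/
theorem fourierInv_toLp_ae_eq {g : Plane → ℂ} (h1 : Integrable g) (h2 : MemLp g 2 volume) :
    ((𝓕⁻ (h2.toLp g) : L2) : Plane → ℂ) =ᵐ[volume] 𝓕⁻ g := by
  have hcont : Continuous (𝓕⁻ g) := by
    have := VectorFourier.fourierIntegral_continuous (μ := (volume : Measure Plane))
      (L := -innerₗ Plane) Real.continuous_fourierChar (by
        exact continuous_inner.neg) h1
    exact this
  refine ae_eq_of_integral_schwartz_smul_eq (locallyIntegrable_L2 _) hcont.locallyIntegrable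
    fun φ => ?_
  have e1 : ∫ x, φ x • (𝓕⁻ (h2.toLp g) : L2) x
      = (Lp.toTemperedDistribution (𝓕⁻ (h2.toLp g) : L2)) φ := by
    rw [Lp.toTemperedDistribution_apply]
  rw [e1, ← Lp.fourierInv_toTemperedDistribution_eq, TemperedDistribution.fourierInv_apply,
    Lp.toTemperedDistribution_apply]
  have e2 : ∫ x, (𝓕⁻ φ) x • (h2.toLp g) x = ∫ x, (𝓕⁻ φ) x • g x := by
    refine integral_congr_ae ?_
    filter_upwards [h2.coeFn_toLp] with x hx
    rw [hx]
  rw [e2, SchwartzMap.fourierInv_coe]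
  have := VectorFourier.integral_fourierIntegral_smul_eq_flip (μ := (volume : Measure Plane))
    (ν := (volume : Measure Plane)) (L := -innerₗ Plane) (f := φ) (g := g)
    Real.continuous_fourierChar (by exact continuous_inner.neg) φ.integrable h1
  rw [show (-innerₗ Plane).flip = -innerₗ Plane by
    ext x y; simp [real_inner_comm]] at this
  exact this

/-- Translation corresponds to multiplication by a character on the Fourier side. By density this is
an identity of integrals for Schwartz functions. -/
theorem fourier_translate (y : Plane) (f : L2) :
    (𝓕 (translate y f) : L2) =
      mulOp (fun ξ => Complex.exp (((-(2 * Real.pi * inner ℝ y ξ) : ℝ) : ℂ) * Complex.I))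
        (𝓕 f) := by
  set m : Plane → ℂ :=
    fun ξ => Complex.exp (((-(2 * Real.pi * inner ℝ y ξ) : ℝ) : ℂ) * Complex.I) with hm
  have hmc : Continuous m := by fun_prop
  have hmn : ∀ ξ, ‖m ξ‖ = 1 := fun ξ => Complex.norm_exp_ofReal_mul_I _
  have hmem : MemLp m ∞ (volume : Measure Plane) :=
    memLp_top_of_norm_le hmc.measurable (fun ξ => (hmn ξ).le)
  suffices H : ∀ g : L2, translate y (𝓕⁻ g) = 𝓕⁻ (mulOp m g) by
    have := H (𝓕 f)
    rw [FourierTransform.fourierInv_fourier_eq] at this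
    rw [this, FourierTransform.fourier_fourierInv_eq]
  intro g
  have hdense := SchwartzMap.denseRange_toLpCLM (E := Plane) (F := ℂ) (p := 2)
    ENNReal.ofNat_ne_top (μ := volume)
  refine hdense.induction_on (p := fun g => translate y (𝓕⁻ g) = 𝓕⁻ (mulOp m g)) g ?_ ?_
  · refine isClosed_eq ?_ ?_
    · have h1 : Isometry (translate y) := by
        refine AddMonoidHomClass.isometry_of_norm
          (Lp.compMeasurePreserving (fun x : Plane => x - y)
            (measurePreserving_sub_right volume y)) (fun f => ?_)
        exact Lp.norm_compMeasurePreserving f _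
      exact h1.continuous.comp (Lp.fourierTransformₗᵢ Plane ℂ).symm.continuous
    · exact (Lp.fourierTransformₗᵢ Plane ℂ).symm.continuous.comp (mulOp m).continuous
  · intro φ
    have hφ2 : MemLp (φ : Plane → ℂ) 2 volume := φ.memLp 2
    have e0 : SchwartzMap.toLpCLM ℝ ℂ 2 volume φ = hφ2.toLp φ := rfl
    have hmφ2 : MemLp (fun ξ => m ξ * φ ξ) 2 volume := by
      refine hφ2.of_le (hmc.aestronglyMeasurable.mul hφ2.1) (Eventually.of_forall fun ξ => ?_)
      rw [norm_mul, hmn, one_mul]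
    have hmφ1 : Integrable (fun ξ => m ξ * φ ξ) := by
      refine φ.integrable.mono (hmc.aestronglyMeasurable.mul hφ2.1)
        (Eventually.of_forall fun ξ => ?_)
      rw [norm_mul, hmn, one_mul]
    have e1 : mulOp m (hφ2.toLp φ) = hmφ2.toLp _ := by
      apply Lp.ext
      filter_upwards [coeFn_mulOp hmem (hφ2.toLp φ), hφ2.coeFn_toLp, hmφ2.coeFn_toLp]
        with ξ h1 h2 h3
      rw [h1, h2, h3]
    rw [e0, e1]
    apply Lp.ext
    have h3 := fourierInv_toLp_ae_eq φ.integrable hφ2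
    have h4 := fourierInv_toLp_ae_eq hmφ1 hmφ2
    have h5 := Lp.coeFn_compMeasurePreserving (𝓕⁻ (hφ2.toLp φ) : L2)
      (measurePreserving_sub_right (volume : Measure Plane) y)
    have h6 := (measurePreserving_sub_right (volume : Measure Plane) y).quasiMeasurePreserving.ae h3
    filter_upwards [h4, h5, h6] with x h4 h5 h6
    rw [h4]
    refine h5.trans ?_
    rw [Function.comp_apply, h6, Real.fourierInv_eq', Real.fourierInv_eq']
    refine integral_congr_ae (Eventually.of_forall fun ξ => ?_)
    simp only [hm, smul_eq_mul]
    rw [← mul_assoc, ← Complex.exp_add, inner_sub_right, real_inner_comm ξ y]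
    congr 2
    push_cast
    ring

theorem coeFn_fourier_schrodinger (t : ℝ) (f : L2) :
    (𝓕 (schrodinger t f) : L2) =ᵐ[volume] fun ξ => schrodingerSymbol t ξ * (𝓕 f : L2) ξ := by
  rw [schrodinger, FourierTransform.fourier_fourierInv_eq]
  exact (memLp_schrodingerSymbol_mul t (𝓕 f)).coeFn_toLp

/-- Multiplication of an `L²` function by `m` in the sense of distributions is pointwise
multiplication. -/
theorem smulLeftCLM_toTemperedDistribution_eq_iff {m : Plane → ℂ} (hm : m.HasTemperateGrowth)
    (f g : L2) :
    smulLeftCLM ℂ m (f : 𝓢'(Plane, ℂ)) = (g : 𝓢'(Plane, ℂ)) ↔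
      g =ᵐ[volume] fun ξ => m ξ * f ξ := by
  have key : ∀ φ : 𝓢(Plane, ℂ), smulLeftCLM ℂ m (f : 𝓢'(Plane, ℂ)) φ
      = ∫ x, φ x • (m x * f x) := by
    intro φ
    rw [smulLeftCLM_apply_apply, Lp.toTemperedDistribution_apply]
    refine integral_congr_ae (Eventually.of_forall fun x => ?_)
    simp only [SchwartzMap.smulLeftCLM_apply_apply hm, smul_eq_mul]
    ring
  constructor
  · intro h
    symm
    refine ae_eq_of_integral_schwartz_smul_eq ?_ (locallyIntegrable_L2 _) fun φ => ?_
    · exact (locallyIntegrable_L2 f).continuous_mul hm.1.continuous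
    · rw [← key, h, Lp.toTemperedDistribution_apply]
  · intro h
    ext φ
    rw [key, Lp.toTemperedDistribution_apply]
    refine integral_congr_ae ?_
    filter_upwards [h] with x hx
    rw [hx]

/-! ### The Bessel potential -/

/-- The weight `(1 + |2πξ|²)^(1/2)` of `H¹`. -/
def weight (ξ : Plane) : ℝ := Real.sqrt (1 + (2 * Real.pi * ‖ξ‖) ^ 2)

theorem continuous_weight : Continuous weight := by unfold weight; fun_prop

theorem one_le_weight (ξ : Plane) : 1 ≤ weight ξ := by
  rw [weight, Real.one_le_sqrt]
  nlinarith [sq_nonneg (2 * Real.pi * ‖ξ‖)]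

theorem weight_pos (ξ : Plane) : 0 < weight ξ := lt_of_lt_of_le one_pos (one_le_weight ξ)

theorem weight_sq (ξ : Plane) : weight ξ ^ 2 = 1 + (2 * Real.pi * ‖ξ‖) ^ 2 :=
  Real.sq_sqrt (by positivity)

theorem norm_le_weight (ξ : Plane) : 2 * Real.pi * ‖ξ‖ ≤ weight ξ := by
  rw [weight]
  exact Real.le_sqrt_of_sq_le (by linarith)

/-- Mathlib defines Sobolev spaces with the weight `(1 + |ξ|²)^(1/2)`, which is comparable to
`weight`. -/
theorem memH1_iff (f : L2) :
    MemH1 f ↔ MemLp (fun ξ => (weight ξ : ℂ) * (𝓕 f : L2) ξ) 2 volume := by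
  have hg : (fun x : Plane => (((1 + ‖x‖ ^ 2) ^ ((1 : ℝ) / 2) : ℝ) : ℂ)).HasTemperateGrowth := by
    fun_prop
  have h1 : MemH1 f ↔
      MemLp (fun ξ => (((1 + ‖ξ‖ ^ 2) ^ ((1 : ℝ) / 2) : ℝ) : ℂ) * (𝓕 f : L2) ξ) 2 volume := by
    rw [MemH1, memSobolev_iff_exists_smulLeftCLM_fourier, Lp.fourier_toTemperedDistribution_eq]
    constructor
    · rintro ⟨f', hf'⟩
      exact (memLp_congr_ae ((smulLeftCLM_toTemperedDistribution_eq_iff hg _ _).1 hf')).1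
        (Lp.memLp f')
    · intro h
      exact ⟨h.toLp, (smulLeftCLM_toTemperedDistribution_eq_iff hg _ _).2 h.coeFn_toLp⟩
  rw [h1]
  have hms : AEStronglyMeasurable (𝓕 f : L2) (volume : Measure Plane) := Lp.aestronglyMeasurable _
  constructor
  · intro h
    refine h.of_le_mul (c := 2 * Real.pi) ?_ (Eventually.of_forall fun ξ => ?_)
    · exact (Complex.continuous_ofReal.comp continuous_weight).aestronglyMeasurable.mul hms
    · rw [norm_mul, norm_mul, ← mul_assoc]
      refine mul_le_mul_of_nonneg_right ?_ (norm_nonneg _)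
      rw [Complex.norm_real, Complex.norm_real, Real.norm_eq_abs, Real.norm_eq_abs,
        abs_of_pos (weight_pos ξ), abs_of_pos (by positivity), ← Real.sqrt_eq_rpow]
      rw [weight]
      refine Real.sqrt_le_iff.2 ⟨by positivity, ?_⟩
      rw [mul_pow (2 * Real.pi) (Real.sqrt _), Real.sq_sqrt (by positivity)]
      nlinarith [Real.pi_gt_three, sq_nonneg ‖ξ‖]
  · intro h
    refine h.of_le ?_ (Eventually.of_forall fun ξ => ?_)
    · exact hg.1.continuous.aestronglyMeasurable.mul hms
    · rw [norm_mul, norm_mul]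
      refine mul_le_mul_of_nonneg_right ?_ (norm_nonneg _)
      rw [Complex.norm_real, Complex.norm_real, Real.norm_eq_abs, Real.norm_eq_abs,
        abs_of_pos (weight_pos ξ), abs_of_pos (by positivity), ← Real.sqrt_eq_rpow, weight]
      refine Real.sqrt_le_sqrt ?_
      have hpi : 0 ≤ 4 * Real.pi ^ 2 - 1 := by nlinarith [Real.pi_gt_three]
      nlinarith [mul_nonneg hpi (sq_nonneg ‖ξ‖)]

theorem memLp_top_weight_inv : MemLp (fun ξ => ((weight ξ)⁻¹ : ℂ)) ∞ (volume : Measure Plane) := by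
  refine memLp_top_of_norm_le (C := 1) ?_ fun ξ => ?_
  · exact (Complex.measurable_ofReal.comp continuous_weight.measurable).inv
  · rw [norm_inv, Complex.norm_real, Real.norm_eq_abs, abs_of_pos (weight_pos ξ)]
    exact inv_le_one_of_one_le₀ (one_le_weight ξ)

/-- The Bessel potential `(1 - Δ)^(-1/2)`, which maps `L²` isometrically onto `H¹`. -/
def bessel (G : L2) : L2 := 𝓕⁻ (mulOp (fun ξ => ((weight ξ)⁻¹ : ℂ)) G)

theorem fourier_bessel (G : L2) :
    (𝓕 (bessel G) : L2) =ᵐ[volume] fun ξ => ((weight ξ)⁻¹ : ℂ) * G ξ := by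
  rw [bessel, FourierTransform.fourier_fourierInv_eq]
  exact coeFn_mulOp memLp_top_weight_inv G

theorem bessel_add (F G : L2) : bessel (F + G) = bessel F + bessel G := by
  rw [bessel, map_add]
  exact (Lp.fourierTransformₗᵢ Plane ℂ).symm.map_add _ _

theorem bessel_sub (F G : L2) : bessel (F - G) = bessel F - bessel G := by
  rw [bessel, map_sub]
  exact (Lp.fourierTransformₗᵢ Plane ℂ).symm.map_sub _ _

theorem memH1_bessel (G : L2) : MemH1 (bessel G) := by
  rw [memH1_iff]
  refine (memLp_congr_ae ?_).1 (Lp.memLp G)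
  filter_upwards [fourier_bessel G] with ξ h
  rw [h, mul_inv_cancel_left₀]
  exact_mod_cast (weight_pos ξ).ne'

theorem exists_bessel_eq {f : L2} (hf : MemH1 f) : ∃ G, f = bessel G := by
  rw [memH1_iff] at hf
  refine ⟨hf.toLp, ?_⟩
  have h : (𝓕 f : L2) = 𝓕 (bessel hf.toLp) := by
    apply Lp.ext
    filter_upwards [fourier_bessel hf.toLp, hf.coeFn_toLp] with ξ h1 h2
    rw [h1, h2, inv_mul_cancel_left₀]
    exact_mod_cast (weight_pos ξ).ne'
  exact (Lp.fourierTransformₗᵢ Plane ℂ).injective h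

theorem hsNorm_sq (s : ℝ) (f : L2) : hsNorm s f ^ 2 =
    ∫ ξ : Plane, (2 * Real.pi * ‖ξ‖) ^ (2 * s) * ‖(𝓕 f : L2) ξ‖ ^ 2 := by
  rw [hsNorm, Real.sq_sqrt]
  exact integral_nonneg fun ξ => by positivity

/-- The symbol `|2πξ|^s (1 + |2πξ|²)^(-1/2)` of `(-Δ)^(s/2) (1 - Δ)^(-1/2)`, which is bounded for
`0 ≤ s ≤ 1`. -/
def hsSymbol (s : ℝ) (ξ : Plane) : ℂ := (((2 * Real.pi * ‖ξ‖) ^ s / weight ξ : ℝ) : ℂ)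

theorem norm_hsSymbol_le {s : ℝ} (h0 : 0 ≤ s) (h1 : s ≤ 1) (ξ : Plane) : ‖hsSymbol s ξ‖ ≤ 1 := by
  rw [hsSymbol, Complex.norm_real, Real.norm_eq_abs,
    abs_of_nonneg (div_nonneg (by positivity) (weight_pos ξ).le), div_le_one (weight_pos ξ)]
  rcases le_total (2 * Real.pi * ‖ξ‖) 1 with h | h
  · exact (Real.rpow_le_one (by positivity) h h0).trans (one_le_weight ξ)
  · refine (Real.rpow_le_rpow_of_exponent_le h h1).trans ?_
    rw [Real.rpow_one]
    exact norm_le_weight ξ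

theorem memLp_top_hsSymbol {s : ℝ} (h0 : 0 ≤ s) (h1 : s ≤ 1) :
    MemLp (hsSymbol s) ∞ (volume : Measure Plane) := by
  refine memLp_top_of_norm_le (C := 1) ?_ (norm_hsSymbol_le h0 h1)
  refine Complex.measurable_ofReal.comp (Measurable.div ?_ continuous_weight.measurable)
  exact (measurable_const.mul measurable_norm).pow_const s

theorem hsNorm_bessel_sq {s : ℝ} (h0 : 0 ≤ s) (h1 : s ≤ 1) (G : L2) :
    hsNorm s (bessel G) ^ 2 = ‖mulOp (hsSymbol s) G‖ ^ 2 := by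
  rw [hsNorm_sq, norm_sq_eq_integral]
  refine integral_congr_ae ?_
  filter_upwards [fourier_bessel G, coeFn_mulOp (memLp_top_hsSymbol h0 h1) G] with ξ h1 h2
  rw [h1, h2, norm_mul, norm_mul, mul_pow, mul_pow, ← mul_assoc]
  congr 1
  rw [hsSymbol, norm_inv, Complex.norm_real, Complex.norm_real, Real.norm_eq_abs, Real.norm_eq_abs,
    sq_abs, inv_pow, sq_abs, div_pow, mul_comm 2 s, Real.rpow_mul (by positivity)]
  norm_num
  rfl

theorem gradNormSq_eq_hsNorm_sq {f : L2} (hf : MemH1 f) : gradNormSq f = hsNorm 1 f ^ 2 := by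
  have hpart : ∀ i, (𝓕 (weakPartial i f) : L2) =ᵐ[volume]
      fun ξ => (2 * Real.pi * Complex.I * ξ i) * (𝓕 f : L2) ξ := by
    intro i
    have h := isWeakPartial_weakPartial hf i
    rw [IsWeakPartial] at h
    have hm : (fun ξ : Plane =>
        ((inner ℝ ξ (EuclideanSpace.single i (1 : ℝ)) : ℝ) : ℂ)).HasTemperateGrowth := by
      fun_prop
    have h2 : smulLeftCLM ℂ (fun ξ : Plane => (2 * Real.pi * Complex.I) •
        ((inner ℝ ξ (EuclideanSpace.single i (1 : ℝ)) : ℝ) : ℂ)) ((𝓕 f : L2) : 𝓢'(Plane, ℂ))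
        = ((𝓕 (weakPartial i f) : L2) : 𝓢'(Plane, ℂ)) := by
      rw [← Lp.fourier_toTemperedDistribution_eq (weakPartial i f), ← h, fourier_lineDerivOp_eq,
        Lp.fourier_toTemperedDistribution_eq]
      have := smulLeftCLM_smul (F := ℂ) hm (2 * Real.pi * Complex.I)
      have h3 := congrArg (fun T => T ((𝓕 f : L2) : 𝓢'(Plane, ℂ))) this
      exact h3
    have h4 := (smulLeftCLM_toTemperedDistribution_eq_iff (by fun_prop) _ _).1 h2
    filter_upwards [h4] with ξ h5
    rw [h5]
    simp [PiLp.inner_apply]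
  have hint : ∀ i, ‖weakPartial i f‖ ^ 2 = ∫ ξ, ‖(𝓕 (weakPartial i f) : L2) ξ‖ ^ 2 := by
    intro i
    rw [← norm_sq_eq_integral, Lp.norm_fourier_eq]
  rw [gradNormSq, hsNorm_sq, Finset.sum_congr rfl fun i _ => hint i, ← integral_finsetSum]
  · refine integral_congr_ae ?_
    filter_upwards [hpart 0, hpart 1] with ξ h0 h1
    rw [Fin.sum_univ_two, h0, h1]
    simp only [norm_mul, Complex.norm_I, Complex.norm_real, mul_pow, Real.norm_eq_abs, sq_abs]
    rw [mul_one, Real.rpow_two, mul_pow, EuclideanSpace.norm_sq_eq, Fin.sum_univ_two]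
    simp
    ring
  · intro i _
    exact (Lp.memLp _).integrable_norm_pow (by norm_num)

theorem hsNorm_zero_sq (f : L2) : hsNorm 0 f ^ 2 = ‖f‖ ^ 2 := by
  rw [hsNorm_sq, ← Lp.norm_fourier_eq f, norm_sq_eq_integral]
  simp

theorem h1Norm_sq_eq {f : L2} (hf : MemH1 f) : h1Norm f ^ 2 = hsNorm 0 f ^ 2 + hsNorm 1 f ^ 2 := by
  rw [h1Norm, Real.sq_sqrt, gradNormSq_eq_hsNorm_sq hf, hsNorm_zero_sq]
  rw [gradNormSq_eq_hsNorm_sq hf]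
  positivity

theorem h1Norm_bessel (G : L2) : h1Norm (bessel G) = ‖G‖ := by
  have h : h1Norm (bessel G) ^ 2 = ‖G‖ ^ 2 := by
    rw [h1Norm_sq_eq (memH1_bessel G), hsNorm_bessel_sq le_rfl zero_le_one,
      hsNorm_bessel_sq zero_le_one le_rfl, norm_sq_eq_integral, norm_sq_eq_integral,
      norm_sq_eq_integral, ← integral_add]
    · refine integral_congr_ae ?_
      filter_upwards [coeFn_mulOp (memLp_top_hsSymbol le_rfl zero_le_one) G,
        coeFn_mulOp (memLp_top_hsSymbol zero_le_one le_rfl) G] with ξ h1 h2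
      rw [h1, h2, norm_mul, norm_mul, mul_pow, mul_pow, ← add_mul]
      simp only [hsSymbol, Complex.norm_real, Real.norm_eq_abs, sq_abs, Real.rpow_zero,
        Real.rpow_one, div_pow, weight_sq]
      rw [← add_div, one_pow, div_self (by positivity), one_mul]
    · exact (Lp.memLp _).integrable_norm_pow (by norm_num)
    · exact (Lp.memLp _).integrable_norm_pow (by norm_num)
  exact (sq_eq_sq₀ (Real.sqrt_nonneg _) (norm_nonneg _)).1 h

/-! ### The group of space-time translations on the frequency side -/

/-- The symbol of `translate x ∘ e^{-itΔ}`, for `γ = (t, x)`. -/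
def chr (γ : ℝ × Plane) (ξ : Plane) : ℂ :=
  Complex.exp (((4 * Real.pi ^ 2 * γ.1 * ‖ξ‖ ^ 2 - 2 * Real.pi * inner ℝ γ.2 ξ : ℝ) : ℂ) *
    Complex.I)

theorem norm_chr (γ : ℝ × Plane) (ξ : Plane) : ‖chr γ ξ‖ = 1 := Complex.norm_exp_ofReal_mul_I _

theorem continuous_chr : Continuous fun p : (ℝ × Plane) × Plane => chr p.1 p.2 := by
  unfold chr; fun_prop

theorem measurable_chr (γ : ℝ × Plane) : Measurable (chr γ) :=
  (continuous_chr.comp (Continuous.prodMk_right γ)).measurable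

theorem chr_zero (ξ : Plane) : chr 0 ξ = 1 := by simp [chr]

theorem chr_add (γ δ : ℝ × Plane) (ξ : Plane) : chr (γ + δ) ξ = chr γ ξ * chr δ ξ := by
  rw [chr, chr, chr, ← Complex.exp_add]
  congr 1
  simp only [Prod.fst_add, Prod.snd_add, inner_add_left]
  push_cast
  ring

theorem conj_chr (γ : ℝ × Plane) (ξ : Plane) : (starRingEnd ℂ) (chr γ ξ) = chr (-γ) ξ := by
  rw [chr, chr, ← Complex.exp_conj]
  congr 1
  simp only [Prod.fst_neg, Prod.snd_neg, inner_neg_left, map_mul, Complex.conj_I,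
    Complex.conj_ofReal]
  push_cast
  ring

theorem memLp_top_chr (γ : ℝ × Plane) : MemLp (chr γ) ∞ (volume : Measure Plane) :=
  memLp_top_of_norm_le (measurable_chr γ) fun ξ => (norm_chr γ ξ).le

/-- The unitary operators of multiplication by `chr γ`, which represent the group `ℝ × ℝ²`. -/
def freqShift (γ : ℝ × Plane) : L2 →L[ℂ] L2 := mulOp (chr γ)

theorem coeFn_freqShift (γ : ℝ × Plane) (G : L2) :
    freqShift γ G =ᵐ[volume] fun ξ => chr γ ξ * G ξ := coeFn_mulOp (memLp_top_chr γ) G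

theorem freqShift_zero (G : L2) : freqShift 0 G = G := by
  apply Lp.ext
  filter_upwards [coeFn_freqShift 0 G] with ξ h
  rw [h, chr_zero, one_mul]

theorem freqShift_add (γ δ : ℝ × Plane) (G : L2) :
    freqShift (γ + δ) G = freqShift γ (freqShift δ G) := by
  apply Lp.ext
  filter_upwards [coeFn_freqShift (γ + δ) G, coeFn_freqShift γ (freqShift δ G),
    coeFn_freqShift δ G] with ξ h1 h2 h3
  rw [h1, h2, h3, chr_add, mul_assoc]

theorem inner_eq_integral (F G : L2) :
    (inner ℂ F G : ℂ) = ∫ ξ, (starRingEnd ℂ) (F ξ) * G ξ := by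
  rw [L2.inner_def]
  refine integral_congr_ae (Eventually.of_forall fun ξ => ?_)
  simp [RCLike.inner_apply, mul_comm]

theorem inner_freqShift_left (γ : ℝ × Plane) (F G : L2) :
    (inner ℂ (freqShift γ F) G : ℂ) = inner ℂ F (freqShift (-γ) G) := by
  rw [inner_eq_integral, inner_eq_integral]
  refine integral_congr_ae ?_
  filter_upwards [coeFn_freqShift γ F, coeFn_freqShift (-γ) G] with ξ h1 h2
  rw [h1, h2, map_mul, conj_chr]
  ring

theorem mulOp_freqShift {m : Plane → ℂ} (hm : MemLp m ∞ (volume : Measure Plane))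
    (γ : ℝ × Plane) (G : L2) : mulOp m (freqShift γ G) = freqShift γ (mulOp m G) := by
  apply Lp.ext
  filter_upwards [coeFn_mulOp hm (freqShift γ G), coeFn_freqShift γ G,
    coeFn_freqShift γ (mulOp m G), coeFn_mulOp hm G] with ξ h1 h2 h3 h4
  rw [h1, h2, h3, h4]
  ring

/-- On the frequency side, space-time translations of waves act by `freqShift`. -/
theorem translate_schrodinger_bessel (t : ℝ) (y : Plane) (G : L2) :
    translate y (schrodinger (-t) (bessel G)) = bessel (freqShift (t, y) G) := by
  have hinj : Function.Injective (fun f : L2 => (𝓕 f : L2)) :=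
    (Lp.fourierTransformₗᵢ Plane ℂ).injective
  apply hinj
  apply Lp.ext
  dsimp only
  have hm : MemLp (fun ξ : Plane =>
      Complex.exp (((-(2 * Real.pi * inner ℝ y ξ) : ℝ) : ℂ) * Complex.I)) ∞ volume :=
    memLp_top_of_norm_le (C := 1) (Continuous.measurable (by fun_prop))
      fun ξ => (Complex.norm_exp_ofReal_mul_I _).le
  rw [fourier_translate]
  filter_upwards [coeFn_mulOp hm (𝓕 (schrodinger (-t) (bessel G))),
    coeFn_fourier_schrodinger (-t) (bessel G), fourier_bessel G,
    fourier_bessel (freqShift (t, y) G), coeFn_freqShift (t, y) G] with ξ h1 h2 h3 h4 h5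
  have hE : Complex.exp (((-(2 * Real.pi * inner ℝ y ξ) : ℝ) : ℂ) * Complex.I) *
      schrodingerSymbol (-t) ξ = chr (t, y) ξ := by
    rw [schrodingerSymbol, chr, ← Complex.exp_add]
    congr 1
    push_cast
    ring
  rw [h1, h2, h3, h4, h5]
  linear_combination ((weight ξ : ℂ)⁻¹ * G ξ) * hE

theorem translate_zero (f : L2) : translate 0 f = f := by
  apply Lp.ext
  refine (Lp.coeFn_compMeasurePreserving f (measurePreserving_sub_right volume 0)).trans ?_
  exact Eventually.of_forall fun x => by simp

theorem schrodinger_bessel (t : ℝ) (G : L2) :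
    schrodinger t (bessel G) = bessel (freqShift (-t, 0) G) := by
  rw [← translate_schrodinger_bessel, translate_zero, neg_neg]

/-! ### Profile decompositions for mixing unitary representations -/

section Abstract

variable {H : Type*} [NormedAddCommGroup H] [InnerProductSpace ℂ H]
  {V : Type*} [NormedAddCommGroup V]

/-- Weak convergence of the sequence `w` to `ψ` along the filter `l`. -/
def WeakLim (l : Filter ℕ) (w : ℕ → H) (ψ : H) : Prop :=
  ∀ h, Tendsto (fun n => (inner ℂ h (w n) : ℂ)) l (𝓝 (inner ℂ h ψ))

/-- `U` is a strongly continuous unitary representation of `V` whose matrix coefficients vanish at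
infinity. -/
structure IsMixingRep (U : V → H →L[ℂ] H) : Prop where
  zero : ∀ f, U 0 f = f
  add : ∀ γ δ f, U (γ + δ) f = U γ (U δ f)
  inner_left : ∀ γ f g, (inner ℂ (U γ f) g : ℂ) = inner ℂ f (U (-γ) g)
  continuous : ∀ f, Continuous fun γ => U γ f
  mixing : ∀ f g, Tendsto (fun γ => (inner ℂ (U γ f) g : ℂ)) (cocompact V) (𝓝 0)

/-- The Banach–Alaoglu theorem along an ultrafilter. -/
theorem exists_weakLim [CompleteSpace H] (𝒰 : Ultrafilter ℕ) {w : ℕ → H} {C : ℝ}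
    (hw : ∀ n, ‖w n‖ ≤ C) : ∃ ψ, WeakLim 𝒰 w ψ := by
  let F : ℕ → WeakDual ℂ H := fun n => StrongDual.toWeakDual (InnerProductSpace.toDual ℂ H (w n))
  have hF : ∀ n, F n ∈ WeakDual.toStrongDual ⁻¹' Metric.closedBall (0 : StrongDual ℂ H) C := by
    intro n
    rw [Set.mem_preimage, mem_closedBall_zero_iff]
    change ‖InnerProductSpace.toDual ℂ H (w n)‖ ≤ C
    rw [LinearIsometryEquiv.norm_map]
    exact hw n
  obtain ⟨L, _, hL⟩ := (WeakDual.isCompact_closedBall (0 : StrongDual ℂ H) C).ultrafilter_le_nhds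
    (𝒰.map F) (by
      rw [le_principal_iff]
      exact Filter.Eventually.of_forall (f := (𝒰 : Filter ℕ)) hF)
  refine ⟨(InnerProductSpace.toDual ℂ H).symm (WeakDual.toStrongDual L), fun h => ?_⟩
  have h1 : Tendsto (fun n => F n h) 𝒰 (𝓝 (L h)) :=
    ((WeakDual.eval_continuous h).tendsto L).comp hL
  have h2 : Tendsto (fun n => (inner ℂ (w n) h : ℂ)) 𝒰 (𝓝 (L h)) := h1
  have h3 := (RCLike.continuous_conj (K := ℂ)).tendsto (L h) |>.comp h2
  have h4 : L h = inner ℂ ((InnerProductSpace.toDual ℂ H).symm (WeakDual.toStrongDual L)) h := by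
    rw [InnerProductSpace.toDual_symm_apply]; rfl
  rw [h4] at h3
  refine (h3.congr fun n => inner_conj_symm _ _).trans (le_of_eq ?_)
  rw [inner_conj_symm]

theorem WeakLim.unique {l : Filter ℕ} [l.NeBot] {w : ℕ → H} {ψ φ : H} (h1 : WeakLim l w ψ)
    (h2 : WeakLim l w φ) : ψ = φ :=
  ext_inner_left ℂ fun h => tendsto_nhds_unique (h1 h) (h2 h)

namespace IsMixingRep

variable {U : V → H →L[ℂ] H} (hU : IsMixingRep U)
include hU

theorem neg_apply (γ : V) (f : H) : U (-γ) (U γ f) = f := by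
  rw [← hU.add, neg_add_cancel, hU.zero]

theorem inner_map (γ : V) (f g : H) : (inner ℂ (U γ f) (U γ g) : ℂ) = inner ℂ f g := by
  rw [hU.inner_left, hU.neg_apply]

theorem norm_map (γ : V) (f : H) : ‖U γ f‖ = ‖f‖ := by
  rw [@norm_eq_sqrt_re_inner ℂ, @norm_eq_sqrt_re_inner ℂ, hU.inner_map]

theorem weakLim_shift {l : Filter ℕ} {w : ℕ → H} {ψ : H} {C : ℝ} (hw : ∀ n, ‖w n‖ ≤ C)
    (h : WeakLim l w ψ) {γ : ℕ → V} {δ : V} (hγ : Tendsto γ l (𝓝 δ)) :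
    WeakLim l (fun n => U (γ n) (w n)) (U δ ψ) := by
  intro f
  have e : ∀ (ε : V) (v : H), (inner ℂ f (U ε v) : ℂ) = inner ℂ (U (-ε) f) v := by
    intro ε v
    rw [hU.inner_left, neg_neg]
  simp_rw [e]
  have h1 : Tendsto (fun n => (inner ℂ (U (-δ) f) (w n) : ℂ)) l (𝓝 (inner ℂ (U (-δ) f) ψ)) := h _
  have h2 : Tendsto (fun n => (inner ℂ (U (-γ n) f - U (-δ) f) (w n) : ℂ)) l (𝓝 0) := by
    have h3 : Tendsto (fun n => ‖U (-γ n) f - U (-δ) f‖ * C) l (𝓝 0) := by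
      have h4 : Tendsto (fun n => U (-γ n) f) l (𝓝 (U (-δ) f)) :=
        ((hU.continuous f).tendsto (-δ)).comp hγ.neg
      simpa using (tendsto_iff_norm_sub_tendsto_zero.1 h4).mul_const C
    refine squeeze_zero_norm (fun n => ?_) h3
    exact (norm_inner_le_norm _ _).trans (mul_le_mul_of_nonneg_left (hw n) (norm_nonneg _))
  simpa [inner_sub_left] using h2.add h1

theorem weakLim_zero_of_norm_tendsto {l : Filter ℕ} [ProperSpace V] {γ : ℕ → V}
    (hγ : Tendsto (fun n => ‖γ n‖) l atTop) (f : H) :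
    WeakLim l (fun n => U (γ n) f) 0 := by
  intro h
  have h1 : Tendsto γ l (cocompact V) := by
    rw [← Metric.cobounded_eq_cocompact, ← comap_norm_atTop]; exact tendsto_comap_iff.2 hγ
  have h2 := (RCLike.continuous_conj (K := ℂ)).tendsto 0 |>.comp ((hU.mixing f h).comp h1)
  simpa [Function.comp_def, inner_conj_symm] using h2

/-- Weak limits of translates of a bounded sequence include one, `ψ`, of at least half of the largest
norm. If it vanishes, the translations `γ n` may be chosen to go to infinity faster than a given
sequence `r n`. -/
theorem exists_profile [CompleteSpace H] [NormedSpace ℝ V] [Nontrivial V] (𝒰 : Ultrafilter ℕ)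
    {w : ℕ → H} (hw : ∃ C, ∀ n, ‖w n‖ ≤ C) (r : ℕ → ℝ) :
    ∃ (ψ : H) (γ : ℕ → V), WeakLim 𝒰 (fun n => U (-γ n) (w n)) ψ ∧
      (∀ (ψ' : H) (γ' : ℕ → V), WeakLim 𝒰 (fun n => U (-γ' n) (w n)) ψ' → ‖ψ'‖ ≤ 2 * ‖ψ‖) ∧
      (ψ = 0 → ∀ n, r n + n ≤ ‖γ n‖) := by
  obtain ⟨C, hC⟩ := hw
  have hC' : ∀ (γ : ℕ → V) n, ‖U (-γ n) (w n)‖ ≤ C := fun γ n => by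
    rw [hU.norm_map]; exact hC n
  let S : Set ℝ := {a | ∃ (ψ : H) (γ : ℕ → V), WeakLim 𝒰 (fun n => U (-γ n) (w n)) ψ ∧ a = ‖ψ‖}
  have hbound : ∀ (ψ : H) (γ : ℕ → V), WeakLim 𝒰 (fun n => U (-γ n) (w n)) ψ → ‖ψ‖ ≤ C := by
    intro ψ γ h
    have h1 : ‖(inner ℂ ψ ψ : ℂ)‖ ≤ ‖ψ‖ * C := by
      refine le_of_tendsto (h ψ).norm (Eventually.of_forall fun n => ?_)
      exact (norm_inner_le_norm _ _).trans (mul_le_mul_of_nonneg_left (hC' γ n) (norm_nonneg _))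
    rw [inner_self_eq_norm_sq_to_K, norm_pow, RCLike.norm_ofReal, abs_norm, sq] at h1
    rcases (norm_nonneg ψ).eq_or_lt with h0 | h0
    · rw [← h0]
      exact (norm_nonneg _).trans (hC 0)
    · exact le_of_mul_le_mul_left h1 h0
  have hS : BddAbove S := ⟨C, by rintro _ ⟨ψ, γ, h, rfl⟩; exact hbound ψ γ h⟩
  have hle : ∀ (ψ : H) (γ : ℕ → V), WeakLim 𝒰 (fun n => U (-γ n) (w n)) ψ → ‖ψ‖ ≤ sSup S :=
    fun ψ γ h => le_csSup hS ⟨ψ, γ, h, rfl⟩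
  by_cases h0 : 0 < sSup S
  · obtain ⟨ψ0, h⟩ := exists_weakLim 𝒰 (hC' 0)
    obtain ⟨_, ⟨ψ, γ, hψ, rfl⟩, h2⟩ := exists_lt_of_lt_csSup (s := S) ⟨_, ψ0, 0, h, rfl⟩
      (half_lt_self h0)
    refine ⟨ψ, γ, hψ, fun ψ' γ' h' => ?_, fun h3 => ?_⟩
    · linarith [hle ψ' γ' h']
    · rw [h3, norm_zero] at h2; linarith
  · have hex : ∀ n, ∃ v : V, r n + n < ‖v‖ := fun n => NormedSpace.exists_lt_norm ℝ V _
    choose γ hγ using hex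
    obtain ⟨ψ, hψ⟩ := exists_weakLim 𝒰 (hC' γ)
    refine ⟨ψ, γ, hψ, fun ψ' γ' h' => ?_, fun _ n => (hγ n).le⟩
    have := hle ψ' γ' h'
    have := norm_nonneg ψ
    linarith

/-- Profile decomposition along an ultrafilter: at each stage a weak limit of translates of the
remainder is removed whose norm is at least half of the largest possible one. -/
theorem exists_profiles [CompleteSpace H] [NormedSpace ℝ V] [Nontrivial V] [ProperSpace V]
    (𝒰 : Ultrafilter ℕ) (h𝒰 : (𝒰 : Filter ℕ) ≤ atTop) {g : ℕ → H} {C : ℝ}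
    (hg : ∀ n, ‖g n‖ ≤ C) :
    ∃ (ψ : ℕ → H) (γ : ℕ → ℕ → V) (W : ℕ → ℕ → H),
      W 0 = g ∧ (∀ M n, W (M + 1) n = W M n - U (γ M n) (ψ M)) ∧
      (∀ M, ∃ B, ∀ n, ‖W M n‖ ≤ B) ∧
      (∀ M, WeakLim 𝒰 (fun n => U (-γ M n) (W (M + 1) n)) 0) ∧
      (∀ j k, j < k → Tendsto (fun n => ‖γ j n - γ k n‖) 𝒰 atTop) ∧
      (∀ M, ∀ᶠ n in 𝒰, ‖W M n‖ ≤ C + 1) ∧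
      (∀ χ : H, ∀ ε > 0, ∃ M₀, ∀ M ≥ M₀, ∀ᶠ n in (𝒰 : Filter ℕ), ∀ γ : V,
        ‖(inner ℂ (U γ χ) (W M n) : ℂ)‖ ≤ ε) := by
  choose Ψ Γ h1 h2 h3 using
    fun (p : {w : ℕ → H // ∃ C, ∀ n, ‖w n‖ ≤ C} × (ℕ → ℝ)) => hU.exists_profile 𝒰 p.1.2 p.2
  -- a state of the iteration is a remainder with the sum of the norms of all earlier shifts
  let next : {w : ℕ → H // ∃ C, ∀ n, ‖w n‖ ≤ C} × (ℕ → ℝ) →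
      {w : ℕ → H // ∃ C, ∀ n, ‖w n‖ ≤ C} × (ℕ → ℝ) := fun p =>
    (⟨fun n => p.1.1 n - U (Γ p n) (Ψ p), by
      obtain ⟨B, hB⟩ := p.1.2
      refine ⟨B + ‖Ψ p‖, fun n => (norm_sub_le _ _).trans ?_⟩
      rw [hU.norm_map]
      gcongr
      exact hB n⟩, fun n => p.2 n + ‖Γ p n‖)
  let st : ℕ → {w : ℕ → H // ∃ C, ∀ n, ‖w n‖ ≤ C} × (ℕ → ℝ) :=
    fun M => Nat.rec (⟨g, C, hg⟩, fun _ => 0) (fun _ p => next p) M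
  have hst : ∀ M, st (M + 1) = next (st M) := fun M => rfl
  set ψ : ℕ → H := fun M => Ψ (st M) with hψ
  set γ : ℕ → ℕ → V := fun M => Γ (st M) with hγ
  set W : ℕ → ℕ → H := fun M => (st M).1.1 with hW
  have hWsucc : ∀ M n, W (M + 1) n = W M n - U (γ M n) (ψ M) := fun M n => rfl
  have hbdd : ∀ M, ∃ B, ∀ n, ‖W M n‖ ≤ B := fun M => (st M).1.2
  have hlim : ∀ M, WeakLim 𝒰 (fun n => U (-γ M n) (W M n)) (ψ M) := fun M => h1 (st M)
  have hshift : ∀ M n, U (-γ M n) (W (M + 1) n) = U (-γ M n) (W M n) - ψ M := by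
    intro M n
    rw [hWsucc, map_sub, hU.neg_apply]
  have hlim0 : ∀ M, WeakLim 𝒰 (fun n => U (-γ M n) (W (M + 1) n)) 0 := by
    intro M h
    have := (hlim M h).sub_const (inner ℂ h (ψ M))
    simpa [hshift, inner_sub_right] using this
  have hr : ∀ M n, (st M).2 n = ∑ j ∈ Finset.range M, ‖γ j n‖ := by
    intro M n
    induction M with
    | zero => rfl
    | succ M ih => rw [Finset.sum_range_succ, ← ih]
  have hdiv : ∀ k, (∀ j < k, WeakLim 𝒰 (fun n => U (-γ j n) (W k n)) 0) →
      ∀ j < k, Tendsto (fun n => ‖γ j n - γ k n‖) 𝒰 atTop := by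
    intro k hA j hj
    by_cases h0 : ψ k = 0
    -- a vanishing profile carries shifts that were chosen far from all earlier ones
    · have h4 := h3 (st k) h0
      refine tendsto_atTop_mono (fun n => ?_) (tendsto_natCast_atTop_atTop.comp h𝒰)
      have h5 : ‖γ j n‖ ≤ (st k).2 n := by
        rw [hr]
        exact Finset.single_le_sum (f := fun j => ‖γ j n‖) (fun i _ => norm_nonneg _)
          (Finset.mem_range.2 hj)
      have h6 := h4 n
      have h7 : ‖γ k n‖ - ‖γ j n‖ ≤ ‖γ j n - γ k n‖ := by
        rw [norm_sub_rev]; exact norm_sub_norm_le _ _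
      have h8 : (st k).2 n + n ≤ ‖γ k n‖ := h6
      simp only [Function.comp_apply]
      linarith
    -- if the difference of the shifts had a limit, the profile `ψ k` would already be seen by the
    -- shifts `γ j`, along which the remainder has the weak limit zero
    · by_contra hnot
      rw [tendsto_atTop] at hnot
      push Not at hnot
      obtain ⟨B, hB⟩ := hnot
      have hB' : ∀ᶠ n in (𝒰 : Filter ℕ), γ j n - γ k n ∈ Metric.closedBall (0 : V) B := by
        filter_upwards [hB] with n hn
        rw [mem_closedBall_zero_iff]
        exact hn.le
      obtain ⟨δ, _, hδ⟩ := (isCompact_closedBall (0 : V) B).ultrafilter_le_nhds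
        (𝒰.map fun n => γ j n - γ k n) (by rw [le_principal_iff]; exact hB')
      have hδ' : Tendsto (fun n => γ j n - γ k n) 𝒰 (𝓝 δ) := hδ
      obtain ⟨Bk, hBk⟩ := hbdd k
      have h5 := hU.weakLim_shift (C := Bk) (fun n => by rw [hU.norm_map]; exact hBk n)
        (hA j hj) hδ'
      rw [map_zero] at h5
      have h6 : WeakLim 𝒰 (fun n => U (-γ k n) (W k n)) 0 := by
        convert h5 using 2 with n
        rw [← hU.add]
        congr 2
        abel
      exact h0 ((hlim k).unique h6)
  have hA : ∀ k, ∀ j < k, WeakLim 𝒰 (fun n => U (-γ j n) (W k n)) 0 := by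
    intro k
    induction k with
    | zero => intro j hj; omega
    | succ k ih =>
      intro j hj
      rcases Nat.lt_succ_iff_lt_or_eq.1 hj with hj' | rfl
      · have h5 := hdiv k ih j hj'
        have h6 : WeakLim 𝒰 (fun n => U (-γ j n + γ k n) (ψ k)) 0 := by
          refine hU.weakLim_zero_of_norm_tendsto ?_ _
          convert h5 using 2 with n
          rw [norm_sub_rev]
          congr 1
          abel
        intro h
        have h7 := (ih j hj' h).sub (h6 h)
        simpa [hWsucc, inner_sub_right, hU.add] using h7
      · exact hlim0 j
  have hC0 : 0 ≤ C := (norm_nonneg _).trans (hg 0)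
  -- orthogonality in the limit makes the squared norms of the profiles summable
  have hpyth1 : ∀ M, Tendsto (fun n => ‖W M n‖ ^ 2 - ‖W (M + 1) n‖ ^ 2) 𝒰 (𝓝 (‖ψ M‖ ^ 2)) := by
    intro M
    have h5 := (Complex.continuous_re.tendsto _).comp (hlim0 M (ψ M))
    rw [inner_zero_right, Complex.zero_re] at h5
    have h6 := (h5.const_mul 2).add_const (‖ψ M‖ ^ 2)
    rw [mul_zero, zero_add] at h6
    refine h6.congr fun n => ?_
    have h7 : W M n = U (γ M n) (ψ M) + W (M + 1) n := by rw [hWsucc]; abel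
    have h8 := @norm_add_sq ℂ H _ _ _ (U (γ M n) (ψ M)) (W (M + 1) n)
    rw [← h7, hU.norm_map, hU.inner_left] at h8
    simp only [Function.comp_apply]
    rw [h8]
    simp only [RCLike.re_eq_complex_re]
    ring
  have hpyth : ∀ M, Tendsto (fun n => ‖g n‖ ^ 2 - ‖W M n‖ ^ 2) 𝒰
      (𝓝 (∑ j ∈ Finset.range M, ‖ψ j‖ ^ 2)) := by
    intro M
    induction M with
    | zero =>
      have : W 0 = g := rfl
      simp [this]
    | succ M ih =>
      rw [Finset.sum_range_succ]
      refine (ih.add (hpyth1 M)).congr fun n => ?_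
      ring
  have hsum : ∀ M, ∑ j ∈ Finset.range M, ‖ψ j‖ ^ 2 ≤ C ^ 2 := by
    intro M
    refine le_of_tendsto (hpyth M) (Eventually.of_forall fun n => ?_)
    have := pow_le_pow_left₀ (norm_nonneg _) (hg n) 2
    nlinarith [sq_nonneg ‖W M n‖]
  have hψ0 : Tendsto (fun M => ‖ψ M‖) atTop (𝓝 0) := by
    have h5 : Summable fun M => ‖ψ M‖ ^ 2 :=
      summable_of_sum_range_le (fun _ => sq_nonneg _) hsum
    have h6 := h5.tendsto_atTop_zero.sqrt
    simpa [Real.sqrt_sq] using h6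
  refine ⟨ψ, γ, W, rfl, hWsucc, hbdd, hlim0, fun j k hjk => hdiv k (hA k) j hjk, ?_, ?_⟩
  · intro M
    have h5 : ∀ᶠ n in (𝒰 : Filter ℕ), -1 < ‖g n‖ ^ 2 - ‖W M n‖ ^ 2 := by
      refine (hpyth M).eventually_const_lt ?_
      exact lt_of_lt_of_le (by norm_num) (Finset.sum_nonneg fun _ _ => sq_nonneg _)
    filter_upwards [h5] with n hn
    have := pow_le_pow_left₀ (norm_nonneg _) (hg n) 2
    refine abs_le_of_sq_le_sq' ?_ (by linarith) |>.2
    nlinarith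
  · intro χ ε hε
    have h5 : Tendsto (fun M => ‖χ‖ * (2 * ‖ψ M‖)) atTop (𝓝 0) := by
      simpa using (hψ0.const_mul 2).const_mul ‖χ‖
    obtain ⟨M₀, hM₀⟩ := eventually_atTop.1 (h5.eventually_lt_const hε)
    refine ⟨M₀, fun M hM => ?_⟩
    -- otherwise a weak limit of translates would violate the choice of `ψ M`
    by_contra hnot
    rw [← Ultrafilter.eventually_not] at hnot
    have h6 : ∀ n, ∃ δ : V, (¬ ∀ γ : V, ‖(inner ℂ (U γ χ) (W M n) : ℂ)‖ ≤ ε) →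
        ε < ‖(inner ℂ (U δ χ) (W M n) : ℂ)‖ := by
      intro n
      by_cases h : ∀ γ : V, ‖(inner ℂ (U γ χ) (W M n) : ℂ)‖ ≤ ε
      · exact ⟨0, fun h' => absurd h h'⟩
      · push Not at h
        obtain ⟨δ, hδ⟩ := h
        exact ⟨δ, fun _ => hδ⟩
    choose δ hδ using h6
    obtain ⟨B, hB⟩ := hbdd M
    obtain ⟨ψ', hψ'⟩ := exists_weakLim 𝒰 (w := fun n => U (-δ n) (W M n)) (C := B)
      fun n => by rw [hU.norm_map]; exact hB n
    have h7 : ε ≤ ‖(inner ℂ χ ψ' : ℂ)‖ := by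
      refine ge_of_tendsto (hψ' χ).norm ?_
      filter_upwards [hnot] with n hn
      rw [← hU.inner_left]
      exact (hδ n hn).le
    have h8 := h2 (st M) ψ' δ hψ'
    have h9 : ‖(inner ℂ χ ψ' : ℂ)‖ ≤ ‖χ‖ * (2 * ‖ψ M‖) :=
      (norm_inner_le_norm _ _).trans (mul_le_mul_of_nonneg_left h8 (norm_nonneg _))
    linarith [hM₀ M hM]

end IsMixingRep

end Abstract

/-! ### Decay of the matrix coefficients -/

theorem norm_chr_mul (γ : ℝ × Plane) (φ : Plane → ℂ) (ξ : Plane) :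
    ‖chr γ ξ * φ ξ‖ = ‖φ ξ‖ := by rw [norm_mul, norm_chr, one_mul]

theorem integrable_chr_mul (γ : ℝ × Plane) {φ : Plane → ℂ} (hφ : Integrable φ) :
    Integrable fun ξ => chr γ ξ * φ ξ :=
  hφ.mono ((measurable_chr γ).aestronglyMeasurable.mul hφ.1)
    (Eventually.of_forall fun ξ => (norm_chr_mul γ φ ξ).le)

/-- The autocorrelation `h ↦ ∫ F(ξ) conj F(ξ + h) dξ`. -/
def autocorr (F : Plane → ℂ) (h : Plane) : ℂ := ∫ ξ, F ξ * (starRingEnd ℂ) (F (ξ + h))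

theorem integrable_autocorr_prod {F : Plane → ℂ} (hF : Integrable F) :
    Integrable (fun p : Plane × Plane => F p.1 * (starRingEnd ℂ) (F (p.1 + p.2)))
      (volume.prod volume) := by
  have h1 : Integrable (fun p : Plane × Plane => F p.1 * (starRingEnd ℂ) (F p.2))
      (volume.prod volume) := hF.mul_prod (hF.norm.mono
        (Complex.continuous_conj.comp_aestronglyMeasurable hF.1)
        (Eventually.of_forall fun ξ => by simp))
  exact (measurePreserving_prod_add (volume : Measure Plane) volume).integrable_comp_of_integrable h1

/-- Van der Corput's inequality. -/
theorem norm_integral_sq_le_integral_autocorr {F : Plane → ℂ} (hF : Integrable F) :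
    ‖∫ ξ, F ξ‖ ^ 2 ≤ ∫ h, ‖autocorr F h‖ := by
  have h1 : (∫ ξ, F ξ) * (starRingEnd ℂ) (∫ ξ, F ξ) = ∫ h, autocorr F h := by
    rw [← integral_conj, ← integral_mul_const]
    have h2 : ∀ ξ, F ξ * ∫ η, (starRingEnd ℂ) (F η)
        = ∫ h, F ξ * (starRingEnd ℂ) (F (ξ + h)) := by
      intro ξ
      rw [integral_const_mul, integral_add_left_eq_self fun η => (starRingEnd ℂ) (F η)]
    simp_rw [h2, autocorr]
    exact integral_integral_swap (integrable_autocorr_prod hF)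
  have h3 : ‖∫ ξ, F ξ‖ ^ 2 = ‖∫ h, autocorr F h‖ := by
    rw [← h1, norm_mul, RCLike.norm_conj, sq]
  rw [h3]
  exact norm_integral_le_integral_norm _

/-- Differencing turns the quadratic phase of `chr` into a linear one: the autocorrelation at `h` is,
in modulus, a Fourier transform at a frequency proportional to `t h`. -/
theorem norm_autocorr_chr_mul (t : ℝ) (x : Plane) (φ : Plane → ℂ) (h : Plane) :
    ‖autocorr (fun ξ => chr (t, x) ξ * φ ξ) h‖ =
      ‖∫ ξ, Complex.exp ((-(8 * Real.pi ^ 2 * t * inner ℝ ξ h) : ℝ) * Complex.I) *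
        (φ ξ * (starRingEnd ℂ) (φ (ξ + h)))‖ := by
  have h1 : autocorr (fun ξ => chr (t, x) ξ * φ ξ) h =
      Complex.exp ((2 * Real.pi * inner ℝ x h - 4 * Real.pi ^ 2 * t * ‖h‖ ^ 2 : ℝ) * Complex.I) *
      ∫ ξ, Complex.exp ((-(8 * Real.pi ^ 2 * t * inner ℝ ξ h) : ℝ) * Complex.I) *
        (φ ξ * (starRingEnd ℂ) (φ (ξ + h))) := by
    rw [autocorr, ← integral_const_mul]
    refine integral_congr_ae (Eventually.of_forall fun ξ => ?_)
    simp only [map_mul, conj_chr]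
    have h2 : chr (t, x) ξ * chr (-(t, x)) (ξ + h) =
        Complex.exp ((2 * Real.pi * inner ℝ x h - 4 * Real.pi ^ 2 * t * ‖h‖ ^ 2 : ℝ) * Complex.I) *
        Complex.exp ((-(8 * Real.pi ^ 2 * t * inner ℝ ξ h) : ℝ) * Complex.I) := by
      rw [chr, chr, ← Complex.exp_add, ← Complex.exp_add]
      congr 1
      simp only [Prod.fst_neg, Prod.snd_neg, inner_neg_left, inner_add_right,
        norm_add_sq_real]
      push_cast
      ring
    linear_combination (φ ξ * (starRingEnd ℂ) (φ (ξ + h))) * h2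
  rw [h1, norm_mul, Complex.norm_exp_ofReal_mul_I, one_mul]

theorem tendsto_integral_autocorr {φ : Plane → ℂ} (hφ : Integrable φ) :
    Tendsto (fun t : ℝ => ∫ h, ‖autocorr (fun ξ => chr (t, 0) ξ * φ ξ) h‖) (cocompact ℝ) (𝓝 0) := by
  have h0 : (0 : ℝ) = ∫ _h : Plane, (0 : ℝ) := by simp
  rw [h0]
  have : (cocompact ℝ).IsCountablyGenerated := by
    rw [← Metric.cobounded_eq_cocompact, ← comap_norm_atTop]; infer_instance
  have hprod : Integrable (fun p : Plane × Plane => ‖φ p.1‖ * ‖φ (p.1 + p.2)‖)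
      (volume.prod volume) := by
    simpa using (integrable_autocorr_prod hφ).norm
  refine tendsto_integral_filter_of_dominated_convergence
    (fun h => ∫ ξ, ‖φ ξ‖ * ‖φ (ξ + h)‖) ?_ ?_ ?_ ?_
  · refine Eventually.of_forall fun t => ?_
    exact ((integrable_autocorr_prod
      (integrable_chr_mul (t, 0) hφ)).integral_prod_right).norm.aestronglyMeasurable
  · refine Eventually.of_forall fun t => Eventually.of_forall fun h => ?_
    rw [norm_norm, autocorr]
    refine (norm_integral_le_integral_norm _).trans_eq ?_
    refine integral_congr_ae (Eventually.of_forall fun ξ => ?_)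
    simp [norm_chr]
  · exact hprod.integral_prod_right
  · have hne : ∀ᵐ h : Plane, h ≠ 0 := by
      simp [ae_iff, measure_singleton]
    filter_upwards [hne] with h hh
    simp_rw [norm_autocorr_chr_mul]
    rw [tendsto_zero_iff_norm_tendsto_zero.symm]
    have hRL := tendsto_integral_exp_inner_smul_cocompact (V := Plane)
      (fun ξ => φ ξ * (starRingEnd ℂ) (φ (ξ + h)))
    have hT : Tendsto (fun t : ℝ => (4 * Real.pi * t) • h) (cocompact ℝ) (cocompact Plane) := by
      rw [← Metric.cobounded_eq_cocompact, ← Metric.cobounded_eq_cocompact,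
        ← tendsto_norm_atTop_iff_cobounded]
      have h1 : Tendsto (fun t : ℝ => ‖t‖ * (4 * Real.pi * ‖h‖)) (Bornology.cobounded ℝ) atTop :=
        tendsto_norm_cobounded_atTop.atTop_mul_const (by have := norm_pos_iff.2 hh; positivity)
      refine h1.congr fun t => ?_
      rw [norm_smul, norm_mul, Real.norm_of_nonneg (by positivity : 0 ≤ 4 * Real.pi)]
      ring
    refine (hRL.comp hT).congr fun t => ?_
    refine integral_congr_ae (Eventually.of_forall fun ξ => ?_)
    simp only [Circle.smul_def, Real.fourierChar_apply, smul_eq_mul, inner_smul_right]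
    congr 2
    push_cast
    ring

/-- The Fourier transform of an integrable density on the paraboloid vanishes at infinity. -/
theorem tendsto_integral_chr_mul_cocompact {φ : Plane → ℂ} (hφ : Integrable φ) :
    Tendsto (fun γ : ℝ × Plane => ∫ ξ, chr γ ξ * φ ξ) (cocompact (ℝ × Plane)) (𝓝 0) := by
  rw [tendsto_iff_ultrafilter]
  intro 𝒱 h𝒱
  have hnorm : Tendsto (fun γ : ℝ × Plane => ‖γ‖) 𝒱 atTop := by
    rw [tendsto_norm_atTop_iff_cobounded, Metric.cobounded_eq_cocompact]
    exact h𝒱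
  -- either the times go to infinity, or they converge and the positions go to infinity
  by_cases hT : Tendsto (fun γ : ℝ × Plane => ‖γ.1‖) 𝒱 atTop
  · have hT' : Tendsto (fun γ : ℝ × Plane => γ.1) 𝒱 (cocompact ℝ) := by
      rwa [tendsto_norm_atTop_iff_cobounded, Metric.cobounded_eq_cocompact] at hT
    have h1 := ((tendsto_integral_autocorr hφ).comp hT').sqrt
    rw [Real.sqrt_zero] at h1
    refine squeeze_zero_norm (fun γ => ?_) h1
    refine Real.le_sqrt_of_sq_le ?_
    refine (norm_integral_sq_le_integral_autocorr (integrable_chr_mul γ hφ)).trans_eq ?_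
    refine integral_congr_ae (Eventually.of_forall fun h => ?_)
    obtain ⟨t, x⟩ := γ
    simp only
    rw [norm_autocorr_chr_mul, norm_autocorr_chr_mul]
  · rw [tendsto_atTop] at hT
    push Not at hT
    obtain ⟨B, hB⟩ := hT
    obtain ⟨τ, _, hτ⟩ := (isCompact_closedBall (0 : ℝ) B).ultrafilter_le_nhds
      (𝒱.map Prod.fst) (by
        rw [le_principal_iff]
        refine Filter.Eventually.mono (f := (𝒱 : Filter (ℝ × Plane))) hB fun γ hγ => ?_
        exact mem_closedBall_zero_iff.2 (le_of_lt hγ))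
    have hτ' : Tendsto (fun γ : ℝ × Plane => γ.1) 𝒱 (𝓝 τ) := hτ
    have hx : Tendsto (fun γ : ℝ × Plane => γ.2) 𝒱 (cocompact Plane) := by
      rw [← Metric.cobounded_eq_cocompact, ← tendsto_norm_atTop_iff_cobounded]
      refine tendsto_atTop_mono' _ ?_ (tendsto_atTop_add_const_right _ (-B) hnorm)
      filter_upwards [hB] with γ hγ
      have := Prod.norm_def γ
      rcases max_cases ‖γ.1‖ ‖γ.2‖ with h | h <;> linarith [norm_nonneg γ.2, norm_nonneg γ.1]
    have h1 : Tendsto (fun s : ℝ => ∫ ξ, ‖chr (s, 0) ξ - chr (τ, 0) ξ‖ * ‖φ ξ‖) (𝓝 τ) (𝓝 0) := by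
      have h0 : (0 : ℝ) = ∫ _ξ : Plane, (0 : ℝ) := by simp
      rw [h0]
      refine tendsto_integral_filter_of_dominated_convergence (fun ξ => 2 * ‖φ ξ‖) ?_ ?_ ?_ ?_
      · refine Eventually.of_forall fun s => ?_
        exact (((measurable_chr _).sub (measurable_chr _)).norm.aestronglyMeasurable).mul hφ.1.norm
      · refine Eventually.of_forall fun s => Eventually.of_forall fun ξ => ?_
        rw [norm_mul, norm_norm, norm_norm]
        refine mul_le_mul_of_nonneg_right ((norm_sub_le _ _).trans ?_) (norm_nonneg _)
        rw [norm_chr, norm_chr]; norm_num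
      · exact hφ.norm.const_mul 2
      · refine Eventually.of_forall fun ξ => ?_
        have hc : Continuous fun s : ℝ => ‖chr (s, 0) ξ - chr (τ, 0) ξ‖ * ‖φ ξ‖ := by
          unfold chr; fun_prop
        have := hc.tendsto τ
        simpa using this
    have h2 : Tendsto (fun y : Plane => ∫ ξ, chr (τ, y) ξ * φ ξ) (cocompact Plane) (𝓝 0) := by
      refine (tendsto_integral_exp_inner_smul_cocompact (V := Plane)
        (fun ξ => chr (τ, 0) ξ * φ ξ)).congr fun y => ?_
      refine integral_congr_ae (Eventually.of_forall fun ξ => ?_)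
      simp only [Circle.smul_def, Real.fourierChar_apply, smul_eq_mul]
      rw [← mul_assoc, chr, chr, ← Complex.exp_add, real_inner_comm ξ y]
      congr 2
      simp only [inner_zero_left]
      push_cast
      ring
    have h3 : Tendsto (fun γ : ℝ × Plane => ∫ ξ, (chr γ ξ - chr (τ, γ.2) ξ) * φ ξ) 𝒱 (𝓝 0) := by
      refine squeeze_zero_norm (fun γ => ?_) (h1.comp hτ')
      refine (norm_integral_le_integral_norm _).trans_eq ?_
      refine integral_congr_ae (Eventually.of_forall fun ξ => ?_)
      have e : ∀ s : ℝ, chr (s, γ.2) ξ = chr (s, 0) ξ * chr (0, γ.2) ξ := by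
        intro s
        rw [← chr_add]; simp
      simp only [norm_mul]
      rw [show chr γ ξ = chr (γ.1, γ.2) ξ from rfl, e, e τ, ← sub_mul, norm_mul, norm_chr, mul_one]
    have h4 := h3.add (h2.comp hx)
    rw [zero_add] at h4
    refine h4.congr fun γ => ?_
    simp only [Function.comp_apply]
    rw [← integral_add]
    · refine integral_congr_ae (Eventually.of_forall fun ξ => ?_)
      simp only
      ring
    · simp_rw [sub_mul]
      exact (integrable_chr_mul γ hφ).sub (integrable_chr_mul (τ, γ.2) hφ)
    · exact integrable_chr_mul _ hφ

theorem continuous_freqShift (G : L2) : Continuous fun γ => freqShift γ G := by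
  rw [continuous_iff_continuousAt]
  intro δ
  rw [ContinuousAt, tendsto_iff_norm_sub_tendsto_zero]
  have h1 : Tendsto (fun γ : ℝ × Plane => ∫ ξ, (‖chr γ ξ - chr δ ξ‖ * ‖G ξ‖) ^ 2) (𝓝 δ) (𝓝 0) := by
    have h0 : (0 : ℝ) = ∫ _ξ : Plane, (0 : ℝ) := by simp
    rw [h0]
    have hGm : AEStronglyMeasurable (G : Plane → ℂ) volume := Lp.aestronglyMeasurable G
    refine tendsto_integral_filter_of_dominated_convergence (fun ξ => 4 * ‖G ξ‖ ^ 2) ?_ ?_ ?_ ?_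
    · refine Eventually.of_forall fun s => ?_
      exact ((((measurable_chr _).sub (measurable_chr _)).norm.aestronglyMeasurable).mul
        hGm.norm).pow 2
    · refine Eventually.of_forall fun s => Eventually.of_forall fun ξ => ?_
      rw [norm_pow, norm_mul, norm_norm, norm_norm, mul_pow]
      refine mul_le_mul_of_nonneg_right ?_ (sq_nonneg _)
      have : ‖chr s ξ - chr δ ξ‖ ≤ 2 := by
        refine (norm_sub_le _ _).trans ?_
        rw [norm_chr, norm_chr]; norm_num
      nlinarith [norm_nonneg (chr s ξ - chr δ ξ)]
    · exact ((Lp.memLp G).integrable_norm_pow (by norm_num)).const_mul 4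
    · refine Eventually.of_forall fun ξ => ?_
      have hc : Continuous fun s : ℝ × Plane => (‖chr s ξ - chr δ ξ‖ * ‖G ξ‖) ^ 2 := by
        unfold chr; fun_prop
      have := hc.tendsto δ
      simpa using this
  have h2 := h1.sqrt
  rw [Real.sqrt_zero] at h2
  refine h2.congr fun γ => ?_
  rw [← Real.sqrt_sq (norm_nonneg (freqShift γ G - freqShift δ G)), norm_sq_eq_integral]
  congr 1
  refine integral_congr_ae ?_
  filter_upwards [Lp.coeFn_sub (freqShift γ G) (freqShift δ G), coeFn_freqShift γ G,
    coeFn_freqShift δ G] with ξ h3 h4 h5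
  rw [h3, Pi.sub_apply, h4, h5, ← sub_mul, norm_mul]

theorem isMixingRep_freqShift : IsMixingRep freqShift where
  zero := freqShift_zero
  add := freqShift_add
  inner_left := inner_freqShift_left
  continuous := continuous_freqShift
  mixing F G := by
    have hint : Integrable fun ξ => (starRingEnd ℂ) (F ξ) * G ξ := by
      have := L2.integrable_inner (𝕜 := ℂ) F G
      refine this.congr (Eventually.of_forall fun ξ => ?_)
      simp [RCLike.inner_apply, mul_comm]
    have h1 := (tendsto_integral_chr_mul_cocompact hint).comp
      ((Homeomorph.neg (ℝ × Plane)).isClosedEmbedding.tendsto_cocompact)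
    refine h1.congr fun γ => ?_
    rw [inner_eq_integral]
    refine integral_congr_ae ?_
    filter_upwards [coeFn_freqShift γ F] with ξ h2
    rw [h2, map_mul, conj_chr]
    simp only [Homeomorph.coe_neg]
    ring

/-! ### The restriction estimate behind the Strichartz inequality -/

/-- Under `ζ ↦ |ζ|²`, Lebesgue measure on the plane is mapped to `π` times Lebesgue measure on the
half-line; hence the bound by the integral over the whole line. -/
theorem lintegral_comp_norm_sq_le {f : ℝ → ℝ} (h0 : ∀ x, 0 ≤ f x) (hf : Integrable f) :
    ∫⁻ ζ : Plane, ENNReal.ofReal (f (‖ζ‖ ^ 2)) ≤ ENNReal.ofReal (Real.pi * ∫ x, f x) := by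
  have hfin : Module.finrank ℝ Plane = 2 := by simp
  have h1 : IntegrableOn (fun x : ℝ => (2 * x) * f (x ^ 2)) (Set.Ioi 0) := by
    have := (integrableOn_Ioi_comp_rpow_iff f (p := 2) two_ne_zero).2 hf.integrableOn
    refine this.congr_fun (fun x _ => ?_) measurableSet_Ioi
    norm_num
  have h2 : Integrable (fun ζ : Plane => f (‖ζ‖ ^ 2)) := by
    refine (integrable_fun_norm_addHaar volume (f := fun r => f (r ^ 2))).2 ?_
    rw [hfin]
    refine IntegrableOn.congr_fun (h1.const_mul (1 / 2)) (fun x _ => ?_) measurableSet_Ioi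
    simp only [smul_eq_mul]
    ring
  rw [← ofReal_integral_eq_lintegral_ofReal h2 (Eventually.of_forall fun ζ => h0 _)]
  refine ENNReal.ofReal_le_ofReal ?_
  have hvol : (volume : Measure Plane).real (Metric.ball 0 1) = Real.pi := by
    rw [Measure.real, EuclideanSpace.volume_ball_fin_two]
    simp [Real.pi_pos.le]
  have h3 : ∫ x in Set.Ioi (0 : ℝ), (2 * x) * f (x ^ 2) = ∫ x in Set.Ioi (0 : ℝ), f x := by
    rw [← integral_comp_rpow_Ioi_of_pos (g := f) two_pos]
    refine setIntegral_congr_fun measurableSet_Ioi fun x _ => ?_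
    norm_num
  rw [integral_fun_norm_addHaar volume (fun r => f (r ^ 2)), hfin, hvol]
  have h4 : ∫ y in Set.Ioi (0 : ℝ), y ^ (2 - 1) • f (y ^ 2)
      = (1 / 2) * ∫ x in Set.Ioi (0 : ℝ), f x := by
    rw [← h3, ← integral_const_mul]
    refine setIntegral_congr_fun measurableSet_Ioi fun x _ => ?_
    simp only [smul_eq_mul]
    ring
  rw [h4]
  have h5 : ∫ x in Set.Ioi (0 : ℝ), f x ≤ ∫ x, f x :=
    setIntegral_le_integral hf (Eventually.of_forall h0)
  simp only [smul_eq_mul, nsmul_eq_mul]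
  nlinarith [Real.pi_pos]

/-- The Schur bound for the Gaussian kernel. -/
theorem lintegral_gaussian_norm_sq_le {c ε : ℝ} (hc : 0 < c) (hε : 0 < ε) (a : ℝ) :
    ∫⁻ ζ : Plane, ENNReal.ofReal
      (Real.sqrt (Real.pi / ε) * Real.exp (-(c ^ 2 / (4 * ε)) * (‖ζ‖ ^ 2 - a) ^ 2)) ≤
      ENNReal.ofReal (2 * Real.pi ^ 2 / c) := by
  have hb : 0 < c ^ 2 / (4 * ε) := by positivity
  have h1 : Integrable fun x : ℝ =>
      Real.sqrt (Real.pi / ε) * Real.exp (-(c ^ 2 / (4 * ε)) * (x - a) ^ 2) :=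
    ((integrable_exp_neg_mul_sq hb).comp_sub_right a).const_mul _
  refine (lintegral_comp_norm_sq_le (f := fun x : ℝ =>
      Real.sqrt (Real.pi / ε) * Real.exp (-(c ^ 2 / (4 * ε)) * (x - a) ^ 2))
      (fun x => by positivity) h1).trans_eq ?_
  congr 1
  rw [integral_const_mul, integral_sub_right_eq_self
    (fun x : ℝ => Real.exp (-(c ^ 2 / (4 * ε)) * x ^ 2)), integral_gaussian, ← Real.sqrt_mul
    (by positivity)]
  have h2 : Real.pi / ε * (Real.pi / (c ^ 2 / (4 * ε))) = (2 * Real.pi / c) ^ 2 := by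
    field_simp
    norm_num
  rw [h2, Real.sqrt_sq (by positivity)]
  ring

/-- The integral of a density against the oscillation `exp(ict|ζ|²)`. -/
def oscInt (c : ℝ) (G : Plane → ℂ) (t : ℝ) : ℂ :=
  ∫ ζ, Complex.exp (((c * t * ‖ζ‖ ^ 2 : ℝ) : ℂ) * Complex.I) * G ζ

theorem continuous_oscInt (c : ℝ) {G : Plane → ℂ} (hG : Integrable G) :
    Continuous (oscInt c G) := by
  refine continuous_of_dominated (bound := fun ζ => ‖G ζ‖) (fun t => ?_) (fun t => ?_) hG.norm ?_
  · refine AEStronglyMeasurable.mul (Continuous.aestronglyMeasurable ?_) hG.1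
    fun_prop
  · refine Eventually.of_forall fun ζ => ?_
    rw [norm_mul, Complex.norm_exp_ofReal_mul_I, one_mul]
  · refine Eventually.of_forall fun ζ => ?_
    fun_prop

/-- The restriction estimate with a Gaussian cutoff in time. Integrating out time turns the square
into a quadratic form with a Gaussian kernel in `|ζ|² - |ζ'|²`, which Schur's test bounds uniformly
in `ε`. -/
theorem lintegral_gaussian_mul_oscInt_sq_le {c ε : ℝ} (hc : 0 < c) (hε : 0 < ε) {G : Plane → ℂ}
    (hG : Integrable G) :
    ∫⁻ t, ENNReal.ofReal (Real.exp (-ε * t ^ 2)) * ‖oscInt c G t‖ₑ ^ 2 ≤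
      2 * ENNReal.ofReal (2 * Real.pi ^ 2 / c) * ∫⁻ ζ, ‖G ζ‖ₑ ^ 2 := by
  set Q : ℝ × (Plane × Plane) → ℂ := fun q =>
    Complex.exp (Complex.I * ((c * (‖q.2.1‖ ^ 2 - ‖q.2.2‖ ^ 2) : ℝ) : ℂ) * q.1) *
      Complex.exp (-(ε : ℂ) * (q.1 : ℂ) ^ 2) * (G q.2.1 * (starRingEnd ℂ) (G q.2.2)) with hQ
  have hGc : Integrable fun ζ => (starRingEnd ℂ) (G ζ) :=
    hG.norm.mono (Complex.continuous_conj.comp_aestronglyMeasurable hG.1)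
      (Eventually.of_forall fun ξ => by simp)
  have hGG : Integrable (fun p : Plane × Plane => G p.1 * (starRingEnd ℂ) (G p.2))
      (volume.prod volume) := hG.mul_prod hGc
  have hgauss : Integrable fun t : ℝ => Complex.exp (-(ε : ℂ) * (t : ℂ) ^ 2) :=
    integrable_cexp_neg_mul_sq (by simpa using hε)
  have hQi : Integrable Q (volume.prod (volume.prod volume)) := by
    have h1 := hgauss.mul_prod hGG
    refine h1.mono ?_ (Eventually.of_forall fun q => ?_)
    · have h2 : AEStronglyMeasurable (fun q : ℝ × (Plane × Plane) =>
          Complex.exp (Complex.I * ((c * (‖q.2.1‖ ^ 2 - ‖q.2.2‖ ^ 2) : ℝ) : ℂ) * q.1))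
          (volume.prod (volume.prod volume)) :=
        Continuous.aestronglyMeasurable (by fun_prop)
      refine (h2.mul h1.1).congr (Eventually.of_forall fun q => ?_)
      simp only [hQ, Pi.mul_apply]
      ring
    · simp only [hQ, norm_mul]
      have : ‖Complex.exp (Complex.I * ((c * (‖q.2.1‖ ^ 2 - ‖q.2.2‖ ^ 2) : ℝ) : ℂ) * q.1)‖ = 1 := by
        rw [show Complex.I * ((c * (‖q.2.1‖ ^ 2 - ‖q.2.2‖ ^ 2) : ℝ) : ℂ) * q.1
          = ((c * (‖q.2.1‖ ^ 2 - ‖q.2.2‖ ^ 2) * q.1 : ℝ) : ℂ) * Complex.I by push_cast; ring]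
        exact Complex.norm_exp_ofReal_mul_I _
      rw [this, one_mul]
  -- integrating out the two frequencies first
  have hleft : ∀ t, ∫ p, Q (t, p) ∂(volume.prod volume) =
      ((Real.exp (-ε * t ^ 2) * ‖oscInt c G t‖ ^ 2 : ℝ) : ℂ) := by
    intro t
    have h1 : ∀ p : Plane × Plane, Q (t, p) = Complex.exp (-(ε : ℂ) * (t : ℂ) ^ 2) *
        ((Complex.exp (((c * t * ‖p.1‖ ^ 2 : ℝ) : ℂ) * Complex.I) * G p.1) *
        (starRingEnd ℂ) (Complex.exp (((c * t * ‖p.2‖ ^ 2 : ℝ) : ℂ) * Complex.I) * G p.2)) := by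
      intro p
      simp only [hQ, map_mul, ← Complex.exp_conj, Complex.conj_ofReal, Complex.conj_I]
      rw [show Complex.I * ((c * (‖p.1‖ ^ 2 - ‖p.2‖ ^ 2) : ℝ) : ℂ) * (t : ℂ)
        = ((c * t * ‖p.1‖ ^ 2 : ℝ) : ℂ) * Complex.I + ((c * t * ‖p.2‖ ^ 2 : ℝ) : ℂ) * -Complex.I by
          push_cast; ring, Complex.exp_add]
      ring
    simp_rw [h1]
    rw [integral_const_mul, integral_prod_mul
      (fun ζ => Complex.exp (((c * t * ‖ζ‖ ^ 2 : ℝ) : ℂ) * Complex.I) * G ζ)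
      (fun ζ => (starRingEnd ℂ) (Complex.exp (((c * t * ‖ζ‖ ^ 2 : ℝ) : ℂ) * Complex.I) * G ζ)),
      integral_conj]
    change _ * (oscInt c G t * (starRingEnd ℂ) (oscInt c G t)) = _
    rw [Complex.mul_conj, Complex.normSq_eq_norm_sq]
    push_cast
    rfl
  -- integrating out time first
  set k : Plane × Plane → ℝ := fun p =>
    Real.sqrt (Real.pi / ε) * Real.exp (-(c ^ 2 / (4 * ε)) * (‖p.1‖ ^ 2 - ‖p.2‖ ^ 2) ^ 2) with hk
  have hright : ∀ p, ∫ t, Q (t, p) = (k p : ℂ) * (G p.1 * (starRingEnd ℂ) (G p.2)) := by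
    intro p
    simp only [hQ]
    rw [integral_mul_const, fourierIntegral_gaussian (by simpa using hε)]
    congr 1
    rw [hk]
    push_cast
    have h1 : ((Real.sqrt (Real.pi / ε) : ℝ) : ℂ) = ((Real.pi : ℂ) / ε) ^ ((1 : ℂ) / 2) := by
      rw [Real.sqrt_eq_rpow, Complex.ofReal_cpow (by positivity)]
      push_cast
      rfl
    rw [h1]
    congr 2
    field_simp
  have hswap : ∫ t, ∫ p, Q (t, p) ∂(volume.prod volume) =
      ∫ p, (∫ t, Q (t, p)) ∂(volume.prod volume) := integral_integral_swap hQi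
  have hintL : Integrable fun t => Real.exp (-ε * t ^ 2) * ‖oscInt c G t‖ ^ 2 := by
    have := hQi.integral_prod_left
    simp_rw [hleft] at this
    exact this.re
  have hk0 : ∀ p, 0 ≤ k p := fun p => by positivity
  have hkm : Measurable fun p => ENNReal.ofReal (k p) :=
    (Continuous.measurable (by fun_prop)).ennreal_ofReal
  have hGm : AEMeasurable (fun ζ => ‖G ζ‖ₑ ^ 2) (volume : Measure Plane) := hG.1.enorm.pow_const 2
  have e1 : ∫⁻ t, ENNReal.ofReal (Real.exp (-ε * t ^ 2)) * ‖oscInt c G t‖ₑ ^ 2 =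
      ‖∫ p, (∫ t, Q (t, p)) ∂(volume.prod volume)‖ₑ := by
    rw [← hswap]
    simp_rw [hleft]
    rw [integral_complex_ofReal, ← ofReal_norm, Complex.norm_real,
      Real.norm_of_nonneg (integral_nonneg fun t => by positivity),
      ofReal_integral_eq_lintegral_ofReal hintL (Eventually.of_forall fun t => by positivity)]
    refine lintegral_congr fun t => ?_
    rw [ENNReal.ofReal_mul (by positivity), ENNReal.ofReal_pow (norm_nonneg _), ofReal_norm]
  have e2 : ∀ p, ‖∫ t, Q (t, p)‖ₑ ≤
      ENNReal.ofReal (k p) * ‖G p.1‖ₑ ^ 2 + ENNReal.ofReal (k p) * ‖G p.2‖ₑ ^ 2 := by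
    intro p
    rw [hright, enorm_mul, enorm_mul, ← mul_add, ← ofReal_norm ((k p : ℂ)), Complex.norm_real,
      Real.norm_of_nonneg (hk0 p)]
    gcongr
    rw [← ofReal_norm ((starRingEnd ℂ) (G p.2)), RCLike.norm_conj, ofReal_norm]
    rcases le_total ‖G p.1‖ₑ ‖G p.2‖ₑ with h | h
    · calc ‖G p.1‖ₑ * ‖G p.2‖ₑ ≤ ‖G p.2‖ₑ * ‖G p.2‖ₑ := by gcongr
        _ ≤ _ := by rw [← sq]; exact le_add_self
    · calc ‖G p.1‖ₑ * ‖G p.2‖ₑ ≤ ‖G p.1‖ₑ * ‖G p.1‖ₑ := by gcongr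
        _ ≤ _ := by rw [← sq]; exact le_self_add
  have hm1 : AEMeasurable (fun p : Plane × Plane => ENNReal.ofReal (k p) * ‖G p.1‖ₑ ^ 2)
      (volume.prod volume) := hkm.aemeasurable.mul hGm.comp_fst
  have hm2 : AEMeasurable (fun p : Plane × Plane => ENNReal.ofReal (k p) * ‖G p.2‖ₑ ^ 2)
      (volume.prod volume) := hkm.aemeasurable.mul hGm.comp_snd
  have hkm1 : ∀ ζ, Measurable fun ζ' => ENNReal.ofReal (k (ζ, ζ')) :=
    fun ζ => hkm.comp measurable_prodMk_left
  have hkm2 : ∀ ζ', Measurable fun ζ => ENNReal.ofReal (k (ζ, ζ')) :=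
    fun ζ => hkm.comp measurable_prodMk_right
  have e3 : ∫⁻ p, ENNReal.ofReal (k p) * ‖G p.1‖ₑ ^ 2 ∂(volume.prod volume) ≤
      ENNReal.ofReal (2 * Real.pi ^ 2 / c) * ∫⁻ ζ, ‖G ζ‖ₑ ^ 2 := by
    rw [lintegral_prod _ hm1, ← lintegral_const_mul'' _ hGm]
    refine lintegral_mono fun ζ => ?_
    simp only
    rw [lintegral_mul_const _ (hkm1 ζ)]
    gcongr
    refine (lintegral_mono fun ζ' => ?_).trans (lintegral_gaussian_norm_sq_le hc hε (‖ζ‖ ^ 2))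
    simp only [hk]
    rw [sub_sq_comm]
  have e4 : ∫⁻ p, ENNReal.ofReal (k p) * ‖G p.2‖ₑ ^ 2 ∂(volume.prod volume) ≤
      ENNReal.ofReal (2 * Real.pi ^ 2 / c) * ∫⁻ ζ, ‖G ζ‖ₑ ^ 2 := by
    rw [lintegral_prod_symm _ hm2, ← lintegral_const_mul'' _ hGm]
    refine lintegral_mono fun ζ => ?_
    simp only
    rw [lintegral_mul_const _ (hkm2 ζ)]
    gcongr
    exact lintegral_gaussian_norm_sq_le hc hε (‖ζ‖ ^ 2)
  rw [e1]
  refine (enorm_integral_le_lintegral_enorm _).trans ((lintegral_mono e2).trans ?_)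
  rw [lintegral_add_left' hm1, mul_assoc, two_mul]
  exact add_le_add e3 e4

/-- The adjoint restriction estimate for the map `ζ ↦ |ζ|²`. -/
theorem lintegral_oscInt_sq_le {c : ℝ} (hc : 0 < c) {G : Plane → ℂ} (hG : Integrable G) :
    ∫⁻ t, ‖oscInt c G t‖ₑ ^ 2 ≤
      2 * ENNReal.ofReal (2 * Real.pi ^ 2 / c) * ∫⁻ ζ, ‖G ζ‖ₑ ^ 2 := by
  set F : ℕ → ℝ → ℝ≥0∞ := fun n t =>
    ENNReal.ofReal (Real.exp (-(1 / ((n : ℝ) + 1)) * t ^ 2)) * ‖oscInt c G t‖ₑ ^ 2 with hF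
  have hm : ∀ n, AEMeasurable (F n) volume := fun n =>
    ((Continuous.measurable (by fun_prop)).ennreal_ofReal.mul
      ((continuous_oscInt c hG).enorm.measurable.pow_const 2)).aemeasurable
  have hlim : ∀ t, Tendsto (fun n => F n t) atTop (𝓝 (‖oscInt c G t‖ₑ ^ 2)) := by
    intro t
    have h1 : Tendsto (fun n : ℕ => -(1 / ((n : ℝ) + 1)) * t ^ 2) atTop (𝓝 0) := by
      simpa using (tendsto_one_div_add_atTop_nhds_zero_nat (𝕜 := ℝ)).neg.mul_const (t ^ 2)
    have h2 := (ENNReal.continuous_ofReal.tendsto _).comp ((Real.continuous_exp.tendsto 0).comp h1)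
    rw [Real.exp_zero, ENNReal.ofReal_one] at h2
    have h3 := ENNReal.Tendsto.mul_const (b := ‖oscInt c G t‖ₑ ^ 2) h2 (Or.inl one_ne_zero)
    rw [one_mul] at h3
    exact h3
  calc ∫⁻ t, ‖oscInt c G t‖ₑ ^ 2 = ∫⁻ t, liminf (fun n => F n t) atTop :=
        lintegral_congr fun t => (hlim t).liminf_eq.symm
    _ ≤ liminf (fun n => ∫⁻ t, F n t) atTop := lintegral_liminf_le' hm
    _ ≤ _ := by
      refine liminf_le_of_le (by isBoundedDefault) fun b hb => ?_
      obtain ⟨n, hn⟩ := hb.exists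
      exact hn.trans (lintegral_gaussian_mul_oscInt_sq_le hc (by positivity) hG)

/-! ### The Strichartz inequality for frequencies in a ball -/

/-- Up to a unimodular factor, the spatial Fourier transform at `η` of the square of the wave with
frequency profile `g` at time `t`. -/
def squareFreq (g : Plane → ℂ) (t : ℝ) (η : Plane) : ℂ :=
  ∫ ξ, Complex.exp (((4 * Real.pi ^ 2 * t * (‖ξ‖ ^ 2 + ‖η - ξ‖ ^ 2) : ℝ) : ℂ) * Complex.I) *
    (g ξ * g (η - ξ))

theorem enorm_integral_chr_sq_le {g : Plane → ℂ} (hg : Integrable g) (t : ℝ) (x : Plane) :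
    ‖∫ ξ, chr (t, x) ξ * g ξ‖ₑ ^ 2 ≤ ∫⁻ η, ‖squareFreq g t η‖ₑ := by
  have hF := integrable_chr_mul (t, x) hg
  have h1 := integral_convolution (ContinuousLinearMap.mul ℂ ℂ) (μ := (volume : Measure Plane))
    (ν := (volume : Measure Plane)) hF hF
  rw [ContinuousLinearMap.mul_apply'] at h1
  have h2 : ∀ η, ‖convolution (fun ξ => chr (t, x) ξ * g ξ) (fun ξ => chr (t, x) ξ * g ξ)
      (ContinuousLinearMap.mul ℂ ℂ) volume η‖ₑ = ‖squareFreq g t η‖ₑ := by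
    intro η
    have h3 : convolution (fun ξ => chr (t, x) ξ * g ξ) (fun ξ => chr (t, x) ξ * g ξ)
        (ContinuousLinearMap.mul ℂ ℂ) volume η =
        Complex.exp (((-(2 * Real.pi * inner ℝ x η) : ℝ) : ℂ) * Complex.I) * squareFreq g t η := by
      rw [convolution_def, squareFreq, ← integral_const_mul]
      refine integral_congr_ae (Eventually.of_forall fun ξ => ?_)
      simp only [ContinuousLinearMap.mul_apply']
      have h4 : chr (t, x) ξ * chr (t, x) (η - ξ) =
          Complex.exp (((-(2 * Real.pi * inner ℝ x η) : ℝ) : ℂ) * Complex.I) *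
          Complex.exp (((4 * Real.pi ^ 2 * t * (‖ξ‖ ^ 2 + ‖η - ξ‖ ^ 2) : ℝ) : ℂ) * Complex.I) := by
        rw [chr, chr, ← Complex.exp_add, ← Complex.exp_add]
        congr 1
        simp only [inner_sub_right]
        push_cast
        ring
      linear_combination (g ξ * g (η - ξ)) * h4
    rw [h3, enorm_mul, ← ofReal_norm (Complex.exp _), Complex.norm_exp_ofReal_mul_I,
      ENNReal.ofReal_one, one_mul]
  rw [sq, ← enorm_mul, ← h1]
  exact (enorm_integral_le_lintegral_enorm _).trans_eq (lintegral_congr h2)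

/-- By the parallelogram law, the phase of `squareFreq` depends only on the modulus of the difference
of the two frequencies. -/
theorem enorm_squareFreq_eq (g : Plane → ℂ) (t : ℝ) (η : Plane) :
    ‖squareFreq g t η‖ₑ =
      ‖oscInt (8 * Real.pi ^ 2) (fun ζ => g ((1 / 2 : ℝ) • η + ζ) * g ((1 / 2 : ℝ) • η - ζ)) t‖ₑ := by
  have h1 : squareFreq g t η =
      Complex.exp (((2 * Real.pi ^ 2 * t * ‖η‖ ^ 2 : ℝ) : ℂ) * Complex.I) *
      oscInt (8 * Real.pi ^ 2) (fun ζ => g ((1 / 2 : ℝ) • η + ζ) * g ((1 / 2 : ℝ) • η - ζ)) t := by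
    rw [squareFreq, oscInt, ← integral_const_mul,
      ← integral_add_left_eq_self _ ((1 / 2 : ℝ) • η)]
    refine integral_congr_ae (Eventually.of_forall fun ζ => ?_)
    have h2 : η - ((1 / 2 : ℝ) • η + ζ) = (1 / 2 : ℝ) • η - ζ := by
      rw [← sub_sub]
      congr 1
      nth_rewrite 1 [← one_smul ℝ η]
      rw [← sub_smul]
      norm_num
    simp only [h2]
    have h3 : ‖(1 / 2 : ℝ) • η + ζ‖ ^ 2 + ‖(1 / 2 : ℝ) • η - ζ‖ ^ 2
        = ‖η‖ ^ 2 / 2 + 2 * ‖ζ‖ ^ 2 := by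
      rw [norm_add_sq_real, norm_sub_sq_real, norm_smul]
      norm_num
      ring
    rw [h3, ← mul_assoc (Complex.exp _) (Complex.exp _), ← Complex.exp_add]
    congr 2
    push_cast
    ring
  rw [h1, enorm_mul, ← ofReal_norm (Complex.exp _), Complex.norm_exp_ofReal_mul_I,
    ENNReal.ofReal_one, one_mul]

theorem lintegral_squareFreq_sq_le (g : Plane → ℂ) (η : Plane) (hg : AEStronglyMeasurable g) :
    ∫⁻ t, ‖squareFreq g t η‖ₑ ^ 2 ≤ 2⁻¹ * ∫⁻ ξ, ‖g ξ‖ₑ ^ 2 * ‖g (η - ξ)‖ₑ ^ 2 := by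
  simp_rw [enorm_squareFreq_eq]
  set G : Plane → ℂ := fun ζ => g ((1 / 2 : ℝ) • η + ζ) * g ((1 / 2 : ℝ) • η - ζ) with hGdef
  have hGm : AEStronglyMeasurable G := by
    refine AEStronglyMeasurable.mul ?_ ?_
    · exact hg.comp_measurePreserving (measurePreserving_add_left volume _)
    · exact hg.comp_measurePreserving (Measure.measurePreserving_sub_left volume _)
  have hRHS : ∫⁻ ζ, ‖G ζ‖ₑ ^ 2 = ∫⁻ ξ, ‖g ξ‖ₑ ^ 2 * ‖g (η - ξ)‖ₑ ^ 2 := by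
    rw [← lintegral_add_left_eq_self (fun ξ => ‖g ξ‖ₑ ^ 2 * ‖g (η - ξ)‖ₑ ^ 2) ((1 / 2 : ℝ) • η)]
    refine lintegral_congr fun ζ => ?_
    rw [hGdef, enorm_mul, mul_pow]
    congr 4
    rw [← sub_sub]
    congr 1
    nth_rewrite 2 [← one_smul ℝ η]
    rw [← sub_smul]
    norm_num
  rw [← hRHS]
  by_cases hG : Integrable G
  · refine (lintegral_oscInt_sq_le (by positivity) hG).trans_eq ?_
    congr 1
    rw [show 2 * Real.pi ^ 2 / (8 * Real.pi ^ 2) = 4⁻¹ by field_simp; norm_num,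
      ENNReal.ofReal_inv_of_pos (by norm_num)]
    rw [show ENNReal.ofReal 4 = 2 * 2 by norm_num, ENNReal.mul_inv (by simp) (by simp),
      ← mul_assoc, ENNReal.mul_inv_cancel (by simp) (by simp), one_mul]
  -- for a density that is not integrable, the integral `oscInt` is zero by convention
  · have h0 : ∀ t, oscInt (8 * Real.pi ^ 2) G t = 0 := by
      intro t
      refine integral_undef fun h => hG ?_
      refine h.mono hGm (Eventually.of_forall fun ζ => ?_)
      rw [norm_mul (Complex.exp _), Complex.norm_exp_ofReal_mul_I, one_mul]
    simp [h0]

theorem squareFreq_eq_zero {g : Plane → ℂ} {R : ℝ} (hR : ∀ ξ, R ≤ ‖ξ‖ → g ξ = 0) (t : ℝ)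
    {η : Plane} (hη : η ∉ Metric.ball (0 : Plane) (2 * R)) : squareFreq g t η = 0 := by
  rw [mem_ball_zero_iff, not_lt] at hη
  rw [squareFreq, ← integral_zero Plane ℂ]
  refine integral_congr_ae (Eventually.of_forall fun ξ => ?_)
  simp only
  rcases le_or_gt R ‖ξ‖ with h | h
  · rw [hR ξ h, zero_mul, mul_zero]
  · have h1 : R ≤ ‖η - ξ‖ := by
      have := norm_sub_norm_le η ξ
      linarith
    rw [hR _ h1, mul_zero, mul_zero]

theorem measurable_squareFreq {g : Plane → ℂ} (hg : StronglyMeasurable g) :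
    Measurable fun p : ℝ × Plane => squareFreq g p.1 p.2 := by
  refine (StronglyMeasurable.integral_prod_right (ν := (volume : Measure Plane))
    (f := fun (p : ℝ × Plane) ξ => Complex.exp
      (((4 * Real.pi ^ 2 * p.1 * (‖ξ‖ ^ 2 + ‖p.2 - ξ‖ ^ 2) : ℝ) : ℂ) * Complex.I) *
    (g ξ * g (p.2 - ξ))) ?_).measurable
  refine StronglyMeasurable.mul (Continuous.stronglyMeasurable (by fun_prop)) ?_
  refine StronglyMeasurable.mul (hg.comp_measurable measurable_snd) ?_
  exact hg.comp_measurable (measurable_fst.snd.sub measurable_snd)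

/-- The `L⁴_t L^∞_x` Strichartz inequality for frequencies in a ball of radius `R`: Bernstein's
inequality for the square of the wave is combined with the bilinear `L²` estimate. -/
theorem exists_strichartz_ball {g : Plane → ℂ} (hgm : StronglyMeasurable g) (hg : Integrable g)
    {R : ℝ} (hR0 : 0 ≤ R) (hR : ∀ ξ, R ≤ ‖ξ‖ → g ξ = 0) :
    ∃ L : ℝ → ℝ≥0∞, Measurable L ∧ (∀ t x, ‖∫ ξ, chr (t, x) ξ * g ξ‖ₑ ^ 2 ≤ L t) ∧
      ∫⁻ t, L t ^ 2 ≤ ENNReal.ofReal (2 * Real.pi * R ^ 2) * (∫⁻ ξ, ‖g ξ‖ₑ ^ 2) ^ 2 := by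
  have hm := measurable_squareFreq hgm
  refine ⟨fun t => ∫⁻ η, ‖squareFreq g t η‖ₑ, hm.enorm.lintegral_prod_right',
    enorm_integral_chr_sq_le hg, ?_⟩
  have hCS : ∀ t, (∫⁻ η, ‖squareFreq g t η‖ₑ) ^ 2 ≤
      volume (Metric.ball (0 : Plane) (2 * R)) * ∫⁻ η, ‖squareFreq g t η‖ₑ ^ 2 := by
    intro t
    have hmt : AEMeasurable (fun η => ‖squareFreq g t η‖ₑ) :=
      (hm.comp measurable_prodMk_left).enorm.aemeasurable
    have h1 := ENNReal.lintegral_mul_le_Lp_mul_Lq (volume : Measure Plane)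
      (p := 2) (q := 2) (by constructor <;> norm_num)
      (f := (Metric.ball (0 : Plane) (2 * R)).indicator 1) (g := fun η => ‖squareFreq g t η‖ₑ)
      ((measurable_one.indicator Metric.isOpen_ball.measurableSet).aemeasurable) hmt
    have h2 : ∫⁻ η, ((Metric.ball (0 : Plane) (2 * R)).indicator (1 : Plane → ℝ≥0∞) *
        fun η => ‖squareFreq g t η‖ₑ) η
        = ∫⁻ η, ‖squareFreq g t η‖ₑ := by
      refine lintegral_congr fun η => ?_
      by_cases hη : η ∈ Metric.ball (0 : Plane) (2 * R)
      · simp only [Pi.mul_apply, Set.indicator_of_mem hη, Pi.one_apply, one_mul]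
      · simp [squareFreq_eq_zero hR t hη]
    have h3 : ∫⁻ η, ((Metric.ball (0 : Plane) (2 * R)).indicator (1 : Plane → ℝ≥0∞)) η ^ (2 : ℝ)
        = volume (Metric.ball (0 : Plane) (2 * R)) := by
      rw [← lintegral_indicator_one Metric.isOpen_ball.measurableSet]
      refine lintegral_congr fun η => ?_
      by_cases hη : η ∈ Metric.ball (0 : Plane) (2 * R)
      · simp [Set.indicator_of_mem hη]
      · simp [Set.indicator_of_notMem hη]
    rw [h2, h3] at h1
    refine (pow_le_pow_left₀ zero_le h1 2).trans_eq ?_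
    rw [mul_pow, ← ENNReal.rpow_natCast, ← ENNReal.rpow_natCast, ← ENNReal.rpow_mul,
      ← ENNReal.rpow_mul]
    norm_num
  have hsq : ∫⁻ η, ∫⁻ t, ‖squareFreq g t η‖ₑ ^ 2 ≤ 2⁻¹ * (∫⁻ ξ, ‖g ξ‖ₑ ^ 2) ^ 2 := by
    have hgm2 : Measurable fun ξ => ‖g ξ‖ₑ ^ 2 := hgm.measurable.enorm.pow_const 2
    calc ∫⁻ η, ∫⁻ t, ‖squareFreq g t η‖ₑ ^ 2
        ≤ ∫⁻ η, 2⁻¹ * ∫⁻ ξ, ‖g ξ‖ₑ ^ 2 * ‖g (η - ξ)‖ₑ ^ 2 :=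
          lintegral_mono fun η => lintegral_squareFreq_sq_le g η hgm.aestronglyMeasurable
      _ = 2⁻¹ * ∫⁻ η, ∫⁻ ξ, ‖g ξ‖ₑ ^ 2 * ‖g (η - ξ)‖ₑ ^ 2 := by
          rw [lintegral_const_mul' _ _ (by simp)]
      _ = 2⁻¹ * ∫⁻ ξ, ∫⁻ η, ‖g ξ‖ₑ ^ 2 * ‖g (η - ξ)‖ₑ ^ 2 := by
          rw [lintegral_lintegral_swap]
          refine Measurable.aemeasurable ?_
          exact (hgm2.comp measurable_snd).mul (hgm2.comp (measurable_fst.sub measurable_snd))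
      _ = 2⁻¹ * ∫⁻ ξ, ‖g ξ‖ₑ ^ 2 * ∫⁻ η, ‖g η‖ₑ ^ 2 := by
          congr 1
          refine lintegral_congr fun ξ => ?_
          have hgm3 : Measurable fun η => ‖g (η - ξ)‖ₑ ^ 2 :=
            hgm2.comp (measurable_id.sub_const ξ)
          rw [lintegral_const_mul _ hgm3]
          congr 1
          exact lintegral_sub_right_eq_self (fun η => ‖g η‖ₑ ^ 2) ξ
      _ = _ := by rw [lintegral_mul_const _ hgm2, sq]
  calc ∫⁻ t, (∫⁻ η, ‖squareFreq g t η‖ₑ) ^ 2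
      ≤ ∫⁻ t, volume (Metric.ball (0 : Plane) (2 * R)) * ∫⁻ η, ‖squareFreq g t η‖ₑ ^ 2 :=
        lintegral_mono hCS
    _ = volume (Metric.ball (0 : Plane) (2 * R)) * ∫⁻ t, ∫⁻ η, ‖squareFreq g t η‖ₑ ^ 2 :=
        lintegral_const_mul' _ _ measure_ball_lt_top.ne
    _ = volume (Metric.ball (0 : Plane) (2 * R)) * ∫⁻ η, ∫⁻ t, ‖squareFreq g t η‖ₑ ^ 2 := by
        rw [lintegral_lintegral_swap (f := fun t η => ‖squareFreq g t η‖ₑ ^ 2)]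
        exact (hm.enorm.pow_const 2).aemeasurable
    _ ≤ volume (Metric.ball (0 : Plane) (2 * R)) * (2⁻¹ * (∫⁻ ξ, ‖g ξ‖ₑ ^ 2) ^ 2) := by gcongr
    _ = _ := by
        rw [← mul_assoc, EuclideanSpace.volume_ball_fin_two]
        congr 1
        rw [show (2⁻¹ : ℝ≥0∞) = ENNReal.ofReal 2⁻¹ by
            rw [ENNReal.ofReal_inv_of_pos two_pos, ENNReal.ofReal_ofNat],
          ← ENNReal.ofReal_pow (by positivity), ← ENNReal.ofReal_mul (by positivity),
          ← ENNReal.ofReal_mul (by positivity)]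
        congr 1
        ring

/-! ### Dyadic decomposition of the Bessel potential -/

theorem eLpNorm_le_eLpNorm_top_rpow_mul {f : Plane → ℂ} {p r : ℝ≥0∞} (hf : AEStronglyMeasurable f)
    (hr0 : r ≠ 0) (hrp : r ≤ p) (hp : p ≠ ∞) :
    eLpNorm f p volume ≤ eLpNorm f ∞ volume ^ (1 - r.toReal / p.toReal) *
      eLpNorm f r volume ^ (r.toReal / p.toReal) := by
  have hr : r ≠ ∞ := ne_top_of_le_ne_top hp hrp
  have hp0 : p ≠ 0 := fun h => hr0 (le_zero_iff.1 (h ▸ hrp))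
  have hr1 : 0 < r.toReal := ENNReal.toReal_pos hr0 hr
  have hp1 : 0 < p.toReal := ENNReal.toReal_pos hp0 hp
  have hle : r.toReal ≤ p.toReal := ENNReal.toReal_mono hp hrp
  rw [eLpNorm_eq_lintegral_rpow_enorm_toReal hp0 hp, eLpNorm_eq_lintegral_rpow_enorm_toReal hr0 hr,
    ← ENNReal.rpow_mul]
  have h1 : ∫⁻ x, ‖f x‖ₑ ^ p.toReal ≤
      eLpNorm f ∞ volume ^ (p.toReal - r.toReal) * ∫⁻ x, ‖f x‖ₑ ^ r.toReal := by
    rcases eq_or_ne (eLpNorm f ∞ volume) ∞ with htop | htop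
    · rcases hle.eq_or_lt with h | h
      · rw [h, sub_self, ENNReal.rpow_zero, one_mul]
      · rw [htop, ENNReal.top_rpow_of_pos (sub_pos.2 h)]
        by_cases h0 : ∫⁻ x, ‖f x‖ₑ ^ r.toReal = 0
        · have h2 := (lintegral_eq_zero_iff' (hf.enorm.pow_const _)).1 h0
          have h3 : f =ᵐ[volume] 0 := by
            filter_upwards [h2] with x hx
            have := (ENNReal.rpow_eq_zero_iff_of_pos hr1).1 hx
            simpa using this
          rw [eLpNorm_congr_ae h3, eLpNorm_zero] at htop
          exact absurd htop (by simp)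
        · rw [ENNReal.top_mul h0]; exact le_top
    · rw [← lintegral_const_mul' _ _ (ENNReal.rpow_ne_top_of_nonneg (by linarith) htop)]
      refine lintegral_mono_ae ?_
      filter_upwards [ae_le_eLpNormEssSup (f := f) (μ := volume)] with x hx
      rw [← eLpNorm_exponent_top] at hx
      calc ‖f x‖ₑ ^ p.toReal = ‖f x‖ₑ ^ (p.toReal - r.toReal) * ‖f x‖ₑ ^ r.toReal := by
            rw [← ENNReal.rpow_add_of_nonneg _ _ (by linarith) hr1.le]
            congr 1
            ring
        _ ≤ _ := by gcongr
  refine (ENNReal.rpow_le_rpow h1 (by positivity)).trans_eq ?_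
  rw [ENNReal.mul_rpow_of_nonneg _ _ (by positivity), ← ENNReal.rpow_mul]
  congr 2
  · field_simp
  · field_simp

/-- The dyadic radii `0, 1, 2, 4, …`. -/
def dyadicRadius : ℕ → ℝ
  | 0 => 0
  | k + 1 => 2 ^ k

/-- The frequencies of size at least `dyadicRadius k`. -/
def freqTail (k : ℕ) : Set Plane := {ξ | dyadicRadius k ≤ ‖ξ‖}

/-- The dyadic annulus `dyadicRadius k ≤ |ξ| < dyadicRadius (k + 1)`. -/
def annulus (k : ℕ) : Set Plane := {ξ | dyadicRadius k ≤ ‖ξ‖ ∧ ‖ξ‖ < dyadicRadius (k + 1)}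

open Classical in
/-- The symbol of the Bessel potential, restricted to a set of frequencies. -/
def cutSymbol (s : Set Plane) (ξ : Plane) : ℂ := if ξ ∈ s then ((weight ξ)⁻¹ : ℂ) else 0

theorem measurableSet_freqTail (k : ℕ) : MeasurableSet (freqTail k) :=
  measurableSet_le measurable_const measurable_norm

theorem measurableSet_annulus (k : ℕ) : MeasurableSet (annulus k) :=
  (measurableSet_le measurable_const measurable_norm).inter
    (measurableSet_lt measurable_norm measurable_const)

theorem annulus_subset_freqTail (k : ℕ) : annulus k ⊆ freqTail k := fun _ h => h.1

theorem two_pow_le_weight {k : ℕ} {ξ : Plane} (h : ξ ∈ freqTail k) : 2 ^ k ≤ weight ξ := by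
  cases k with
  | zero => simpa using one_le_weight ξ
  | succ k =>
    have h1 : (2 : ℝ) ^ k ≤ ‖ξ‖ := h
    have h2 := norm_le_weight ξ
    rw [pow_succ]
    nlinarith [Real.pi_gt_three, norm_nonneg ξ]

theorem measurable_cutSymbol {s : Set Plane} (hs : MeasurableSet s) : Measurable (cutSymbol s) := by
  classical
  refine Measurable.ite hs ?_ measurable_const
  exact (Complex.measurable_ofReal.comp continuous_weight.measurable).inv

theorem norm_cutSymbol_le {s : Set Plane} {k : ℕ} (hs : s ⊆ freqTail k) (ξ : Plane) :
    ‖cutSymbol s ξ‖ ≤ (2 ^ k)⁻¹ := by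
  classical
  rw [cutSymbol]
  split_ifs with h
  · rw [norm_inv, Complex.norm_real, Real.norm_eq_abs, abs_of_pos (weight_pos ξ)]
    exact inv_anti₀ (by positivity) (two_pow_le_weight (hs h))
  · rw [norm_zero]; positivity

theorem conj_cutSymbol (s : Set Plane) (ξ : Plane) :
    (starRingEnd ℂ) (cutSymbol s ξ) = cutSymbol s ξ := by
  classical
  rw [cutSymbol]
  split_ifs <;> simp

theorem memLp_top_cutSymbol {s : Set Plane} (hm : MeasurableSet s) {k : ℕ} (hs : s ⊆ freqTail k) :
    MemLp (cutSymbol s) ∞ (volume : Measure Plane) :=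
  memLp_top_of_norm_le (measurable_cutSymbol hm) (norm_cutSymbol_le hs)

/-- The part of the Bessel potential of `G` with frequencies in `s`. -/
def besselPart (s : Set Plane) (G : L2) : L2 := 𝓕⁻ (mulOp (cutSymbol s) G)

theorem norm_besselPart_le {s : Set Plane} (hm : MeasurableSet s) {k : ℕ} (hs : s ⊆ freqTail k)
    (G : L2) : ‖besselPart s G‖ ≤ (2 ^ k)⁻¹ * ‖G‖ := by
  have h1 : ‖besselPart s G‖ = ‖mulOp (cutSymbol s) G‖ :=
    (Lp.fourierTransformₗᵢ Plane ℂ).symm.norm_map _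
  rw [h1]
  exact norm_mulOp_le (memLp_top_cutSymbol hm hs) (norm_cutSymbol_le hs) G

theorem bessel_eq_besselPart (G : L2) : bessel G = besselPart (freqTail 0) G := by
  rw [bessel, besselPart]
  congr 3
  funext ξ
  rw [cutSymbol, if_pos]
  exact norm_nonneg ξ

theorem besselPart_freqTail (k : ℕ) (G : L2) : besselPart (freqTail k) G =
    besselPart (annulus k) G + besselPart (freqTail (k + 1)) G := by
  have h1 : mulOp (cutSymbol (freqTail k)) G =
      mulOp (cutSymbol (annulus k)) G + mulOp (cutSymbol (freqTail (k + 1))) G := by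
    apply Lp.ext
    filter_upwards [coeFn_mulOp (memLp_top_cutSymbol (measurableSet_freqTail k) subset_rfl) G,
      coeFn_mulOp (memLp_top_cutSymbol (measurableSet_annulus k) (annulus_subset_freqTail k)) G,
      coeFn_mulOp (memLp_top_cutSymbol (measurableSet_freqTail (k + 1)) subset_rfl) G,
      Lp.coeFn_add (mulOp (cutSymbol (annulus k)) G) (mulOp (cutSymbol (freqTail (k + 1))) G)]
      with ξ h1 h2 h3 h4
    rw [h1, h4, Pi.add_apply, h2, h3, ← add_mul]
    congr 1
    have hmono : dyadicRadius k ≤ dyadicRadius (k + 1) := by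
      cases k with
      | zero => simp [dyadicRadius]
      | succ k => simp only [dyadicRadius, pow_succ]; nlinarith [pow_pos (two_pos (α := ℝ)) k]
    simp only [cutSymbol]
    rcases le_or_gt (dyadicRadius (k + 1)) ‖ξ‖ with h | h
    · have a1 : ξ ∈ freqTail k := hmono.trans h
      have a2 : ξ ∉ annulus k := fun h' => absurd h'.2 (not_lt.2 h)
      have a3 : ξ ∈ freqTail (k + 1) := h
      rw [if_pos a1, if_neg a2, if_pos a3, zero_add]
    · have a3 : ξ ∉ freqTail (k + 1) := not_le.2 h
      rw [if_neg a3, add_zero]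
      by_cases h' : ξ ∈ freqTail k
      · rw [if_pos h', if_pos (show ξ ∈ annulus k from ⟨h', h⟩)]
      · rw [if_neg h', if_neg (fun h2 : ξ ∈ annulus k => h' h2.1)]
  rw [besselPart, h1]
  exact (Lp.fourierTransformₗᵢ Plane ℂ).symm.map_add _ _

theorem bessel_eq_sum_add (G : L2) (N : ℕ) : bessel G =
    ∑ k ∈ Finset.range N, besselPart (annulus k) G + besselPart (freqTail N) G := by
  induction N with
  | zero => rw [Finset.sum_range_zero, zero_add, bessel_eq_besselPart]
  | succ N ih => rw [ih, besselPart_freqTail, Finset.sum_range_succ, add_assoc]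

theorem eLpNorm_Lp_sum_le {p : ℝ≥0∞} (hp : 1 ≤ p) {ι : Type*} (s : Finset ι) (f : ι → L2) :
    eLpNorm (∑ i ∈ s, f i : L2) p volume ≤ ∑ i ∈ s, eLpNorm (f i) p volume := by
  rw [eLpNorm_congr_ae (Lp.coeFn_finsetSum s f)]
  exact eLpNorm_sum_le (fun i _ => Lp.aestronglyMeasurable (f i)) hp

/-- The triangle inequality for the dyadic decomposition. The series converges in `L²`, and the lower
semicontinuity of `L^p` norms under convergence in measure gives the bound. -/
theorem eLpNorm_bessel_le_tsum {p : ℝ≥0∞} (hp : 1 ≤ p) (G : L2) :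
    eLpNorm (bessel G) p volume ≤ ∑' k, eLpNorm (besselPart (annulus k) G) p volume := by
  have h1 : Tendsto (fun N => ∑ k ∈ Finset.range N, besselPart (annulus k) G) atTop
      (𝓝 (bessel G)) := by
    rw [tendsto_iff_norm_sub_tendsto_zero]
    have h2 : Tendsto (fun N : ℕ => ((2 : ℝ) ^ N)⁻¹ * ‖G‖) atTop (𝓝 0) := by
      have := (tendsto_pow_atTop_atTop_of_one_lt (one_lt_two (α := ℝ))).inv_tendsto_atTop
      simpa using this.mul_const ‖G‖
    refine squeeze_zero (fun _ => norm_nonneg _) (fun N => ?_) h2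
    rw [norm_sub_rev, bessel_eq_sum_add G N, add_sub_cancel_left]
    exact norm_besselPart_le (measurableSet_freqTail N) subset_rfl G
  refine eLpNorm_le_of_tendstoInMeasure (Eventually.of_forall fun N => ?_)
    (tendstoInMeasure_of_tendsto_Lp h1) (fun N => Lp.aestronglyMeasurable _)
  exact (eLpNorm_Lp_sum_le hp _ _).trans (ENNReal.sum_le_tsum _)

theorem memLp_two_cutSymbol_annulus (k : ℕ) :
    MemLp (cutSymbol (annulus k)) 2 (volume : Measure Plane) ∧
      eLpNorm (cutSymbol (annulus k)) 2 volume ≤ 2 := by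
  have hsub : ∀ ξ, ξ ∉ Metric.ball (0 : Plane) (2 ^ k) → cutSymbol (annulus k) ξ = 0 := by
    intro ξ h
    rw [cutSymbol, if_neg fun h' => h (mem_ball_zero_iff.2 h'.2)]
  have h1 : ∫⁻ ξ, ‖cutSymbol (annulus k) ξ‖ₑ ^ 2 ≤ ENNReal.ofReal 4 := by
    calc ∫⁻ ξ, ‖cutSymbol (annulus k) ξ‖ₑ ^ 2
        ≤ ∫⁻ ξ in Metric.ball (0 : Plane) (2 ^ k), ENNReal.ofReal ((((2 : ℝ) ^ k)⁻¹) ^ 2) := by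
          rw [← lintegral_indicator Metric.isOpen_ball.measurableSet]
          refine lintegral_mono fun ξ => ?_
          by_cases hξ : ξ ∈ Metric.ball (0 : Plane) (2 ^ k)
          · rw [Set.indicator_of_mem hξ, ← ofReal_norm, ← ENNReal.ofReal_pow (norm_nonneg _)]
            exact ENNReal.ofReal_le_ofReal (pow_le_pow_left₀ (norm_nonneg _)
              (norm_cutSymbol_le (annulus_subset_freqTail k) ξ) 2)
          · rw [hsub ξ hξ]; simp
      _ ≤ ENNReal.ofReal 4 := by
          rw [setLIntegral_const, EuclideanSpace.volume_ball_fin_two,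
            ← ENNReal.ofReal_pow (by positivity), ← ENNReal.ofReal_mul (by positivity),
            ← ENNReal.ofReal_mul (by positivity)]
          refine ENNReal.ofReal_le_ofReal ?_
          rw [← mul_assoc, ← mul_pow, inv_mul_cancel₀ (by positivity), one_pow, one_mul]
          exact Real.pi_le_four
  have h2 : eLpNorm (cutSymbol (annulus k)) 2 volume ≤ 2 := by
    rw [eLpNorm_eq_lintegral_rpow_enorm_toReal two_ne_zero ENNReal.ofNat_ne_top]
    simp only [ENNReal.toReal_ofNat, ENNReal.rpow_ofNat]
    refine (ENNReal.rpow_le_rpow h1 (by norm_num)).trans_eq ?_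
    rw [show ENNReal.ofReal 4 = 2 ^ (2 : ℝ) by norm_num, ← ENNReal.rpow_mul]
    norm_num
  exact ⟨⟨(measurable_cutSymbol (measurableSet_annulus k)).aestronglyMeasurable,
    h2.trans_lt (by simp)⟩, h2⟩

/-- The symbol of a dyadic piece of the Bessel potential as an element of `L²`. -/
def annulusSymbol (k : ℕ) : L2 := (memLp_two_cutSymbol_annulus k).1.toLp

theorem norm_annulusSymbol_le (k : ℕ) : ‖annulusSymbol k‖ ≤ 2 := by
  rw [annulusSymbol, Lp.norm_toLp]
  exact ENNReal.toReal_le_of_le_ofReal zero_le_two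
    (by simpa using (memLp_two_cutSymbol_annulus k).2)

theorem integrable_cutSymbol_mul (k : ℕ) (G : L2) :
    Integrable fun ξ => cutSymbol (annulus k) ξ * G ξ := by
  have := (memLp_two_cutSymbol_annulus k).1.integrable_mul (Lp.memLp G)
  exact this

theorem inner_freqShift_annulusSymbol (k : ℕ) (γ : ℝ × Plane) (G : L2) :
    (inner ℂ (freqShift γ (annulusSymbol k)) G : ℂ) =
      ∫ ξ, chr (-γ) ξ * (cutSymbol (annulus k) ξ * G ξ) := by
  rw [inner_eq_integral]
  refine integral_congr_ae ?_
  filter_upwards [coeFn_freqShift γ (annulusSymbol k),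
    (memLp_two_cutSymbol_annulus k).1.coeFn_toLp] with ξ h1 h2
  rw [h1, annulusSymbol, h2, map_mul, conj_chr, conj_cutSymbol, mul_assoc]

/-- The dyadic pieces of a wave are given by matrix coefficients of the representation
`freqShift`. -/
theorem besselPart_annulus_ae_eq (k : ℕ) (t : ℝ) (G : L2) :
    (besselPart (annulus k) (freqShift (-t, 0) G) : Plane → ℂ) =ᵐ[volume]
      fun x => (inner ℂ (freqShift (t, x) (annulusSymbol k)) G : ℂ) := by
  set F := freqShift (-t, 0) G with hF
  have hi := integrable_cutSymbol_mul k F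
  have hm := coeFn_mulOp (memLp_top_cutSymbol (measurableSet_annulus k)
    (annulus_subset_freqTail k)) F
  have h2 : MemLp (fun ξ => cutSymbol (annulus k) ξ * F ξ) 2 volume :=
    (memLp_congr_ae hm).1 (Lp.memLp _)
  have h3 : besselPart (annulus k) F = 𝓕⁻ (h2.toLp : L2) := by
    rw [besselPart]
    congr 1
    apply Lp.ext
    exact hm.trans h2.coeFn_toLp.symm
  rw [h3]
  filter_upwards [fourierInv_toLp_ae_eq hi h2] with x hx
  rw [hx, Real.fourierInv_eq', inner_freqShift_annulusSymbol]
  refine integral_congr_ae ?_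
  filter_upwards [coeFn_freqShift (-t, 0) G] with ξ h4
  rw [hF, h4, smul_eq_mul]
  have h5 : Complex.exp ((2 * Real.pi * inner ℝ ξ x : ℝ) * Complex.I) * chr (-t, 0) ξ
      = chr (-(t, x)) ξ := by
    rw [chr, chr, ← Complex.exp_add]
    congr 1
    simp only [Prod.fst_neg, Prod.snd_neg, inner_neg_left, inner_zero_left, real_inner_comm x ξ]
    push_cast
    ring
  linear_combination (cutSymbol (annulus k) ξ * G ξ) * h5

theorem eLpNorm_top_besselPart_le {k : ℕ} {t : ℝ} {G : L2} {b : ℝ≥0∞}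
    (hb : ∀ x, ‖(inner ℂ (freqShift (t, x) (annulusSymbol k)) G : ℂ)‖ₑ ≤ b) :
    eLpNorm (besselPart (annulus k) (freqShift (-t, 0) G)) ∞ volume ≤ b := by
  rw [eLpNorm_congr_ae (besselPart_annulus_ae_eq k t G), eLpNorm_exponent_top]
  exact essSup_le_of_ae_le _ (Eventually.of_forall hb)

/-! ### Sobolev and Strichartz estimates -/

theorem norm_freqShift (γ : ℝ × Plane) (G : L2) : ‖freqShift γ G‖ = ‖G‖ :=
  isMixingRep_freqShift.norm_map γ G

theorem eLpNorm_two_eq (f : L2) : eLpNorm f 2 volume = ENNReal.ofReal ‖f‖ := by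
  rw [Lp.norm_def, ENNReal.ofReal_toReal (Lp.eLpNorm_ne_top f)]

theorem enorm_inner_annulusSymbol_le (k : ℕ) (γ : ℝ × Plane) (G : L2) :
    ‖(inner ℂ (freqShift γ (annulusSymbol k)) G : ℂ)‖ₑ ≤ ENNReal.ofReal (2 * ‖G‖) := by
  rw [← ofReal_norm]
  refine ENNReal.ofReal_le_ofReal ((norm_inner_le_norm _ _).trans ?_)
  rw [norm_freqShift]
  exact mul_le_mul_of_nonneg_right (norm_annulusSymbol_le k) (norm_nonneg _)

theorem ennreal_rpow_pow_comm (x : ℝ≥0∞) (y : ℝ) (k : ℕ) : (x ^ y) ^ k = (x ^ k) ^ y := by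
  rw [← ENNReal.rpow_mul_natCast, ← ENNReal.rpow_natCast_mul, mul_comm]

/-- Interpolation between `L²` and `L^∞` for a dyadic piece of a wave. -/
theorem eLpNorm_besselPart_annulus_le {p : ℝ≥0∞} (hp2 : 2 ≤ p) (hp : p ≠ ∞) {k : ℕ} {t : ℝ}
    {G : L2} {b : ℝ≥0∞} {C : ℝ} (hG : ‖G‖ ≤ C)
    (hb : ∀ x, ‖(inner ℂ (freqShift (t, x) (annulusSymbol k)) G : ℂ)‖ₑ ≤ b) :
    eLpNorm (besselPart (annulus k) (freqShift (-t, 0) G)) p volume ≤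
      b ^ (1 - 2 / p.toReal) *
        (ENNReal.ofReal C ^ (2 / p.toReal) * (2⁻¹ ^ (2 / p.toReal)) ^ k) := by
  have hp1 : 2 ≤ p.toReal := by
    have := ENNReal.toReal_mono hp hp2
    simpa using this
  have h0 : 0 ≤ 1 - 2 / p.toReal := by
    rw [sub_nonneg, div_le_one (by linarith)]; exact hp1
  refine (eLpNorm_le_eLpNorm_top_rpow_mul (Lp.aestronglyMeasurable _) two_ne_zero hp2 hp).trans ?_
  rw [ENNReal.toReal_ofNat]
  refine mul_le_mul' (ENNReal.rpow_le_rpow (eLpNorm_top_besselPart_le hb) h0) ?_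
  rw [ennreal_rpow_pow_comm, ← ENNReal.mul_rpow_of_nonneg _ _ (by positivity)]
  refine ENNReal.rpow_le_rpow ?_ (by positivity)
  rw [eLpNorm_two_eq, mul_comm]
  have h1 := norm_besselPart_le (measurableSet_annulus k) (annulus_subset_freqTail k)
    (freqShift (-t, 0) G)
  rw [norm_freqShift] at h1
  have h2 : ‖besselPart (annulus k) (freqShift (-t, 0) G)‖ ≤ (2⁻¹ : ℝ) ^ k * C := by
    rw [inv_pow]
    exact h1.trans (mul_le_mul_of_nonneg_left hG (by positivity))
  refine (ENNReal.ofReal_le_ofReal h2).trans_eq ?_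
  rw [ENNReal.ofReal_mul (by positivity), ENNReal.ofReal_pow (by positivity),
    ENNReal.ofReal_inv_of_pos two_pos, ENNReal.ofReal_ofNat, mul_comm]

theorem tsum_geometric_half_rpow_ne_top {a : ℝ} (ha : 0 < a) :
    ∑' k : ℕ, ((2⁻¹ : ℝ≥0∞) ^ a) ^ k ≠ ∞ := by
  rw [ENNReal.tsum_geometric]
  have h1 : (2⁻¹ : ℝ≥0∞) ^ a < 1 := ENNReal.rpow_lt_one (by norm_num) ha
  exact ENNReal.inv_ne_top.2 (tsub_pos_of_lt h1).ne'

/-- The Sobolev embedding `H¹ ⊆ L^p` for `2 ≤ p < ∞`. -/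
theorem exists_eLpNorm_bessel_le {p : ℝ≥0∞} (hp2 : 2 ≤ p) (hp : p ≠ ∞) :
    ∃ K : ℝ≥0∞, K ≠ ∞ ∧ ∀ G, eLpNorm (bessel G) p volume ≤ K * ENNReal.ofReal ‖G‖ := by
  have hp1 : 2 ≤ p.toReal := by
    have := ENNReal.toReal_mono hp hp2
    simpa using this
  have h0 : 0 ≤ 1 - 2 / p.toReal := by
    rw [sub_nonneg, div_le_one (by linarith)]; exact hp1
  refine ⟨2 ^ (1 - 2 / p.toReal) * ∑' k : ℕ, ((2⁻¹ : ℝ≥0∞) ^ (2 / p.toReal)) ^ k,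
    ENNReal.mul_ne_top (ENNReal.rpow_ne_top_of_nonneg h0 (by simp))
      (tsum_geometric_half_rpow_ne_top (by positivity)), fun G => ?_⟩
  refine (eLpNorm_bessel_le_tsum (le_trans one_le_two hp2) G).trans ?_
  rw [mul_right_comm, ← ENNReal.tsum_mul_left]
  refine ENNReal.tsum_le_tsum fun k => ?_
  have h1 := eLpNorm_besselPart_annulus_le hp2 hp (k := k) (t := 0) le_rfl
    (fun x => enorm_inner_annulusSymbol_le k (0, x) G)
  rw [neg_zero, show ((0 : ℝ), (0 : Plane)) = 0 from rfl, freqShift_zero] at h1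
  refine h1.trans_eq ?_
  rw [ENNReal.ofReal_mul zero_le_two, ENNReal.mul_rpow_of_nonneg _ _ h0, ENNReal.ofReal_ofNat,
    mul_assoc, ← mul_assoc (_ ^ (1 - 2 / p.toReal)) (_ ^ (2 / p.toReal)),
    ← ENNReal.rpow_add_of_nonneg _ _ h0 (by positivity), sub_add_cancel, ENNReal.rpow_one]
  ring

/-- A wave that is bounded in `H¹` is small in `L^p` at every time at which finitely many of its
matrix coefficients are small. -/
theorem exists_eLpNorm_bessel_le_of_inner_le {p : ℝ≥0∞} (hp2 : 2 < p) (hp : p ≠ ∞) (C : ℝ)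
    {ε : ℝ≥0∞} (hε : 0 < ε) :
    ∃ (N : ℕ) (δ : ℝ), 0 < δ ∧ ∀ (G : L2) (t : ℝ), ‖G‖ ≤ C →
      (∀ k < N, ∀ x, ‖(inner ℂ (freqShift (t, x) (annulusSymbol k)) G : ℂ)‖ ≤ δ) →
      eLpNorm (bessel (freqShift (-t, 0) G)) p volume ≤ ε := by
  have hp1 : 2 < p.toReal := by
    have := (ENNReal.toReal_lt_toReal (by simp) hp).2 hp2
    simpa using this
  have h0 : 0 < 1 - 2 / p.toReal := by
    rw [sub_pos, div_lt_one (by linarith)]; exact hp1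
  set q : ℝ≥0∞ := (2⁻¹ : ℝ≥0∞) ^ (2 / p.toReal) with hq
  have hqsum : ∑' k : ℕ, q ^ k ≠ ∞ := tsum_geometric_half_rpow_ne_top (by positivity)
  set B : ℝ≥0∞ := ENNReal.ofReal (2 * C) with hB
  set D : ℝ≥0∞ := ENNReal.ofReal C ^ (2 / p.toReal) with hD
  have hDtop : D ≠ ∞ := ENNReal.rpow_ne_top_of_nonneg (by positivity) ENNReal.ofReal_ne_top
  have hBtop : B ^ (1 - 2 / p.toReal) ≠ ∞ :=
    ENNReal.rpow_ne_top_of_nonneg h0.le ENNReal.ofReal_ne_top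
  have hsum : ∑' k : ℕ, B ^ (1 - 2 / p.toReal) * (D * q ^ k) ≠ ∞ := by
    rw [ENNReal.tsum_mul_left, ENNReal.tsum_mul_left]
    exact ENNReal.mul_ne_top hBtop (ENNReal.mul_ne_top hDtop hqsum)
  have hε2 : 0 < ε / 2 := ENNReal.half_pos hε.ne'
  obtain ⟨N, hN⟩ := ((ENNReal.tendsto_sum_nat_add _ hsum).eventually_lt_const hε2).exists
  have hδ : Tendsto (fun δ : ℝ => ENNReal.ofReal δ ^ (1 - 2 / p.toReal) * (D * ∑' k : ℕ, q ^ k))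
      (𝓝[>] 0) (𝓝 0) := by
    have h1 : Tendsto (fun δ : ℝ => ENNReal.ofReal δ ^ (1 - 2 / p.toReal)) (𝓝[>] 0) (𝓝 0) := by
      have h2 : Continuous fun δ : ℝ => ENNReal.ofReal δ ^ (1 - 2 / p.toReal) :=
        (ENNReal.continuous_rpow_const).comp ENNReal.continuous_ofReal
      have h3 := (h2.tendsto 0).mono_left (nhdsWithin_le_nhds (s := Set.Ioi 0))
      rwa [ENNReal.ofReal_zero, ENNReal.zero_rpow_of_pos h0] at h3
    have h4 := ENNReal.Tendsto.mul_const (b := D * ∑' k : ℕ, q ^ k) h1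
      (Or.inr (ENNReal.mul_ne_top hDtop hqsum))
    rwa [zero_mul] at h4
  obtain ⟨δ, hδ1, hδ0⟩ := ((hδ.eventually_lt_const hε2).and self_mem_nhdsWithin).exists
  refine ⟨N, δ, hδ0, fun G t hG hsmall => ?_⟩
  refine (eLpNorm_bessel_le_tsum (one_le_two.trans hp2.le) _).trans ?_
  rw [← ENNReal.summable.sum_add_tsum_nat_add' (k := N) (f := fun k =>
    eLpNorm (besselPart (annulus k) (freqShift (-t, 0) G)) p volume), ← ENNReal.add_halves ε]
  refine add_le_add ?_ ?_
  · refine le_trans ?_ hδ1.le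
    calc ∑ k ∈ Finset.range N, eLpNorm (besselPart (annulus k) (freqShift (-t, 0) G)) p volume
        ≤ ∑ k ∈ Finset.range N, ENNReal.ofReal δ ^ (1 - 2 / p.toReal) * (D * q ^ k) := by
          refine Finset.sum_le_sum fun k hk => ?_
          refine eLpNorm_besselPart_annulus_le hp2.le hp hG fun x => ?_
          rw [← ofReal_norm]
          exact ENNReal.ofReal_le_ofReal (hsmall k (Finset.mem_range.1 hk) x)
      _ ≤ ∑' k, ENNReal.ofReal δ ^ (1 - 2 / p.toReal) * (D * q ^ k) := ENNReal.sum_le_tsum _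
      _ = _ := by rw [ENNReal.tsum_mul_left, ENNReal.tsum_mul_left]
  · refine le_trans (ENNReal.tsum_le_tsum fun k => ?_) hN.le
    refine eLpNorm_besselPart_annulus_le hp2.le hp hG fun x => ?_
    refine (enorm_inner_annulusSymbol_le _ (t, x) G).trans ?_
    exact ENNReal.ofReal_le_ofReal (by linarith)

/-- The Strichartz inequality for a dyadic piece of a wave. -/
theorem exists_strichartz_annulus (k : ℕ) (G : L2) :
    ∃ L : ℝ → ℝ≥0∞, Measurable L ∧
      (∀ t, eLpNorm (besselPart (annulus k) (freqShift (-t, 0) G)) ∞ volume ≤ L t ^ (1 / 2 : ℝ)) ∧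
      ∫⁻ t, L t ^ 2 ≤ ENNReal.ofReal (2 * Real.pi * ‖G‖ ^ 4) * (4⁻¹) ^ k := by
  set g : Plane → ℂ := fun ξ => cutSymbol (annulus k) ξ * G ξ with hg
  have hgm : StronglyMeasurable g :=
    (measurable_cutSymbol (measurableSet_annulus k)).stronglyMeasurable.mul (Lp.stronglyMeasurable G)
  have hgR : ∀ ξ, (2 : ℝ) ^ k ≤ ‖ξ‖ → g ξ = 0 := by
    intro ξ h
    have h1 : ξ ∉ annulus k := fun h' => absurd h'.2 (not_lt.2 h)
    rw [hg]
    simp only [cutSymbol, if_neg h1, zero_mul]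
  obtain ⟨L, hLm, hL, hint⟩ := exists_strichartz_ball hgm (integrable_cutSymbol_mul k G)
    (by positivity) hgR
  refine ⟨fun t => L (-t), hLm.comp measurable_neg, fun t => ?_, ?_⟩
  · refine eLpNorm_top_besselPart_le fun x => ?_
    rw [inner_freqShift_annulusSymbol]
    have h1 := ENNReal.rpow_le_rpow (hL (-t) (-x)) (z := 1 / 2) (by norm_num)
    rw [← ENNReal.rpow_natCast, ← ENNReal.rpow_mul] at h1
    norm_num at h1
    simpa using h1
  · rw [lintegral_neg_eq_self (fun t => L t ^ 2)]
    refine hint.trans ?_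
    have h1 : ∫⁻ ξ, ‖g ξ‖ₑ ^ 2 ≤ ENNReal.ofReal (((2 ^ k)⁻¹ * ‖G‖) ^ 2) := by
      have h2 : ∫⁻ ξ, ‖G ξ‖ₑ ^ 2 = ENNReal.ofReal (‖G‖ ^ 2) := by
        rw [norm_sq_eq_integral, ofReal_integral_eq_lintegral_ofReal
          ((Lp.memLp G).integrable_norm_pow (by norm_num))
          (Eventually.of_forall fun _ => by positivity)]
        refine lintegral_congr fun ξ => ?_
        rw [ENNReal.ofReal_pow (norm_nonneg _), ofReal_norm]
      rw [mul_pow, ENNReal.ofReal_mul (by positivity), ← h2, ← lintegral_const_mul' _ _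
        ENNReal.ofReal_ne_top]
      refine lintegral_mono fun ξ => ?_
      simp only [hg]
      rw [enorm_mul, mul_pow]
      gcongr
      rw [← ofReal_norm, ← ENNReal.ofReal_pow (norm_nonneg _)]
      exact ENNReal.ofReal_le_ofReal (pow_le_pow_left₀ (norm_nonneg _)
        (norm_cutSymbol_le (annulus_subset_freqTail k) ξ) 2)
    refine (mul_le_mul_right (pow_le_pow_left₀ zero_le h1 2) _).trans_eq ?_
    rw [show (4⁻¹ : ℝ≥0∞) ^ k = ENNReal.ofReal ((4⁻¹ : ℝ) ^ k) by
        rw [ENNReal.ofReal_pow (by positivity), ENNReal.ofReal_inv_of_pos (by norm_num),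
          ENNReal.ofReal_ofNat],
      ← ENNReal.ofReal_pow (by positivity), ← ENNReal.ofReal_mul (by positivity),
      ← ENNReal.ofReal_mul (by positivity)]
    congr 1
    have h3 : ((4 : ℝ)⁻¹) ^ k = ((2 ^ k)⁻¹) ^ 2 := by
      rw [← inv_pow, ← pow_mul, mul_comm k 2, pow_mul]; norm_num
    rw [h3]
    field_simp

/-- The `L⁴_t L^∞_x` Strichartz inequality in `H¹`. -/
theorem exists_strichartz :
    ∃ K : ℝ≥0∞, K ≠ ∞ ∧ ∀ G : L2, ∃ h : ℝ → ℝ≥0∞,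
      (∀ t, eLpNorm (bessel (freqShift (-t, 0) G)) ∞ volume ≤ h t) ∧
      ∫⁻ t, h t ^ 4 ≤ K * ENNReal.ofReal ‖G‖ ^ 4 := by
  set c : ℝ≥0∞ := ∑' k : ℕ, ((2⁻¹ : ℝ≥0∞) ^ (1 / 4 : ℝ)) ^ k with hc
  have hctop : c ≠ ∞ := tsum_geometric_half_rpow_ne_top (by norm_num)
  refine ⟨c ^ 4 * (ENNReal.ofReal (2 * Real.pi) * ∑' k : ℕ, (2⁻¹ : ℝ≥0∞) ^ k), ?_, fun G => ?_⟩
  · refine ENNReal.mul_ne_top (ENNReal.pow_ne_top hctop) (ENNReal.mul_ne_top ENNReal.ofReal_ne_top ?_)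
    rw [ENNReal.tsum_geometric_two]; simp
  choose L hLm hL hint using fun k => exists_strichartz_annulus k G
  refine ⟨fun t => ∑' k, L k t ^ (1 / 2 : ℝ), fun t => ?_, ?_⟩
  · exact (eLpNorm_bessel_le_tsum le_top _).trans (ENNReal.tsum_le_tsum fun k => hL k t)
  -- each term is at most a geometric factor times the fourth root of the sum weighted by `2 ^ k`
  have hpt : ∀ t, (∑' k, L k t ^ (1 / 2 : ℝ)) ^ 4 ≤ c ^ 4 * ∑' k, 2 ^ k * L k t ^ 2 := by
    intro t
    set X : ℝ≥0∞ := ∑' k, 2 ^ k * L k t ^ 2 with hX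
    have h1 : ∀ k, L k t ^ (1 / 2 : ℝ) ≤ ((2⁻¹ : ℝ≥0∞) ^ (1 / 4 : ℝ)) ^ k * X ^ (1 / 4 : ℝ) := by
      intro k
      have h2 : L k t ^ 2 ≤ (2⁻¹) ^ k * X := by
        calc L k t ^ 2 = (2⁻¹) ^ k * (2 ^ k * L k t ^ 2) := by
              rw [← mul_assoc, ← mul_pow, ENNReal.inv_mul_cancel (by simp) (by simp), one_pow,
                one_mul]
          _ ≤ _ := by gcongr; exact ENNReal.le_tsum k
      have h3 := ENNReal.rpow_le_rpow h2 (z := 1 / 4) (by norm_num)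
      rw [ENNReal.mul_rpow_of_nonneg _ _ (by norm_num), ← ENNReal.rpow_natCast,
        ← ENNReal.rpow_mul] at h3
      rw [ennreal_rpow_pow_comm]
      norm_num at h3 ⊢
      exact h3
    have h4 : ∑' k, L k t ^ (1 / 2 : ℝ) ≤ c * X ^ (1 / 4 : ℝ) := by
      rw [hc, ← ENNReal.tsum_mul_right]
      exact ENNReal.tsum_le_tsum h1
    refine (pow_le_pow_left₀ zero_le h4 4).trans_eq ?_
    rw [mul_pow, ← ENNReal.rpow_natCast (X ^ (1 / 4 : ℝ)), ← ENNReal.rpow_mul]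
    norm_num
  refine (lintegral_mono hpt).trans ?_
  have hm : ∀ k, AEMeasurable (fun t => 2 ^ k * L k t ^ 2) (volume : Measure ℝ) :=
    fun k => (((hLm k).pow_const 2).const_mul _).aemeasurable
  rw [lintegral_const_mul' _ _ (ENNReal.pow_ne_top hctop), lintegral_tsum hm, mul_assoc (c ^ 4)]
  gcongr
  rw [mul_right_comm, ← ENNReal.tsum_mul_left]
  refine ENNReal.tsum_le_tsum fun k => ?_
  rw [lintegral_const_mul' _ _ (by simp)]
  refine (mul_le_mul_right (hint k) _).trans_eq ?_
  rw [ENNReal.ofReal_mul (by positivity), ENNReal.ofReal_pow (norm_nonneg _), mul_left_comm,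
    ← mul_pow]
  congr 2
  rw [show (4 : ℝ≥0∞) = 2 * 2 by norm_num, ENNReal.mul_inv (by simp) (by simp), ← mul_assoc,
    ENNReal.mul_inv_cancel (by simp) (by simp), one_mul]

/-! ### Smallness of the Strichartz norm -/

/-- The exponents of an admissible pair in the range of the Strichartz norm. The endpoint
`q = ∞` does not occur, since it forces `r = 4 < a`; the last identity is the scaling relation that
places `(q, r)` between `(∞, 4)` and `(4, ∞)`. -/
theorem Admissible.exponents {a : ℝ} (ha : 4 < a) {q r : ℝ≥0∞} (h : Admissible (1 / 2) q r)
    (har : ENNReal.ofReal a ≤ r) (hr : r ≤ ENNReal.ofReal (4 * a / (a - 4))) :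
    q ≠ ∞ ∧ r ≠ ∞ ∧ 4 < r ∧ (a - 4) / a ≤ 4 / r.toReal ∧ 1 ≤ q.toReal ∧
      (1 - 4 / r.toReal) * q.toReal = 4 := by
  obtain ⟨h1, h2, h3, -⟩ := h
  have hrtop : r ≠ ∞ := ne_top_of_le_ne_top ENNReal.ofReal_ne_top hr
  have hR : a ≤ r.toReal := (ENNReal.ofReal_le_iff_le_toReal hrtop).1 har
  have hR0 : 0 < r.toReal := by linarith
  have hr0 : r ≠ 0 := by rintro rfl; simp at hR0
  have e1 : (2 / r : ℝ≥0∞) = ENNReal.ofReal (2 / r.toReal) := by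
    rw [ENNReal.ofReal_div_of_pos hR0, ENNReal.ofReal_toReal hrtop, ENNReal.ofReal_ofNat]
  have hqtop : q ≠ ∞ := by
    rintro rfl
    rw [ENNReal.div_top, zero_add, e1, ENNReal.ofReal_eq_ofReal_iff (by positivity) (by norm_num),
      div_eq_iff hR0.ne'] at h1
    linarith
  have hQ : 2 ≤ q.toReal := by
    have := ENNReal.toReal_mono hqtop h2
    simpa using this
  have hQ0 : 0 < q.toReal := by linarith
  have e2 : (2 / q : ℝ≥0∞) = ENNReal.ofReal (2 / q.toReal) := by
    rw [ENNReal.ofReal_div_of_pos hQ0, ENNReal.ofReal_toReal hqtop, ENNReal.ofReal_ofNat]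
  rw [e1, e2, ← ENNReal.ofReal_add (by positivity) (by positivity),
    ENNReal.ofReal_eq_ofReal_iff (by positivity) (by norm_num)] at h1
  refine ⟨hqtop, hrtop, ?_, ?_, by linarith, ?_⟩
  · refine lt_of_lt_of_le ?_ har
    rw [← ENNReal.ofReal_ofNat]
    exact (ENNReal.ofReal_lt_ofReal_iff (by linarith)).2 ha
  · have h4 : r.toReal ≤ 4 * a / (a - 4) :=
      ENNReal.toReal_le_of_le_ofReal (div_nonneg (by linarith) (by linarith)) hr
    rw [le_div_iff₀ (by linarith)] at h4
    rw [div_le_div_iff₀ (by linarith) hR0]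
    linarith
  · field_simp at h1 ⊢
    linarith

/-- The Strichartz norm of a wave is controlled by its `L^∞_t L⁴_x` norm, by interpolation with the
`L⁴_t L^∞_x` Strichartz inequality. -/
theorem exists_strichartzNorm_le_of_eLpNorm_four_le {a : ℝ} (ha : 4 < a) (C : ℝ) :
    ∃ K : ℝ≥0∞, K ≠ ∞ ∧ ∀ (G : L2) (B : ℝ≥0∞), ‖G‖ ≤ C → B ≤ 1 →
      (∀ t, eLpNorm (bessel (freqShift (-t, 0) G)) 4 volume ≤ B) →
      strichartzNorm a (fun τ => schrodinger τ (bessel G)) ≤ B ^ ((a - 4) / a) * K := by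
  obtain ⟨K, hK, hS⟩ := exists_strichartz
  refine ⟨max 1 (K * ENNReal.ofReal C ^ 4), ?_, fun G B hG hB h4 => ?_⟩
  · simp only [ne_eq, max_eq_top, ENNReal.one_ne_top, false_or]
    exact ENNReal.mul_ne_top hK (ENNReal.pow_ne_top ENNReal.ofReal_ne_top)
  obtain ⟨h, hh, hint⟩ := hS G
  refine iSup_le fun q => iSup_le fun r => iSup_le fun hqr => ?_
  obtain ⟨hqtop, hrtop, hr4, hκ, hq1, hqr4⟩ := hqr.1.exponents ha hqr.2.2.1 hqr.2.2.2
  have hQ0 : 0 < q.toReal := by linarith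
  have hR4 : 4 < r.toReal := by
    have := (ENNReal.toReal_lt_toReal (by simp) hrtop).2 hr4
    simpa using this
  have h0 : 0 ≤ 1 - 4 / r.toReal := by
    rw [sub_nonneg, div_le_one (by linarith)]; exact hR4.le
  have hq0 : q ≠ 0 := by rintro rfl; simp at hQ0
  rw [mixedNorm, eLpNorm_eq_lintegral_rpow_enorm_toReal hq0 hqtop]
  have hpt : ∀ t, ‖eLpNorm (schrodinger t (bessel G)) r volume‖ₑ ^ q.toReal ≤
      (B ^ (4 / r.toReal)) ^ q.toReal * h t ^ 4 := by
    intro t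
    rw [enorm_eq_self, schrodinger_bessel]
    have h1 := (eLpNorm_le_eLpNorm_top_rpow_mul (Lp.aestronglyMeasurable
      (bessel (freqShift (-t, 0) G))) four_ne_zero hr4.le hrtop)
    rw [ENNReal.toReal_ofNat] at h1
    have h2 : eLpNorm (bessel (freqShift (-t, 0) G)) r volume ≤
        h t ^ (1 - 4 / r.toReal) * B ^ (4 / r.toReal) :=
      h1.trans (mul_le_mul' (ENNReal.rpow_le_rpow (hh t) h0)
        (ENNReal.rpow_le_rpow (h4 t) (by positivity)))
    refine (ENNReal.rpow_le_rpow h2 hQ0.le).trans_eq ?_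
    rw [ENNReal.mul_rpow_of_nonneg _ _ hQ0.le, ← ENNReal.rpow_mul, hqr4, mul_comm]
    norm_num
  refine (ENNReal.rpow_le_rpow (lintegral_mono hpt) (by positivity)).trans ?_
  have hBtop : (B ^ (4 / r.toReal)) ^ q.toReal ≠ ∞ :=
    ENNReal.rpow_ne_top_of_nonneg hQ0.le (ENNReal.rpow_ne_top_of_nonneg (by positivity)
      (ne_top_of_le_ne_top ENNReal.one_ne_top hB))
  rw [lintegral_const_mul' _ _ hBtop, ENNReal.mul_rpow_of_nonneg _ _ (by positivity),
    ← ENNReal.rpow_mul, mul_one_div_cancel hQ0.ne', ENNReal.rpow_one]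
  refine mul_le_mul' (ENNReal.rpow_le_rpow_of_exponent_ge hB hκ) ?_
  have h5 : ∫⁻ t, h t ^ 4 ≤ max 1 (K * ENNReal.ofReal C ^ 4) :=
    (hint.trans (by gcongr)).trans (le_max_right _ _)
  refine (ENNReal.rpow_le_rpow h5 (by positivity)).trans ?_
  refine (ENNReal.rpow_le_rpow_of_exponent_le (le_max_left _ _) ?_).trans_eq (ENNReal.rpow_one _)
  rw [div_le_one hQ0]; exact hq1

/-- A wave that is bounded in `H¹` has a small Strichartz norm as soon as finitely many of its
matrix coefficients are small. -/
theorem exists_strichartzNorm_le_of_inner_le {a : ℝ} (ha : 4 < a) (C : ℝ) {ε : ℝ≥0∞} (hε : 0 < ε) :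
    ∃ (N : ℕ) (δ : ℝ), 0 < δ ∧ ∀ G : L2, ‖G‖ ≤ C →
      (∀ k < N, ∀ γ, ‖(inner ℂ (freqShift γ (annulusSymbol k)) G : ℂ)‖ ≤ δ) →
      strichartzNorm a (fun τ => schrodinger τ (bessel G)) ≤ ε := by
  obtain ⟨K, hK, hS⟩ := exists_strichartzNorm_le_of_eLpNorm_four_le ha C
  have hκ : 0 < (a - 4) / a := div_pos (by linarith) (by linarith)
  have h1 : Tendsto (fun B : ℝ≥0∞ => B ^ ((a - 4) / a) * K) (𝓝[>] 0) (𝓝 0) := by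
    have h3 := ((ENNReal.continuous_rpow_const (y := (a - 4) / a)).tendsto 0).mono_left
      (nhdsWithin_le_nhds (s := Set.Ioi 0))
    rw [ENNReal.zero_rpow_of_pos hκ] at h3
    have h4 := ENNReal.Tendsto.mul_const (b := K) h3 (Or.inr hK)
    rwa [zero_mul] at h4
  obtain ⟨B, ⟨hB1, hB2⟩, hB0⟩ := (((h1.eventually_lt_const hε).and
    (mem_nhdsWithin_of_mem_nhds (Iic_mem_nhds one_pos))).and self_mem_nhdsWithin).exists
  obtain ⟨N, δ, hδ, h⟩ := exists_eLpNorm_bessel_le_of_inner_le (p := 4) (by norm_num) (by simp) C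
    (show (0 : ℝ≥0∞) < B from hB0)
  exact ⟨N, δ, hδ, fun G hG hs =>
    (hS G B hG hB2 fun t => h G t hG fun k hk x => hs k hk (t, x)).trans hB1.le⟩

/-! ### Existence of the decomposition -/

/-- Countably many properties of convergence along an ultrafilter hold along one subsequence. -/
theorem exists_strictMono_tendsto {ι : Type*} [Countable ι] {𝒰 : Ultrafilter ℕ}
    (h𝒰 : (𝒰 : Filter ℕ) ≤ atTop) (F : ι → Filter ℕ) [∀ i, (F i).IsCountablyGenerated]
    (hF : ∀ i, (𝒰 : Filter ℕ) ≤ F i) : ∃ σ : ℕ → ℕ, StrictMono σ ∧ ∀ i, Tendsto σ atTop (F i) := by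
  have hne : NeBot ((⨅ i, F i) ⊓ map id atTop) := by
    rw [map_id]
    exact 𝒰.neBot.mono (le_inf (le_iInf hF) h𝒰)
  obtain ⟨σ, hσ, h⟩ := subseq_tendsto_of_neBot hne
  exact ⟨σ, hσ, fun i => h.mono_right (iInf_le F i)⟩

/-- Weak convergence of a bounded sequence may be tested on a dense sequence. -/
theorem WeakLim.of_denseRange {H : Type*} [NormedAddCommGroup H] [InnerProductSpace ℂ H]
    {l : Filter ℕ} {w : ℕ → H} {B : ℝ} (hB : ∀ n, ‖w n‖ ≤ B) {d : ℕ → H} (hd : DenseRange d)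
    (h : ∀ i, Tendsto (fun n => (inner ℂ (d i) (w n) : ℂ)) l (𝓝 0)) : WeakLim l w 0 := by
  intro f
  rw [inner_zero_right, tendsto_zero_iff_norm_tendsto_zero, Metric.tendsto_nhds]
  intro ε hε
  have hB1 : 0 < |B| + 1 := by positivity
  obtain ⟨i, hi⟩ := hd.exists_dist_lt f (ε := ε / 2 / (|B| + 1)) (by positivity)
  filter_upwards [(h i).norm.eventually_lt_const (u := ε / 2) (by simpa using half_pos hε)] with n hn
  rw [Real.dist_eq, sub_zero, abs_norm]
  have h1 : (inner ℂ f (w n) : ℂ) = inner ℂ (f - d i) (w n) + inner ℂ (d i) (w n) := by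
    rw [inner_sub_left, sub_add_cancel]
  have h2 : ‖(inner ℂ (f - d i) (w n) : ℂ)‖ ≤ ε / 2 := by
    refine (norm_inner_le_norm _ _).trans ?_
    rw [dist_eq_norm] at hi
    have h3 : ‖w n‖ ≤ |B| + 1 := (hB n).trans ((le_abs_self B).trans (by linarith))
    calc ‖f - d i‖ * ‖w n‖ ≤ ε / 2 / (|B| + 1) * (|B| + 1) := by gcongr
      _ = ε / 2 := div_mul_cancel₀ _ hB1.ne'
  rw [h1]
  exact (norm_add_le _ _).trans_lt (by linarith)

/-- If the matrix coefficients of the remainders `W M n` are small for large `M`, uniformly in the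
shift, then the limits in `n` of their Strichartz norms tend to zero as `M → ∞`. -/
theorem exists_strichartzNorm_limits {a : ℝ} (ha : 4 < a) {𝒰 : Ultrafilter ℕ} {C : ℝ}
    {W : ℕ → ℕ → L2} (hWC : ∀ M, ∀ᶠ n in (𝒰 : Filter ℕ), ‖W M n‖ ≤ C)
    (hsmall : ∀ χ : L2, ∀ ε > 0, ∃ M₀, ∀ M ≥ M₀, ∀ᶠ n in (𝒰 : Filter ℕ), ∀ γ,
        ‖(inner ℂ (freqShift γ χ) (W M n) : ℂ)‖ ≤ ε) :
    ∃ ℓ : ℕ → ℝ≥0∞, (∀ M, Tendsto (fun n => strichartzNorm a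
      (fun τ => schrodinger τ (bessel (W M n)))) 𝒰 (𝓝 (ℓ M))) ∧ Tendsto ℓ atTop (𝓝 0) := by
  have h1 : ∀ M, ∃ y : ℝ≥0∞, Tendsto (fun n => strichartzNorm a
      (fun τ => schrodinger τ (bessel (W M n)))) 𝒰 (𝓝 y) := by
    intro M
    obtain ⟨y, -, hy⟩ := isCompact_univ.ultrafilter_le_nhds (𝒰.map fun n => strichartzNorm a
      (fun τ => schrodinger τ (bessel (W M n)))) (by simp)
    exact ⟨y, hy⟩
  choose ℓ hℓ using h1
  refine ⟨ℓ, hℓ, ?_⟩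
  rw [ENNReal.tendsto_nhds_zero]
  intro ε hε
  obtain ⟨N, δ, hδ, h⟩ := exists_strichartzNorm_le_of_inner_le ha C hε
  choose M₀ hM₀ using fun k => hsmall (annulusSymbol k) δ hδ
  filter_upwards [eventually_ge_atTop ((Finset.range N).sup M₀)] with M hM
  refine le_of_tendsto (hℓ M) ?_
  have h2 : ∀ᶠ n in (𝒰 : Filter ℕ), ∀ k ∈ Finset.range N, ∀ γ,
      ‖(inner ℂ (freqShift γ (annulusSymbol k)) (W M n) : ℂ)‖ ≤ δ :=
    (Filter.eventually_all_finset _).2 fun k hk => hM₀ k M ((Finset.le_sup hk).trans hM)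
  filter_upwards [hWC M, h2] with n hn1 hn2
  exact h (W M n) hn1 fun k hk => hn2 k (Finset.mem_range.2 hk)

/-- The `Ḣˢ` Pythagorean relation for the extraction of one profile. The cross term is a matrix
coefficient of the shifted remainder, because the Fourier multiplier of `Ḣˢ` commutes with the
shifts. -/
theorem tendsto_hsNorm_sq_sub {s : ℝ} (h0 : 0 ≤ s) (h1 : s ≤ 1) {l : Filter ℕ} {w w' : ℕ → L2}
    {γ : ℕ → ℝ × Plane} {ψ : L2} (hw : ∀ n, w' n = w n - freqShift (γ n) ψ)
    (hlim : WeakLim l (fun n => freqShift (-γ n) (w' n)) 0) :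
    Tendsto (fun n => hsNorm s (bessel (w n)) ^ 2 -
      (hsNorm s (bessel ψ) ^ 2 + hsNorm s (bessel (w' n)) ^ 2)) l (𝓝 0) := by
  set T := mulOp (hsSymbol s) with hT
  have hm := memLp_top_hsSymbol h0 h1
  have h2 := (hlim (ContinuousLinearMap.adjoint T (T ψ)))
  rw [inner_zero_right] at h2
  have h3 := ((Complex.continuous_re.tendsto _).comp h2).const_mul 2
  rw [Complex.zero_re, mul_zero] at h3
  refine h3.congr fun n => ?_
  have h4 : w n = freqShift (γ n) ψ + w' n := by rw [hw]; abel
  rw [hsNorm_bessel_sq h0 h1, hsNorm_bessel_sq h0 h1, hsNorm_bessel_sq h0 h1, ← hT, h4, map_add,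
    norm_add_sq (𝕜 := ℂ), hT, mulOp_freqShift hm, ← hT, isMixingRep_freqShift.norm_map]
  rw [Function.comp_apply, ContinuousLinearMap.adjoint_inner_left, hT, mulOp_freqShift hm, ← hT,
    ← inner_freqShift_left, RCLike.re_eq_complex_re]
  ring

/-- A bounded sequence in `H¹` has a subsequence with a linear profile decomposition. -/
theorem exists_isLinearProfileDecomposition {a : ℝ} (ha : 4 < a) {φ : ℕ → L2}
    (hφ : ∀ n, MemH1 (φ n)) {C : ℝ} (hC : ∀ n, h1Norm (φ n) ≤ C) :
    ∃ (σ : ℕ → ℕ) (ψ : ℕ → L2) (t : ℕ → ℕ → ℝ) (x : ℕ → ℕ → Plane) (W : ℕ → ℕ → L2),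
      StrictMono σ ∧ IsLinearProfileDecomposition a (fun n => φ (σ n)) ψ t x W := by
  choose g hg using fun n => exists_bessel_eq (hφ n)
  have hgC : ∀ n, ‖g n‖ ≤ C := fun n => by rw [← h1Norm_bessel, ← hg]; exact hC n
  set 𝒰 : Ultrafilter ℕ := hyperfilter ℕ with h𝒰
  have h𝒰top : (𝒰 : Filter ℕ) ≤ atTop := Nat.hyperfilter_le_atTop
  obtain ⟨ψ, γ, W, hW0, hWsucc, hWB, hweak, hdiv, hWC, hsmall⟩ :=
    isMixingRep_freqShift.exists_profiles 𝒰 h𝒰top hgC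
  obtain ⟨ℓ, hℓ, hℓ0⟩ := exists_strichartzNorm_limits ha hWC hsmall
  have : Fact ((2 : ℝ≥0∞) ≠ ∞) := ⟨by simp⟩
  set d := TopologicalSpace.denseSeq L2 with hd
  -- the properties along the ultrafilter that have to be inherited by a subsequence
  let F : {p : ℕ × ℕ // p.1 < p.2} ⊕ (ℕ × ℕ) ⊕ ℕ → Filter ℕ := Sum.elim
    (fun p => comap (fun n => ‖γ p.1.1 n - γ p.1.2 n‖) atTop) (Sum.elim
      (fun p => comap (fun n => (inner ℂ (d p.2) (freqShift (-γ p.1 n) (W (p.1 + 1) n)) : ℂ)) (𝓝 0))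
      (fun M => comap (fun n => strichartzNorm a (fun τ => schrodinger τ (bessel (W M n))))
        (𝓝 (ℓ M))))
  have hFc : ∀ i, (F i).IsCountablyGenerated := by
    rintro (p | p | M)
    · exact comap.isCountablyGenerated _ _
    · exact comap.isCountablyGenerated _ _
    · exact comap.isCountablyGenerated _ _
  obtain ⟨σ, hσ, hσF⟩ := exists_strictMono_tendsto h𝒰top F (by
    rintro (p | p | M)
    · exact (hdiv p.1.1 p.1.2 p.2).le_comap
    · have := hweak p.1 (d p.2)
      rw [inner_zero_right] at this
      exact this.le_comap
    · exact (hℓ M).le_comap)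
  have hweak' : ∀ M, WeakLim atTop (fun n => freqShift (-γ M (σ n)) (W (M + 1) (σ n))) 0 := by
    intro M
    obtain ⟨B, hB⟩ := hWB (M + 1)
    refine WeakLim.of_denseRange (B := B) (fun n => ?_) (TopologicalSpace.denseRange_denseSeq L2)
      fun i => ?_
    · rw [isMixingRep_freqShift.norm_map]; exact hB _
    · have h := tendsto_comap_iff.1 (hσF (Sum.inr (Sum.inl (M, i))))
      exact h
  refine ⟨σ, fun j => bessel (ψ j), fun j n => (γ j (σ n)).1, fun j n => (γ j (σ n)).2,
    fun M n => bessel (W M (σ n)), hσ, ?_⟩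
  refine ⟨fun j => memH1_bessel _, fun M n => memH1_bessel _, fun M n => ?_, ?_, ⟨ℓ, fun M => ?_, hℓ0⟩,
    fun M s h0 h1 => ?_⟩
  · induction M with
    | zero => rw [Finset.sum_range_zero, zero_add, hW0, hg]
    | succ M ih =>
      rw [ih, Finset.sum_range_succ, translate_schrodinger_bessel, hWsucc, bessel_sub, add_assoc,
        Prod.mk.eta, add_sub_cancel]
  · have key : ∀ j k, j < k → Tendsto (fun n => |(γ j (σ n)).1 - (γ k (σ n)).1| +
        ‖(γ j (σ n)).2 - (γ k (σ n)).2‖) atTop atTop := by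
      intro j k hjk
      refine tendsto_atTop_mono (fun n => ?_) (tendsto_comap_iff.1 (hσF (Sum.inl ⟨(j, k), hjk⟩)))
      simp only [Function.comp_apply]
      rw [Prod.norm_def, Prod.fst_sub, Prod.snd_sub, Real.norm_eq_abs]
      exact max_le_add_of_nonneg (abs_nonneg _) (norm_nonneg _)
    intro j k hjk
    rcases hjk.lt_or_gt with h | h
    · exact key j k h
    · refine (key k j h).congr fun n => ?_
      rw [abs_sub_comm, norm_sub_rev]
  · have h := tendsto_comap_iff.1 (hσF (Sum.inr (Sum.inr M)))
    exact h
  · induction M with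
    | zero => simp [hW0, hg]
    | succ M ih =>
      have h2 := tendsto_hsNorm_sq_sub h0 h1 (fun n => hWsucc M (σ n)) (hweak' M)
      have h3 := ih.add h2
      rw [add_zero] at h3
      refine h3.congr fun n => ?_
      rw [Finset.sum_range_succ]
      ring

/-! ### The `L⁶` norm of waves with small Strichartz norm -/

/-- The Banach space `L⁶(ℝ²)`. -/
abbrev L6 : Type := Lp ℂ 6 (volume : Measure Plane)

instance fact_one_le_six : Fact ((1 : ℝ≥0∞) ≤ 6) := ⟨by norm_num⟩

theorem memLp_six_bessel (G : L2) : MemLp (bessel G) 6 volume := by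
  obtain ⟨K, hK, h⟩ := exists_eLpNorm_bessel_le (p := 6) (by norm_num) (by simp)
  exact ⟨Lp.aestronglyMeasurable _,
    (h G).trans_lt (ENNReal.mul_lt_top hK.lt_top ENNReal.ofReal_lt_top)⟩

/-- The Bessel potential as an element of `L⁶(ℝ²)`. -/
def besselSix (G : L2) : L6 := (memLp_six_bessel G).toLp

theorem coeFn_besselSix (G : L2) : besselSix G =ᵐ[volume] bessel G := MemLp.coeFn_toLp _

theorem besselSix_add (F G : L2) : besselSix (F + G) = besselSix F + besselSix G := by
  apply Lp.ext
  filter_upwards [coeFn_besselSix (F + G), coeFn_besselSix F, coeFn_besselSix G,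
    Lp.coeFn_add (besselSix F) (besselSix G), Lp.coeFn_add (bessel F) (bessel G)] with x h1 h2 h3 h4 h5
  rw [h1, h4, bessel_add, h5, Pi.add_apply, Pi.add_apply, h2, h3]

theorem besselSix_sub (F G : L2) : besselSix (F - G) = besselSix F - besselSix G := by
  rw [eq_sub_iff_add_eq, ← besselSix_add, sub_add_cancel]

theorem besselSix_sum {ι : Type*} (s : Finset ι) (F : ι → L2) :
    besselSix (∑ i ∈ s, F i) = ∑ i ∈ s, besselSix (F i) :=
  map_sum (AddMonoidHom.mk' besselSix besselSix_add) F s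

theorem norm_besselSix (G : L2) : ‖besselSix G‖ = (eLpNorm (bessel G) 6 volume).toReal :=
  Lp.norm_toLp _ _

theorem norm_besselSix_le {G : L2} {ε : ℝ} (hε : 0 ≤ ε)
    (h : eLpNorm (bessel G) 6 volume ≤ ENNReal.ofReal ε) : ‖besselSix G‖ ≤ ε := by
  rw [norm_besselSix]
  exact ENNReal.toReal_le_of_le_ofReal hε h

theorem exists_norm_besselSix_le : ∃ K : ℝ, 0 ≤ K ∧ ∀ G, ‖besselSix G‖ ≤ K * ‖G‖ := by
  obtain ⟨K, hK, h⟩ := exists_eLpNorm_bessel_le (p := 6) (by norm_num) (by simp)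
  refine ⟨K.toReal, ENNReal.toReal_nonneg, fun G => norm_besselSix_le (by positivity) ?_⟩
  rw [ENNReal.ofReal_mul ENNReal.toReal_nonneg, ENNReal.ofReal_toReal hK]
  exact h G

theorem L6.norm_pow_six (f : L6) : ‖f‖ ^ 6 = ∫ x, ‖f x‖ ^ 6 := by
  have h : 0 ≤ ∫ x, ‖f x‖ ^ 6 := integral_nonneg fun x => by positivity
  rw [Lp.norm_def, MemLp.eLpNorm_eq_integral_rpow_norm (by simp) (by simp) (Lp.memLp f),
    ENNReal.toReal_ofReal (by positivity)]
  simp only [ENNReal.toReal_ofNat]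
  have e : ∀ y : ℝ, y ^ (6 : ℝ) = y ^ 6 := fun y => by
    rw [← Real.rpow_natCast]; norm_num
  simp only [e]
  rw [← Real.rpow_natCast, ← Real.rpow_mul h]
  norm_num

theorem integral_norm_bessel_pow_six (G : L2) : ∫ x, ‖bessel G x‖ ^ 6 = ‖besselSix G‖ ^ 6 := by
  rw [L6.norm_pow_six]
  refine integral_congr_ae ?_
  filter_upwards [coeFn_besselSix G] with x h
  rw [h]

/-- The translate `f(· - y)` of an element of `L⁶(ℝ²)`. -/
def translateSix (y : Plane) (f : L6) : L6 :=
  Lp.compMeasurePreserving (fun x : Plane => x - y) (measurePreserving_sub_right volume y) f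

theorem coeFn_translateSix (y : Plane) (f : L6) :
    translateSix y f =ᵐ[volume] fun x => f (x - y) :=
  Lp.coeFn_compMeasurePreserving f _

theorem norm_translateSix_sub (y : Plane) (f g : L6) :
    ‖translateSix y f - translateSix y g‖ = ‖f - g‖ := by
  rw [translateSix, translateSix, ← map_sub, Lp.norm_compMeasurePreserving]

theorem norm_translateSix (y : Plane) (f : L6) : ‖translateSix y f‖ = ‖f‖ :=
  Lp.norm_compMeasurePreserving _ _

theorem besselSix_freqShift (t : ℝ) (y : Plane) (G : L2) :
    besselSix (freqShift (t, y) G) = translateSix y (besselSix (freqShift (t, 0) G)) := by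
  have h0 : bessel (freqShift (t, y) G) = translate y (bessel (freqShift (t, 0) G)) := by
    rw [← translate_schrodinger_bessel, schrodinger_bessel, neg_neg]
  apply Lp.ext
  have hq := (measurePreserving_sub_right (volume : Measure Plane) y).quasiMeasurePreserving.ae_eq
    (coeFn_besselSix (freqShift (t, 0) G))
  have hL2 : translate y (bessel (freqShift (t, 0) G)) =ᵐ[volume]
      fun x => bessel (freqShift (t, 0) G) (x - y) := Lp.coeFn_compMeasurePreserving _ _
  filter_upwards [coeFn_besselSix (freqShift (t, y) G), coeFn_translateSix y
    (besselSix (freqShift (t, 0) G)), hq, hL2] with x h1 h2 h3 h4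
  rw [h1, h0, h4, h2]
  exact h3.symm

theorem norm_besselSix_freqShift (t : ℝ) (y : Plane) (G : L2) :
    ‖besselSix (freqShift (t, y) G)‖ = ‖besselSix (freqShift (t, 0) G)‖ := by
  rw [besselSix_freqShift, norm_translateSix]

/-- Waves that are bounded in `H¹` are equicontinuous in time with values in `L^p`, because their
matrix coefficients are and these control the `L^p` norm. -/
theorem exists_eLpNorm_sub_le {p : ℝ≥0∞} (hp2 : 2 < p) (hp : p ≠ ∞) (C : ℝ) {ε : ℝ≥0∞}
    (hε : 0 < ε) : ∃ δ > 0, ∀ (G : L2) (t : ℝ), ‖G‖ ≤ C → |t| < δ →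
      eLpNorm (bessel (freqShift (t, 0) G - G)) p volume ≤ ε := by
  obtain ⟨N, η, hη, h⟩ := exists_eLpNorm_bessel_le_of_inner_le hp2 hp (2 * C) hε
  have h1 : ∀ k, Tendsto (fun t : ℝ => ‖freqShift (-t, 0) (annulusSymbol k) - annulusSymbol k‖ * C)
      (𝓝 0) (𝓝 0) := by
    intro k
    have hc : Continuous fun t : ℝ =>
        ‖freqShift (-t, 0) (annulusSymbol k) - annulusSymbol k‖ * C := by
      have := (isMixingRep_freqShift.continuous (annulusSymbol k)).comp
        (show Continuous fun t : ℝ => ((-t, 0) : ℝ × Plane) by fun_prop)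
      exact ((this.sub continuous_const).norm).mul continuous_const
    have h2 := hc.tendsto 0
    rwa [neg_zero, show ((0 : ℝ), (0 : Plane)) = 0 from rfl, freqShift_zero, sub_self, norm_zero,
      zero_mul] at h2
  have h3 : ∀ᶠ t : ℝ in 𝓝 0, ∀ k ∈ Finset.range N,
      ‖freqShift (-t, 0) (annulusSymbol k) - annulusSymbol k‖ * C < η :=
    (Filter.eventually_all_finset _).2 fun k _ => (h1 k).eventually_lt_const hη
  obtain ⟨δ, hδ, hball⟩ := Metric.eventually_nhds_iff.1 h3
  refine ⟨δ, hδ, fun G t hG ht => ?_⟩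
  have h4 := h (freqShift (t, 0) G - G) 0 ?_ fun k hk x => ?_
  · rwa [neg_zero, show ((0 : ℝ), (0 : Plane)) = 0 from rfl, freqShift_zero] at h4
  · refine (norm_sub_le _ _).trans ?_
    rw [norm_freqShift]
    linarith
  · have h5 : (inner ℂ (freqShift (0, x) (annulusSymbol k)) (freqShift (t, 0) G - G) : ℂ) =
        inner ℂ (freqShift (0, x) (freqShift (-t, 0) (annulusSymbol k) - annulusSymbol k)) G := by
      rw [inner_sub_right, map_sub, inner_sub_left, ← freqShift_add, inner_freqShift_left,
        ← freqShift_add, inner_freqShift_left _ _ G]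
      simp [inner_freqShift_left]
    rw [h5]
    refine (norm_inner_le_norm _ _).trans ?_
    rw [norm_freqShift]
    refine (mul_le_mul_of_nonneg_left hG (norm_nonneg _)).trans ?_
    exact (hball (by simpa using ht) k (Finset.mem_range.2 hk)).le

theorem mixedNorm_eight_le_strichartzNorm {a : ℝ} (ha : 4 < a) (ha' : a < 8) (u : ℝ → L2) :
    mixedNorm 8 8 u ≤ strichartzNorm a u := by
  refine le_iSup_of_le 8 (le_iSup_of_le 8 (le_iSup_of_le ⟨⟨?_, by norm_num, by norm_num, by simp⟩,
    ?_, ?_, ?_⟩ le_rfl))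
  · have h : (2 / 8 : ℝ≥0∞) = ENNReal.ofReal (2 / 8) := by
      rw [ENNReal.ofReal_div_of_pos (by norm_num)]; norm_num
    rw [h, ← ENNReal.ofReal_add (by norm_num) (by norm_num)]
    norm_num
  · rw [← ENNReal.ofReal_ofNat]; exact ENNReal.ofReal_le_ofReal ha'.le
  · rw [← ENNReal.ofReal_ofNat]; exact ENNReal.ofReal_le_ofReal ha'.le
  · rw [← ENNReal.ofReal_ofNat]
    refine ENNReal.ofReal_le_ofReal ?_
    rw [le_div_iff₀ (by linarith)]
    linarith

/-- A wave that is bounded in `H¹` and has a small Strichartz norm is small in `L⁸` at time zero: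
by equicontinuity it cannot be large at time zero without being large on a time interval of fixed
length. -/
theorem exists_eLpNorm_eight_le {a : ℝ} (ha : 4 < a) (ha' : a < 8) (C : ℝ) {ε : ℝ≥0∞}
    (hε : 0 < ε) (hεtop : ε ≠ ∞) : ∃ η : ℝ≥0∞, 0 < η ∧ ∀ G : L2, ‖G‖ ≤ C →
      strichartzNorm a (fun τ => schrodinger τ (bessel G)) < η →
      eLpNorm (bessel G) 8 volume ≤ ε + ε := by
  obtain ⟨δ, hδ, h⟩ := exists_eLpNorm_sub_le (p := 8) (by norm_num) (by simp) C hε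
  set I : Set ℝ := Set.Ioo 0 δ with hI
  have hIv : volume I = ENNReal.ofReal δ := by rw [hI, Real.volume_Ioo, sub_zero]
  refine ⟨eLpNorm (I.indicator fun _ : ℝ => ε) 8 volume, ?_, fun G hG hS => ?_⟩
  · rw [eLpNorm_indicator_const measurableSet_Ioo (by simp) (by simp), hIv, enorm_eq_self]
    refine ENNReal.mul_pos hε.ne' ?_
    exact (ENNReal.rpow_pos (ENNReal.ofReal_pos.2 hδ) ENNReal.ofReal_ne_top).ne'
  · by_contra! hlt
    refine absurd hS (not_lt.2 (le_trans ?_ (mixedNorm_eight_le_strichartzNorm ha ha' _)))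
    refine eLpNorm_mono_enorm fun t => ?_
    rw [enorm_eq_self, enorm_eq_self]
    by_cases ht : t ∈ I
    · rw [Set.indicator_of_mem ht]
      beta_reduce
      rw [schrodinger_bessel]
      have h1 : bessel G = bessel (freqShift (-t, 0) G) - bessel (freqShift (-t, 0) G - G) := by
        rw [← bessel_sub, sub_sub_cancel]
      have h2 : eLpNorm (bessel G) 8 volume ≤ eLpNorm (bessel (freqShift (-t, 0) G)) 8 volume + ε := by
        conv_lhs => rw [h1]
        rw [eLpNorm_congr_ae (Lp.coeFn_sub _ _)]
        refine (eLpNorm_sub_le (Lp.aestronglyMeasurable _) (Lp.aestronglyMeasurable _)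
          (by norm_num)).trans ?_
        gcongr
        refine h G (-t) hG ?_
        rw [abs_neg, abs_of_pos ht.1]
        exact ht.2
      exact ((ENNReal.add_lt_add_iff_right hεtop).1 (hlt.trans_le h2)).le
    · rw [Set.indicator_of_notMem ht]
      exact zero_le

theorem lintegral_pow_six_le {f : Plane → ℂ} (hf : AEStronglyMeasurable f) :
    ∫⁻ x, ‖f x‖ₑ ^ 6 ≤
      (∫⁻ x, ‖f x‖ₑ ^ 4) ^ (1 / 2 : ℝ) * (∫⁻ x, ‖f x‖ₑ ^ 8) ^ (1 / 2 : ℝ) := by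
  have h := ENNReal.lintegral_mul_le_Lp_mul_Lq (volume : Measure Plane) Real.HolderConjugate.two_two
    (hf.enorm.pow_const 2) (hf.enorm.pow_const 4)
  refine le_trans (le_of_eq ?_) (h.trans_eq ?_)
  · refine lintegral_congr fun x => ?_
    rw [Pi.mul_apply, ← pow_add]
  · norm_num [← pow_mul]

theorem lintegral_enorm_pow_eq {f : Plane → ℂ} {n : ℕ} (hn : n ≠ 0) :
    ∫⁻ x, ‖f x‖ₑ ^ n = eLpNorm f n volume ^ n := by
  have h0 : (n : ℝ) ≠ 0 := Nat.cast_ne_zero.2 hn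
  rw [eLpNorm_eq_lintegral_rpow_enorm_toReal (Nat.cast_ne_zero.2 hn) (ENNReal.natCast_ne_top n),
    ← ENNReal.rpow_natCast, ← ENNReal.rpow_mul, ENNReal.toReal_natCast, one_div_mul_cancel h0,
    ENNReal.rpow_one]
  simp only [ENNReal.rpow_natCast]

theorem eLpNorm_six_pow_le {f : Plane → ℂ} (hf : AEStronglyMeasurable f) :
    eLpNorm f 6 volume ^ 6 ≤ eLpNorm f 4 volume ^ 2 * eLpNorm f 8 volume ^ 4 := by
  have h := lintegral_pow_six_le hf
  rw [lintegral_enorm_pow_eq (by norm_num), lintegral_enorm_pow_eq (by norm_num),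
    lintegral_enorm_pow_eq (by norm_num), ← ENNReal.rpow_natCast_mul, ← ENNReal.rpow_natCast_mul,
    show ((4 : ℕ) : ℝ) * (1 / 2) = (2 : ℕ) by norm_num,
    show ((8 : ℕ) : ℝ) * (1 / 2) = (4 : ℕ) by norm_num, ENNReal.rpow_natCast,
    ENNReal.rpow_natCast] at h
  exact_mod_cast h

/-- A wave that is bounded in `H¹` and has a small Strichartz norm is small in `L⁶` at time zero. -/
theorem exists_norm_besselSix_le_of_strichartzNorm {a : ℝ} (ha : 4 < a) (ha' : a < 8) (C : ℝ)
    {ε : ℝ} (hε : 0 < ε) : ∃ η : ℝ≥0∞, 0 < η ∧ ∀ G : L2, ‖G‖ ≤ C →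
      strichartzNorm a (fun τ => schrodinger τ (bessel G)) < η → ‖besselSix G‖ ≤ ε := by
  obtain ⟨K, hK, h4⟩ := exists_eLpNorm_bessel_le (p := 4) (by norm_num) (by simp)
  set D : ℝ≥0∞ := (K * ENNReal.ofReal C) ^ 2 with hD
  have hDtop : D ≠ ∞ := ENNReal.pow_ne_top (ENNReal.mul_ne_top hK ENNReal.ofReal_ne_top)
  have h1 : Tendsto (fun e : ℝ≥0∞ => D * (e + e) ^ 4) (𝓝[>] 0) (𝓝 0) := by
    have h2 : Tendsto (fun e : ℝ≥0∞ => (e + e) ^ 4) (𝓝[>] 0) (𝓝 0) := by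
      have h5 : Continuous fun e : ℝ≥0∞ => (e + e) ^ 4 :=
        (ENNReal.continuous_pow 4).comp (continuous_id'.add continuous_id')
      simpa using (h5.tendsto 0).mono_left (nhdsWithin_le_nhds (s := Set.Ioi 0))
    have h3 := ENNReal.Tendsto.const_mul (a := D) h2 (Or.inr hDtop)
    rwa [mul_zero] at h3
  have hε6 : 0 < ENNReal.ofReal ε ^ 6 := ENNReal.pow_pos (ENNReal.ofReal_pos.2 hε) 6
  obtain ⟨e, ⟨he1, he2⟩, he0⟩ := (((h1.eventually_lt_const hε6).and
    (mem_nhdsWithin_of_mem_nhds (Iio_mem_nhds (ENNReal.zero_lt_top)))).and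
    self_mem_nhdsWithin).exists
  obtain ⟨η, hη, h⟩ := exists_eLpNorm_eight_le ha ha' C (show (0 : ℝ≥0∞) < e from he0)
    (ne_of_lt he2)
  refine ⟨η, hη, fun G hG hS => norm_besselSix_le hε.le ?_⟩
  refine le_of_not_gt fun hlt => ?_
  refine absurd (ENNReal.pow_right_strictMono (by norm_num : 6 ≠ 0) hlt) (not_lt.2 ?_)
  refine (eLpNorm_six_pow_le (Lp.aestronglyMeasurable _)).trans (le_trans ?_ he1.le)
  refine mul_le_mul' (pow_le_pow_left₀ zero_le ((h4 G).trans ?_) 2)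
    (pow_le_pow_left₀ zero_le (h G hG hS) 4)
  gcongr

/-! ### Decoupling of profiles in `L⁶` -/

/-- A wave is small in `L⁶` at all times that are far from zero. -/
theorem exists_norm_besselSix_freqShift_le (G : L2) {ε : ℝ} (hε : 0 < ε) :
    ∃ R : ℝ, ∀ (t : ℝ) (x : Plane), R < |t| → ‖besselSix (freqShift (t, x) G)‖ ≤ ε := by
  obtain ⟨N, δ, hδ, h⟩ := exists_eLpNorm_bessel_le_of_inner_le (p := 6) (by norm_num) (by simp) ‖G‖
    (ENNReal.ofReal_pos.2 hε)
  have h1 : ∀ᶠ γ in cocompact (ℝ × Plane), ∀ k ∈ Finset.range N,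
      ‖(inner ℂ (freqShift γ (annulusSymbol k)) G : ℂ)‖ < δ := by
    refine (Filter.eventually_all_finset _).2 fun k _ => ?_
    have h2 := (isMixingRep_freqShift.mixing (annulusSymbol k) G).norm
    rw [norm_zero] at h2
    exact h2.eventually_lt_const hδ
  rw [← Metric.cobounded_eq_cocompact, ← comap_norm_atTop] at h1
  obtain ⟨R, hR⟩ := eventually_atTop.1 (eventually_comap.1 h1)
  refine ⟨R, fun t x ht => norm_besselSix_le hε.le ?_⟩
  have h3 := h (freqShift (t, x) G) 0 (norm_freqShift _ _).le fun k hk y => ?_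
  · rwa [neg_zero, show ((0 : ℝ), (0 : Plane)) = 0 from rfl, freqShift_zero] at h3
  · have h4 : (inner ℂ (freqShift (0, y) (annulusSymbol k)) (freqShift (t, x) G) : ℂ) =
        inner ℂ (freqShift (-t, y - x) (annulusSymbol k)) G := by
      rw [inner_freqShift_left, inner_freqShift_left, ← freqShift_add]
      congr 3
      ext1 <;> simp [sub_eq_neg_add, add_comm]
    rw [h4]
    refine (hR _ ?_ _ rfl k (Finset.mem_range.2 hk)).le
    rw [Prod.norm_def]
    refine le_max_of_le_left ?_
    rw [Real.norm_eq_abs, abs_neg]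
    exact ht.le

theorem L6.exists_norm_sub_le (f : L6) {ε : ℝ} (hε : 0 < ε) :
    ∃ (g : L6) (R : ℝ), ‖f - g‖ ≤ ε ∧ ∀ᵐ x, R < ‖x‖ → g x = 0 := by
  obtain ⟨g, hgc, hg, -, hgm⟩ := (Lp.memLp f).exists_hasCompactSupport_eLpNorm_sub_le (by simp)
    (ENNReal.ofReal_pos.2 hε).ne'
  obtain ⟨R, hR⟩ := hgc.isCompact.isBounded.exists_norm_le
  refine ⟨hgm.toLp, R, ?_, ?_⟩
  · rw [Lp.norm_def]
    refine ENNReal.toReal_le_of_le_ofReal hε.le (le_trans (le_of_eq (eLpNorm_congr_ae ?_)) hg)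
    filter_upwards [Lp.coeFn_sub f hgm.toLp, hgm.coeFn_toLp] with x h1 h2
    rw [h1, Pi.sub_apply, h2, Pi.sub_apply]
  · filter_upwards [hgm.coeFn_toLp] with x h1 h2
    rw [h1]
    by_contra h3
    exact absurd (hR x (subset_tsupport _ h3)) (not_le.2 h2)

/-- Along an ultrafilter, a moving profile is close in `L⁶` to the translates of one compactly
supported function, which vanishes unless the times stay bounded. -/
theorem exists_approx_besselSix {𝒰 : Ultrafilter ℕ} (G : L2) (t : ℕ → ℝ) (x : ℕ → Plane) {ε : ℝ}
    (hε : 0 < ε) : ∃ (g : L6) (R : ℝ), (∀ᵐ y, R < ‖y‖ → g y = 0) ∧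
      (g = 0 ∨ ∃ T, ∀ᶠ n in (𝒰 : Filter ℕ), |t n| ≤ T) ∧
      ∀ᶠ n in (𝒰 : Filter ℕ), ‖besselSix (freqShift (t n, x n) G) - translateSix (x n) g‖ ≤ ε := by
  by_cases hT : ∃ T, ∀ᶠ n in (𝒰 : Filter ℕ), |t n| ≤ T
  · obtain ⟨T, hT'⟩ := hT
    obtain ⟨s, -, hs⟩ := (isCompact_Icc (a := -T) (b := T)).ultrafilter_le_nhds (𝒰.map t) (by
      rw [le_principal_iff]
      exact Filter.Eventually.mono (f := (𝒰 : Filter ℕ)) hT' fun n hn => abs_le.1 hn)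
    have hs' : Tendsto t 𝒰 (𝓝 s) := hs
    obtain ⟨g, R, hg, hR⟩ := L6.exists_norm_sub_le (besselSix (freqShift (s, 0) G)) (half_pos hε)
    refine ⟨g, R, hR, Or.inr ⟨T, hT'⟩, ?_⟩
    obtain ⟨K, hK, hbound⟩ := exists_norm_besselSix_le
    have h1 : Tendsto (fun n => K * ‖freqShift (t n, 0) G - freqShift (s, 0) G‖) 𝒰 (𝓝 0) := by
      have h2 : Continuous fun r : ℝ => K * ‖freqShift (r, 0) G - freqShift (s, 0) G‖ :=
        continuous_const.mul (((isMixingRep_freqShift.continuous G).comp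
          (show Continuous fun r : ℝ => ((r, 0) : ℝ × Plane) by fun_prop)).sub continuous_const).norm
      have h3 := (h2.tendsto s).comp hs'
      rwa [sub_self, norm_zero, mul_zero] at h3
    filter_upwards [h1.eventually_lt_const (half_pos hε)] with n hn
    rw [besselSix_freqShift, norm_translateSix_sub]
    have h4 := hbound (freqShift (t n, 0) G - freqShift (s, 0) G)
    rw [besselSix_sub] at h4
    have h5 := norm_sub_le_norm_sub_add_norm_sub (besselSix (freqShift (t n, 0) G))
      (besselSix (freqShift (s, 0) G)) g
    linarith
  · obtain ⟨R, hR⟩ := exists_norm_besselSix_freqShift_le G hε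
    refine ⟨0, 0, ?_, Or.inl rfl, ?_⟩
    · filter_upwards [Lp.coeFn_zero ℂ 6 (volume : Measure Plane)] with y hy _
      exact hy
    · have h1 : ∀ᶠ n in (𝒰 : Filter ℕ), ¬|t n| ≤ R :=
        Ultrafilter.eventually_not.2 fun h => hT ⟨R, h⟩
      filter_upwards [h1] with n hn
      rw [translateSix, map_zero, sub_zero]
      exact hR _ _ (not_le.1 hn)

theorem L6.norm_sum_pow_six_of_disjoint {ι : Type*} (s : Finset ι) (f : ι → L6)
    (h : ∀ i ∈ s, ∀ j ∈ s, i ≠ j → ∀ᵐ x, f i x = 0 ∨ f j x = 0) :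
    ‖∑ i ∈ s, f i‖ ^ 6 = ∑ i ∈ s, ‖f i‖ ^ 6 := by
  simp only [L6.norm_pow_six]
  have hint : ∀ i ∈ s, Integrable (fun x => ‖f i x‖ ^ 6) (volume : Measure Plane) := fun i _ =>
    (Lp.memLp (f i)).integrable_norm_pow (by norm_num)
  rw [← integral_finsetSum s hint]
  refine integral_congr_ae ?_
  have h1 : ∀ᵐ x, ∀ i ∈ s, ∀ j ∈ s, i ≠ j → f i x = 0 ∨ f j x = 0 := by
    refine (Finset.eventually_all s).2 fun i hi => (Finset.eventually_all s).2 fun j hj => ?_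
    by_cases hij : i = j
    · exact Eventually.of_forall fun x h' => absurd hij h'
    · exact (h i hi j hj hij).mono fun x hx _ => hx
  filter_upwards [h1, Lp.coeFn_finsetSum s f] with x hx hsum
  rw [hsum, Finset.sum_apply]
  by_cases h0 : ∃ i ∈ s, f i x ≠ 0
  · obtain ⟨i, hi, hi0⟩ := h0
    have h2 : ∀ j ∈ s, j ≠ i → f j x = 0 := fun j hj hji =>
      (hx j hj i hi hji).resolve_right hi0
    rw [Finset.sum_eq_single_of_mem i hi h2, Finset.sum_eq_single_of_mem i hi fun j hj hji => by
      rw [h2 j hj hji]; simp]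
  · push Not at h0
    rw [Finset.sum_eq_zero h0, Finset.sum_eq_zero fun j hj => by rw [h0 j hj]; simp]
    simp

theorem abs_pow_six_sub_le {a b B : ℝ} (ha0 : 0 ≤ a) (hb0 : 0 ≤ b) (ha : a ≤ B) (hb : b ≤ B) :
    |a ^ 6 - b ^ 6| ≤ 6 * B ^ 5 * |a - b| := by
  have h := abs_pow_sub_pow_le a b 6
  rw [abs_of_nonneg ha0, abs_of_nonneg hb0] at h
  refine h.trans ?_
  have h1 : max a b ^ 5 ≤ B ^ 5 := pow_le_pow_left₀ (le_max_of_le_left ha0) (max_le ha hb) 5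
  calc |a - b| * 6 * max a b ^ 5 ≤ |a - b| * 6 * B ^ 5 := by gcongr
    _ = _ := by ring

/-- The sixth powers of the `L⁶` norms of diverging profiles decouple. -/
theorem tendsto_norm_sum_besselSix_pow_six (Ψ : ℕ → L2) (t : ℕ → ℕ → ℝ) (x : ℕ → ℕ → Plane)
    (hdiv : ∀ j k, j ≠ k → Tendsto (fun n => |t j n - t k n| + ‖x j n - x k n‖) atTop atTop)
    (s : Finset ℕ) :
    Tendsto (fun n => ‖∑ j ∈ s, besselSix (freqShift (t j n, x j n) (Ψ j))‖ ^ 6 -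
      ∑ j ∈ s, ‖besselSix (freqShift (t j n, x j n) (Ψ j))‖ ^ 6) atTop (𝓝 0) := by
  rw [tendsto_iff_ultrafilter]
  intro 𝒰 h𝒰
  obtain ⟨K, hK, hbound⟩ := exists_norm_besselSix_le
  set A : ℕ → ℕ → L6 := fun j n => besselSix (freqShift (t j n, x j n) (Ψ j)) with hA
  have hAK : ∀ j n, ‖A j n‖ ≤ K * ‖Ψ j‖ := fun j n => by
    have := hbound (freqShift (t j n, x j n) (Ψ j))
    rwa [norm_freqShift] at this
  set B : ℝ := ∑ j ∈ s, (K * ‖Ψ j‖ + 1) with hB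
  have hB0 : 0 ≤ B := Finset.sum_nonneg fun j _ => by positivity
  set c : ℝ := (s.card : ℝ) with hc
  -- the total error for profiles approximated to within `ε`
  have hE : Tendsto (fun ε : ℝ => 2 * (6 * B ^ 5 * (c * ε))) (𝓝[>] 0) (𝓝 0) := by
    have h1 : Continuous fun ε : ℝ => 2 * (6 * B ^ 5 * (c * ε)) := by fun_prop
    simpa using (h1.tendsto 0).mono_left (nhdsWithin_le_nhds (s := Set.Ioi 0))
  rw [Metric.tendsto_nhds]
  intro η hη
  obtain ⟨ε, ⟨hε1, hε2⟩, hε0⟩ := (((hE.eventually_lt_const hη).and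
    (mem_nhdsWithin_of_mem_nhds (Iio_mem_nhds one_pos))).and self_mem_nhdsWithin).exists
  have hε0 : 0 < ε := hε0
  have hε2 : ε < 1 := hε2
  choose g R hgR hgT hg using fun j =>
    exists_approx_besselSix (𝒰 := 𝒰) (Ψ j) (t j) (x j) hε0
  have hdisj : ∀ᶠ n in (𝒰 : Filter ℕ), ∀ i ∈ s, ∀ j ∈ s, i ≠ j →
      ∀ᵐ y, translateSix (x i n) (g i) y = 0 ∨ translateSix (x j n) (g j) y = 0 := by
    refine (Filter.eventually_all_finset s).2 fun i _ =>
      (Filter.eventually_all_finset s).2 fun j _ => ?_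
    by_cases hij : i = j
    · exact Eventually.of_forall fun n h => absurd hij h
    have hzero : ∀ y : Plane, (translateSix y 0 : L6) = 0 := fun y => map_zero _
    have h0 := Lp.coeFn_zero ℂ 6 (volume : Measure Plane)
    rcases hgT i with hi | ⟨Ti, hi⟩
    · refine Eventually.of_forall fun n _ => ?_
      rw [hi, hzero]
      filter_upwards [h0] with y hy
      exact Or.inl hy
    rcases hgT j with hj | ⟨Tj, hj⟩
    · refine Eventually.of_forall fun n _ => ?_
      rw [hj, hzero]
      filter_upwards [h0] with y hy
      exact Or.inr hy
    -- both times are bounded, so the centres diverge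
    filter_upwards [hi, hj, ((hdiv i j hij).mono_left h𝒰).eventually_gt_atTop
      (Ti + Tj + (R i + R j))] with n hin hjn hn _
    have hx : R i + R j < ‖x i n - x j n‖ := by
      have := abs_sub (t i n) (t j n)
      linarith
    have q : ∀ k, ∀ᵐ y, R k < ‖y - x k n‖ → translateSix (x k n) (g k) y = 0 := by
      intro k
      have h1 := (measurePreserving_sub_right (volume : Measure Plane)
        (x k n)).quasiMeasurePreserving.ae (hgR k)
      filter_upwards [h1, coeFn_translateSix (x k n) (g k)] with y hy1 hy2 hy3
      rw [hy2]
      exact hy1 hy3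
    filter_upwards [q i, q j] with y hyi hyj
    by_cases h1 : R i < ‖y - x i n‖
    · exact Or.inl (hyi h1)
    · refine Or.inr (hyj ?_)
      have h2 := norm_sub_le_norm_sub_add_norm_sub (x i n) y (x j n)
      rw [norm_sub_rev (x i n) y] at h2
      linarith
  have hall : ∀ᶠ n in (𝒰 : Filter ℕ), ∀ j ∈ s, ‖A j n - translateSix (x j n) (g j)‖ ≤ ε :=
    (Filter.eventually_all_finset s).2 fun j _ => hg j
  filter_upwards [hdisj, hall] with n hn1 hn2
  set v : ℕ → L6 := fun j => translateSix (x j n) (g j) with hv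
  have hvB : ∀ j ∈ s, ‖v j‖ ≤ K * ‖Ψ j‖ + 1 := fun j hj => by
    have h1 := norm_sub_norm_le (v j) (A j n)
    rw [norm_sub_rev] at h1
    linarith [hn2 j hj, hAK j n]
  have hle : ∀ j ∈ s, K * ‖Ψ j‖ + 1 ≤ B := fun j hj =>
    Finset.single_le_sum (f := fun j => K * ‖Ψ j‖ + 1) (fun j _ => by positivity) hj
  have e1 : |‖∑ j ∈ s, A j n‖ ^ 6 - ‖∑ j ∈ s, v j‖ ^ 6| ≤ 6 * B ^ 5 * (c * ε) := by
    refine (abs_pow_six_sub_le (norm_nonneg _) (norm_nonneg _)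
      ((norm_sum_le _ _).trans (Finset.sum_le_sum fun j _ => (hAK j n).trans (by linarith)))
      ((norm_sum_le _ _).trans (Finset.sum_le_sum hvB))).trans ?_
    refine mul_le_mul_of_nonneg_left ?_ (by positivity)
    refine (abs_norm_sub_norm_le _ _).trans ?_
    rw [← Finset.sum_sub_distrib]
    refine (norm_sum_le _ _).trans ((Finset.sum_le_sum hn2).trans_eq ?_)
    rw [Finset.sum_const, nsmul_eq_mul]
  have e2 : |∑ j ∈ s, ‖v j‖ ^ 6 - ∑ j ∈ s, ‖A j n‖ ^ 6| ≤ 6 * B ^ 5 * (c * ε) := by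
    rw [← Finset.sum_sub_distrib]
    have h1 : ∀ j ∈ s, |‖v j‖ ^ 6 - ‖A j n‖ ^ 6| ≤ 6 * B ^ 5 * ε := fun j hj => by
      refine (abs_pow_six_sub_le (norm_nonneg _) (norm_nonneg _) ((hvB j hj).trans (hle j hj))
        ((hAK j n).trans (le_trans (by linarith) (hle j hj)))).trans ?_
      refine mul_le_mul_of_nonneg_left ?_ (by positivity)
      refine (abs_norm_sub_norm_le _ _).trans ?_
      rw [norm_sub_rev]
      exact hn2 j hj
    refine (Finset.abs_sum_le_sum_abs _ _).trans ((Finset.sum_le_sum h1).trans_eq ?_)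
    rw [Finset.sum_const, nsmul_eq_mul]
    ring
  have e3 := L6.norm_sum_pow_six_of_disjoint s v hn1
  rw [Real.dist_eq, sub_zero]
  refine lt_of_le_of_lt ?_ hε1
  rw [e3] at e1
  have e4 := abs_sub_le (‖∑ j ∈ s, A j n‖ ^ 6) (∑ j ∈ s, ‖v j‖ ^ 6) (∑ j ∈ s, ‖A j n‖ ^ 6)
  linarith

/-! ### The energy expansion -/

theorem hsNorm_freqShift_sq {s : ℝ} (h0 : 0 ≤ s) (h1 : s ≤ 1) (γ : ℝ × Plane) (G : L2) :
    hsNorm s (bessel (freqShift γ G)) ^ 2 = hsNorm s (bessel G) ^ 2 := by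
  rw [hsNorm_bessel_sq h0 h1, hsNorm_bessel_sq h0 h1, mulOp_freqShift (memLp_top_hsSymbol h0 h1),
    norm_freqShift]

theorem energy_bessel (G : L2) :
    energy (bessel G) = (1 / 2) * hsNorm 1 (bessel G) ^ 2 - (1 / 6) * ‖besselSix G‖ ^ 6 := by
  rw [energy, gradNormSq_eq_hsNorm_sq (memH1_bessel G), integral_norm_bessel_pow_six]

theorem energy_schrodinger_bessel (t : ℝ) (y : Plane) (G : L2) :
    energy (schrodinger (-t) (bessel G)) =
      (1 / 2) * hsNorm 1 (bessel G) ^ 2 - (1 / 6) * ‖besselSix (freqShift (t, y) G)‖ ^ 6 := by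
  rw [schrodinger_bessel, neg_neg, energy_bessel, hsNorm_freqShift_sq zero_le_one le_rfl,
    norm_besselSix_freqShift t y]

/-- The remainders are bounded in `H¹`, because their norms obey the Pythagorean expansion. -/
theorem eventually_norm_remainder_le {g : ℕ → L2} {C : ℝ} (hg : ∀ n, ‖g n‖ ≤ C) {w : ℕ → L2}
    {c : ℝ → ℝ} (hc : ∀ s, 0 ≤ c s)
    (h : ∀ s : ℝ, 0 ≤ s → s ≤ 1 → Tendsto (fun n => hsNorm s (bessel (g n)) ^ 2 -
      (c s + hsNorm s (bessel (w n)) ^ 2)) atTop (𝓝 0)) :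
    ∀ᶠ n in atTop, ‖w n‖ ≤ C + 1 := by
  have e : ∀ G : L2, ‖G‖ ^ 2 = hsNorm 0 (bessel G) ^ 2 + hsNorm 1 (bessel G) ^ 2 := fun G => by
    rw [← h1Norm_bessel G, h1Norm_sq_eq (memH1_bessel G)]
  have hC : 0 ≤ C := (norm_nonneg _).trans (hg 0)
  filter_upwards [(h 0 le_rfl zero_le_one).eventually_const_lt (u := -(1 / 2)) (by norm_num),
    (h 1 zero_le_one le_rfl).eventually_const_lt (u := -(1 / 2)) (by norm_num)] with n h0 h1
  have h2 : ‖w n‖ ^ 2 ≤ C ^ 2 + 1 := by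
    have h3 : ‖g n‖ ^ 2 ≤ C ^ 2 := pow_le_pow_left₀ (norm_nonneg _) (hg n) 2
    rw [e] at h3 ⊢
    linarith [hc 0, hc 1]
  refine le_of_sq_le_sq (h2.trans (by nlinarith)) (by linarith)

/-- If the remainders of a decomposition into decoupling profiles are eventually small in `L⁶`, the
sixth powers of the `L⁶` norms expand. -/
theorem tendsto_norm_pow_six_sub {g : ℕ → L6} {A : ℕ → ℕ → L6} {w : ℕ → ℕ → L6} {B : ℝ}
    (hdec : ∀ M n, g n = ∑ j ∈ Finset.range M, A j n + w M n)
    (hg : ∀ n, ‖g n‖ ≤ B) (hw : ∀ M, ∀ᶠ n in atTop, ‖w M n‖ ≤ B)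
    (hsmall : ∀ ε > 0, ∃ M₀, ∀ M ≥ M₀, ∀ᶠ n in atTop, ‖w M n‖ ≤ ε)
    (hA : ∀ s : Finset ℕ, Tendsto (fun n => ‖∑ j ∈ s, A j n‖ ^ 6 - ∑ j ∈ s, ‖A j n‖ ^ 6)
      atTop (𝓝 0)) (M : ℕ) :
    Tendsto (fun n => ‖g n‖ ^ 6 - (∑ j ∈ Finset.range M, ‖A j n‖ ^ 6 + ‖w M n‖ ^ 6)) atTop
      (𝓝 0) := by
  have hB : 0 ≤ B := (norm_nonneg _).trans (hg 0)
  rw [Metric.tendsto_nhds]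
  intro η hη
  obtain ⟨ε, hε, hε1⟩ : ∃ ε > 0, 12 * (2 * B) ^ 5 * ε < η / 2 := by
    have h1 : Continuous fun ε : ℝ => 12 * (2 * B) ^ 5 * ε := by fun_prop
    have h2 := (h1.tendsto 0).mono_left (nhdsWithin_le_nhds (s := Set.Ioi 0))
    rw [mul_zero] at h2
    obtain ⟨ε, h3, h4⟩ := ((h2.eventually_lt_const (half_pos hη)).and self_mem_nhdsWithin).exists
    exact ⟨ε, h4, h3⟩
  obtain ⟨M₀, hM₀⟩ := hsmall ε hε
  set N := max M M₀ with hN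
  have hMN : M ≤ N := le_max_left _ _
  have hη4 : 0 < η / 4 := by linarith
  filter_upwards [hM₀ N (le_max_right _ _), hw M, hw N,
    ((hA (Finset.range N)).abs.eventually_lt_const (u := η / 4) (by simpa using hη4)),
    ((hA (Finset.Ico M N)).abs.eventually_lt_const (u := η / 4) (by simpa using hη4))]
    with n h1 h2 h3 h4 h5
  have d1 : ∑ j ∈ Finset.range N, A j n = g n - w N n := by rw [hdec N n, add_sub_cancel_right]
  have d2 : ∑ j ∈ Finset.Ico M N, A j n = w M n - w N n := by
    rw [Finset.sum_Ico_eq_sub _ hMN, d1, hdec M n]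
    abel
  have d3 := Finset.sum_range_add_sum_Ico (fun j => ‖A j n‖ ^ 6) hMN
  have key : ∀ u : L6, ‖u‖ ≤ B → |‖u‖ ^ 6 - ‖u - w N n‖ ^ 6| ≤ 6 * (2 * B) ^ 5 * ε := by
    intro u hu
    have hu2 : ‖u‖ ≤ 2 * B := by linarith
    have huw : ‖u - w N n‖ ≤ 2 * B := (norm_sub_le u (w N n)).trans (by linarith)
    refine (abs_pow_six_sub_le (norm_nonneg _) (norm_nonneg _) hu2 huw).trans ?_
    refine mul_le_mul_of_nonneg_left ?_ (by positivity)
    refine (abs_norm_sub_norm_le _ _).trans ?_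
    rwa [sub_sub_cancel]
  have k1 := key (g n) (hg n)
  have k2 := key (w M n) h2
  rw [d1] at h4
  rw [d2] at h5
  rw [Real.dist_eq, sub_zero]
  rw [abs_le] at k1 k2
  rw [abs_lt] at h4 h5 ⊢
  constructor <;> linarith [k1.1, k1.2, k2.1, k2.2, h4.1, h4.2, h5.1, h5.2]

/-- The energy of a bounded sequence in `H¹` expands along each of its linear profile
decompositions. -/
theorem IsLinearProfileDecomposition.tendsto_energy_sub {a : ℝ} (ha : 4 < a) (ha' : a < 8)
    {φ : ℕ → L2} (hφ : ∀ n, MemH1 (φ n)) {C : ℝ} (hC : ∀ n, h1Norm (φ n) ≤ C) {ψ : ℕ → L2}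
    {t : ℕ → ℕ → ℝ} {x : ℕ → ℕ → Plane} {W : ℕ → ℕ → L2}
    (hd : IsLinearProfileDecomposition a φ ψ t x W) (M : ℕ) :
    Tendsto (fun n => energy (φ n) - (∑ j ∈ Finset.range M, energy (schrodinger (-(t j n)) (ψ j)) +
      energy (W M n))) atTop (𝓝 0) := by
  choose g hg using fun n => exists_bessel_eq (hφ n)
  choose Ψ hΨ using fun j => exists_bessel_eq (hd.profile_memH1 j)
  choose w hw using fun M n => exists_bessel_eq (hd.remainder_memH1 M n)
  have hgC : ∀ n, ‖g n‖ ≤ C := fun n => by rw [← h1Norm_bessel, ← hg]; exact hC n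
  have hpyth : ∀ M, ∀ s : ℝ, 0 ≤ s → s ≤ 1 → Tendsto (fun n => hsNorm s (bessel (g n)) ^ 2 -
      (∑ j ∈ Finset.range M, hsNorm s (bessel (Ψ j)) ^ 2 + hsNorm s (bessel (w M n)) ^ 2))
      atTop (𝓝 0) := by
    intro M s h0 h1
    simp only [← hg, ← hΨ, ← hw]
    exact hd.pythagorean M s h0 h1
  have hwC : ∀ M, ∀ᶠ n in atTop, ‖w M n‖ ≤ C + 1 := fun M =>
    eventually_norm_remainder_le hgC
      (c := fun s => ∑ j ∈ Finset.range M, hsNorm s (bessel (Ψ j)) ^ 2)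
      (fun s => Finset.sum_nonneg fun j _ => sq_nonneg _) (hpyth M)
  obtain ⟨K, hK, hbound⟩ := exists_norm_besselSix_le
  obtain ⟨ℓ, hℓ, hℓ0⟩ := hd.smallness
  have h6 := tendsto_norm_pow_six_sub (g := fun n => besselSix (g n))
    (A := fun j n => besselSix (freqShift (t j n, x j n) (Ψ j)))
    (w := fun M n => besselSix (w M n)) (B := K * (C + 1)) (fun M n => ?_)
    (fun n => (hbound _).trans (mul_le_mul_of_nonneg_left ((hgC n).trans (by linarith)) hK))
    (fun M => (hwC M).mono fun n hn => (hbound _).trans (mul_le_mul_of_nonneg_left hn hK))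
    (fun ε hε => ?_) (tendsto_norm_sum_besselSix_pow_six Ψ t x hd.divergence) M
  · have h2 := hpyth M 1 zero_le_one le_rfl
    have h3 := (h2.const_mul (1 / 2)).sub (h6.const_mul (1 / 6))
    rw [mul_zero, mul_zero, sub_zero] at h3
    refine h3.congr fun n => ?_
    simp only [hg, hΨ, hw]
    rw [Finset.sum_congr rfl fun j _ => energy_schrodinger_bessel (t j n) (x j n) (Ψ j),
      Finset.sum_sub_distrib, ← Finset.mul_sum, ← Finset.mul_sum, energy_bessel, energy_bessel]
    ring
  · have hinj : Function.Injective bessel := fun F G h => by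
      rw [← sub_eq_zero, ← norm_eq_zero, ← h1Norm_bessel, bessel_sub, h, ← bessel_sub,
        h1Norm_bessel, sub_self, norm_zero]
    have hsum : ∀ F : ℕ → L2, bessel (∑ j ∈ Finset.range M, F j) =
        ∑ j ∈ Finset.range M, bessel (F j) := fun F =>
      map_sum (AddMonoidHom.mk' bessel bessel_add) F _
    have h1 : g n = ∑ j ∈ Finset.range M, freqShift (t j n, x j n) (Ψ j) + w M n := by
      apply hinj
      rw [bessel_add, hsum, ← hg, ← hw, hd.decomposition M n]
      congr 1
      refine Finset.sum_congr rfl fun j _ => ?_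
      rw [← translate_schrodinger_bessel, ← hΨ]
    rw [h1, besselSix_add, besselSix_sum]
  · obtain ⟨η, hη, h⟩ := exists_norm_besselSix_le_of_strichartzNorm ha ha' (C + 1) hε
    obtain ⟨M₀, hM₀⟩ := eventually_atTop.1 (hℓ0.eventually_lt_const hη)
    refine ⟨M₀, fun M hM => ?_⟩
    filter_upwards [(hℓ M).eventually_lt_const (hM₀ M hM), hwC M] with n h1 h2
    refine h (w M n) h2 ?_
    rw [← hw]
    exact h1

end ProfileDecomposition

end

theorem mainTheorem3 (a : ℝ) (ha : 4 < a) (ha' : a < 8)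
    (φ : ℕ → ProfileDecomposition.L2)
    (hφ : ∀ n, ProfileDecomposition.MemH1 (φ n))
    (hbdd : ∃ C : ℝ, ∀ n, ProfileDecomposition.h1Norm (φ n) ≤ C) :
    (∃ (σ : ℕ → ℕ) (ψ : ℕ → ProfileDecomposition.L2) (t : ℕ → ℕ → ℝ)
      (x : ℕ → ℕ → ProfileDecomposition.Plane) (W : ℕ → ℕ → ProfileDecomposition.L2),
      StrictMono σ ∧
      ProfileDecomposition.IsLinearProfileDecomposition a (fun n => φ (σ n)) ψ t x W) ∧
    (∀ (σ : ℕ → ℕ) (ψ : ℕ → ProfileDecomposition.L2) (t : ℕ → ℕ → ℝ)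
      (x : ℕ → ℕ → ProfileDecomposition.Plane) (W : ℕ → ℕ → ProfileDecomposition.L2),
      StrictMono σ →
      ProfileDecomposition.IsLinearProfileDecomposition a (fun n => φ (σ n)) ψ t x W →
      ∀ M : ℕ, Tendsto (fun n => ProfileDecomposition.energy (φ (σ n)) -
        (∑ j ∈ Finset.range M,
            ProfileDecomposition.energy (ProfileDecomposition.schrodinger (-(t j n)) (ψ j)) +
          ProfileDecomposition.energy (W M n))) atTop (𝓝 0)) := by
  obtain ⟨C, hC⟩ := hbdd
  exact ⟨ProfileDecomposition.exists_isLinearProfileDecomposition ha hφ hC,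
    fun σ ψ t x W _ hd M => hd.tendsto_energy_sub ha ha' (fun n => hφ (σ n)) (fun n => hC (σ n)) M⟩
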